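/- Let $\mathcal Y,\mathcal A\subseteq\mathbb R$ and $\mathcal W\subseteq\mathbb R^p$, and let $O=(Y,A,W)$. For a probability distribution $P$ on $\mathcal Y\times\mathcal A\times\mathcal W$ let $F_P$ be the marginal distribution of $A$ (and also its distribution function), $\mathcal A_P$ the support of $F_P$, $Q_P$ the marginal distribution of $W$, $G_P(da,w)$ the conditional distribution of $A$ given $W=w$, $g_P(a,w)=G_P(da,w)/F_P(da)$ its density with respect to $F_P$ when $G_P(\cdot,w)\ll F_P$ for $Q_P$-almost every $w$, $\mu_P(a,w)=E_P[Y\mid A=a,W=w]$, $\theta_P(a)=\int\mu_P(a,w)\,Q_P(dw)$, $\gamma_P=\int\theta_P\,dF_P$, $\Gamma_P(a)=\int_{(-\infty,a]}\theta_P\,dF_P$ and $$\Omega_P(a)=\Gamma_P(a)-\gamma_P F_P(a).$$ Let $\mathcal M$ be the set of such $P$ for which $\theta_P$ has a version that is continuous and bounded on $\mathcal A_P$. Let $\mathcal M^\circ$ be the set of $P\in\mathcal M$ for which $E_P[Y^2]<\infty$, $g_P$ exists, and, for some $\eta>0$, $g_P\ge\eta$ holds $F_P\otimes Q_P$-almost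 everywhere. A regular path through $P_0$ is a family $(P_\varepsilon)_{|\varepsilon|\le\delta}$ in $\mathcal M^\circ$, $\delta>0$, passing through $P_0$ at $\varepsilon=0$, such that for some $\eta>0$ and $C<\infty$, and all $|\varepsilon|\le\delta$, $g_{P_\varepsilon}\ge\eta$ holds $F_{P_\varepsilon}\otimes Q_{P_\varepsilon}$-almost everywhere and $E_{P_\varepsilon}[Y^2]\le C$. It is differentiable in quadratic mean with score $h\in L^2(P_0)$ if $$\int\Big[\frac{dP_\varepsilon^{1/2}-dP_0^{1/2}}{\varepsilon}-\tfrac12\,h\,dP_0^{1/2}\Big]^2\to0\qquad(\varepsilon\to0).$$ The tangent space at $P_0$ is the closed linear span in $L^2(P_0)$ of the scores of all such paths. Then, for every $P_0\in\mathcal M^\circ$ and every $a_0\in\mathbb R$, the parameter $P\mapsto\Omega_P(a_0)$ is pathwise differentiable at $P_0$ relative to these paths: there is a continuous linear functional $L$ on the tangent space such that $\frac{d}{d\varepsilon}\Omega_{P_\varepsilon}(a_0)\big|_{\varepsilon=0}$ exists and equals $L(h)$ for every regular path that is differentiable in quadratic mean with score $h$. Writing $F_0$, $\mu_0$, $g_0$,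 $\theta_0$, $\gamma_0$, $\Omega_0$ for the above quantities at $P=P_0$, its efficient influence function is $$D^*_{a_0,0}(y,a,w)=\big[I_{(-\infty,a_0]}(a)-F_0(a_0)\big]\Big[\frac{y-\mu_0(a,w)}{g_0(a,w)}+\theta_0(a)-\gamma_0\Big]+\int\big[I_{(-\infty,a_0]}(u)-F_0(a_0)\big]\mu_0(u,w)\,F_0(du)-2\,\Omega_0(a_0).$$ That is, $D^*_{a_0,0}$ is in $L^2(P_0)$ with $E_{P_0}[D^*_{a_0,0}(O)]=0$, it belongs to the tangent space, and $\frac{d}{d\varepsilon}\Omega_{P_\varepsilon}(a_0)\big|_{\varepsilon=0}=E_{P_0}[D^*_{a_0,0}(O)\,h(O)]$ for every such path. -/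

import Mathlib

open MeasureTheory ProbabilityTheory Filter Topology Set

noncomputable section

/-! ### Differentiable paths, tangent spaces and efficient influence functions

Everything here is relative to a class `𝒞` of one-dimensional paths `ε ↦ P_ε` of probability
measures on a measurable space. -/

/-- The path `ε ↦ P_ε` passes through `P₀` at `ε = 0` and is differentiable in quadratic mean
there, with score `h ∈ L²(P₀)`:
`∫ [(dP_ε^{1/2} - dP₀^{1/2}) / ε - (1/2) h dP₀^{1/2}]² → 0` as `ε → 0`, `ε ≠ 0`.
The integral does not depend on the dominating measure; `P_ε + P₀` is used. -/
def IsDQM {Ω : Type*} [MeasurableSpace Ω] (P₀ : ProbabilityMeasure Ω)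
    (P : ℝ → ProbabilityMeasure Ω) (h : Lp ℝ 2 (P₀ : Measure Ω)) : Prop :=
  P 0 = P₀ ∧
  Tendsto (fun ε : ℝ =>
      ∫⁻ o, ENNReal.ofReal
        (((√((P ε : Measure Ω).rnDeriv ((P ε : Measure Ω) + (P₀ : Measure Ω)) o).toReal
            - √((P₀ : Measure Ω).rnDeriv ((P ε : Measure Ω) + (P₀ : Measure Ω)) o).toReal) / ε
          - (1 / 2) * h o
            * √((P₀ : Measure Ω).rnDeriv ((P ε : Measure Ω) + (P₀ : Measure Ω)) o).toReal) ^ 2)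
        ∂((P ε : Measure Ω) + (P₀ : Measure Ω)))
    (𝓝[≠] 0) (𝓝 0)

/-- The tangent space at `P₀`: the closed linear span in `L²(P₀)` of the scores of the paths
in `𝒞` through `P₀`. -/
def tangentSpace {Ω : Type*} [MeasurableSpace Ω] (𝒞 : Set (ℝ → ProbabilityMeasure Ω))
    (P₀ : ProbabilityMeasure Ω) : Submodule ℝ (Lp ℝ 2 (P₀ : Measure Ω)) :=
  (Submodule.span ℝ {h | ∃ P ∈ 𝒞, IsDQM P₀ P h}).topologicalClosure

/-- `ψ` is pathwise differentiable at `P₀` relative to `𝒞`: along every path in `𝒞` with score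
`h` at `P₀`, the derivative of `ψ` exists and is the value at `h` of one continuous linear
functional. -/
def PathwiseDifferentiableAt {Ω : Type*} [MeasurableSpace Ω]
    (𝒞 : Set (ℝ → ProbabilityMeasure Ω)) (ψ : ProbabilityMeasure Ω → ℝ)
    (P₀ : ProbabilityMeasure Ω) : Prop :=
  ∃ L : tangentSpace 𝒞 P₀ →L[ℝ] ℝ, ∀ P ∈ 𝒞, ∀ h : tangentSpace 𝒞 P₀,
    IsDQM P₀ P (h : Lp ℝ 2 (P₀ : Measure Ω)) → HasDerivAt (fun ε => ψ (P ε)) (L h) 0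

/-- `D` is the efficient influence function (canonical gradient) of `ψ` at `P₀` relative to `𝒞`:
it is square integrable with mean zero, it represents the derivative of `ψ` along every path in
`𝒞` through `P₀`, and it belongs to the tangent space. -/
def IsEfficientInfluenceFunction {Ω : Type*} [MeasurableSpace Ω]
    (𝒞 : Set (ℝ → ProbabilityMeasure Ω)) (ψ : ProbabilityMeasure Ω → ℝ)
    (P₀ : ProbabilityMeasure Ω) (D : Ω → ℝ) : Prop :=
  ∫ o, D o ∂(P₀ : Measure Ω) = 0 ∧
  (∀ P ∈ 𝒞, ∀ h : Lp ℝ 2 (P₀ : Measure Ω), IsDQM P₀ P h →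
    HasDerivAt (fun ε => ψ (P ε)) (∫ o, D o * h o ∂(P₀ : Measure Ω)) 0) ∧
  ∃ hD : MemLp D 2 (P₀ : Measure Ω), hD.toLp D ∈ tangentSpace 𝒞 P₀

/-! ### The observed data and the parameters -/

/-- The space of observations `(y, a, w)`: outcome, exposure and `d` covariates. -/
abbrev Obs (d : ℕ) : Type := ℝ × ℝ × (Fin d → ℝ)

/-- The marginal distribution `F_P` of the exposure `A`. -/
def exposureLaw {d : ℕ} (P : ProbabilityMeasure (Obs d)) : Measure ℝ :=
  (P : Measure (Obs d)).map (fun o => o.2.1)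

/-- The marginal distribution `Q_P` of the covariates `W`. -/
def covariateLaw {d : ℕ} (P : ProbabilityMeasure (Obs d)) : Measure (Fin d → ℝ) :=
  (P : Measure (Obs d)).map (fun o => o.2.2)

/-- The distribution function `F_P(a) = P(A ≤ a)`. -/
def exposureCDF {d : ℕ} (P : ProbabilityMeasure (Obs d)) (a : ℝ) : ℝ :=
  (exposureLaw P).real (Iic a)

/-- The conditional distribution `G_P(da, w)` of `A` given `W = w`. -/
def exposureCondLaw {d : ℕ} (P : ProbabilityMeasure (Obs d)) : Kernel (Fin d → ℝ) ℝ :=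
  condDistrib (fun o : Obs d => o.2.1) (fun o : Obs d => o.2.2) (P : Measure (Obs d))

/-- The standardized propensity `g_P(a, w) = G_P(da, w) / F_P(da)`, in a jointly measurable
version. -/
def propensity {d : ℕ} (P : ProbabilityMeasure (Obs d)) (a : ℝ) (w : Fin d → ℝ) : ℝ :=
  (Kernel.rnDeriv (exposureCondLaw P) (Kernel.const (Fin d → ℝ) (exposureLaw P)) w a).toReal

/-- The outcome regression `μ_P(a, w) = E_P[Y | A = a, W = w]`. -/
def outcomeReg {d : ℕ} (P : ProbabilityMeasure (Obs d)) (a : ℝ) (w : Fin d → ℝ) : ℝ :=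
  ∫ y, y ∂(condDistrib (fun o : Obs d => o.1) (fun o : Obs d => o.2) (P : Measure (Obs d)) (a, w))

/-- The G-computed regression function `θ_P(a) = ∫ μ_P(a, w) Q_P(dw)`. -/
def gCompReg {d : ℕ} (P : ProbabilityMeasure (Obs d)) (a : ℝ) : ℝ :=
  ∫ w, outcomeReg P a w ∂(covariateLaw P)

/-- `γ_P = ∫ θ_P(a) F_P(da)`. -/
def meanReg {d : ℕ} (P : ProbabilityMeasure (Obs d)) : ℝ :=
  ∫ a, gCompReg P a ∂(exposureLaw P)

/-- `Γ_P(a) = ∫_{(-∞, a]} θ_P(u) F_P(du)`. -/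
def regPrimitive {d : ℕ} (P : ProbabilityMeasure (Obs d)) (a : ℝ) : ℝ :=
  ∫ u in Iic a, gCompReg P u ∂(exposureLaw P)

/-- The primitive parameter `Ω_P(a) = Γ_P(a) - γ_P F_P(a)`. -/
def primitiveParam {d : ℕ} (a : ℝ) (P : ProbabilityMeasure (Obs d)) : ℝ :=
  regPrimitive P a - meanReg P * exposureCDF P a

/-- The function `D*_{a₀,P}`. -/
def eif {d : ℕ} (a₀ : ℝ) (P : ProbabilityMeasure (Obs d)) (o : Obs d) : ℝ :=
  ((Iic a₀).indicator 1 o.2.1 - exposureCDF P a₀)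
      * ((o.1 - outcomeReg P o.2.1 o.2.2) / propensity P o.2.1 o.2.2
          + gCompReg P o.2.1 - meanReg P)
    + ∫ u, ((Iic a₀).indicator 1 u - exposureCDF P a₀) * outcomeReg P u o.2.2 ∂(exposureLaw P)
    - 2 * primitiveParam a₀ P

/-! ### The models -/

/-- The nonparametric model: all distributions on `𝒴 × 𝒜 × 𝒲`. -/
def nonparametricModel {d : ℕ} (𝒴 𝒜 : Set ℝ) (𝒲 : Set (Fin d → ℝ)) :
    Set (ProbabilityMeasure (Obs d)) :=
  {P | ∀ᵐ o ∂(P : Measure (Obs d)), o.1 ∈ 𝒴 ∧ o.2.1 ∈ 𝒜 ∧ o.2.2 ∈ 𝒲}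

/-- The model in which `θ_P` is continuous and bounded on the support of `F_P`. Since `μ_P`, and
hence `θ_P`, is determined only up to null sets, this means that `θ_P` has such a version. -/
def regressionModel {d : ℕ} (𝒴 𝒜 : Set ℝ) (𝒲 : Set (Fin d → ℝ)) :
    Set (ProbabilityMeasure (Obs d)) :=
  {P ∈ nonparametricModel 𝒴 𝒜 𝒲 | ∃ f : ℝ → ℝ,
    ContinuousOn f (exposureLaw P).support ∧
    (∃ K : ℝ, ∀ a ∈ (exposureLaw P).support, |f a| ≤ K) ∧
    gCompReg P =ᵐ[exposureLaw P] f}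

/-- The `P` in the model for which `g_P` exists, `g_P ≥ η` almost everywhere with respect to
`F_P ⊗ Q_P`, and `E_P[Y²] ≤ C`. -/
def boundedModel {d : ℕ} (𝒴 𝒜 : Set ℝ) (𝒲 : Set (Fin d → ℝ)) (η C : ℝ) :
    Set (ProbabilityMeasure (Obs d)) :=
  {P ∈ regressionModel 𝒴 𝒜 𝒲 |
    (∀ᵐ w ∂(covariateLaw P), exposureCondLaw P w ≪ exposureLaw P) ∧
    (∀ᵐ z ∂((exposureLaw P).prod (covariateLaw P)), η ≤ propensity P z.1 z.2) ∧
    ∫⁻ o, ENNReal.ofReal (o.1 ^ 2) ∂(P : Measure (Obs d)) ≤ ENNReal.ofReal C}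

/-- The submodel in which `g_P` is almost surely bounded away from zero and `E_P[Y²] < ∞`. -/
def positivityModel {d : ℕ} (𝒴 𝒜 : Set ℝ) (𝒲 : Set (Fin d → ℝ)) :
    Set (ProbabilityMeasure (Obs d)) :=
  {P | ∃ η > 0, ∃ C : ℝ, P ∈ boundedModel 𝒴 𝒜 𝒲 η C}

/-- The paths that stay in the submodel near `ε = 0`, with a lower bound on `g_P` and an upper
bound on `E_P[Y²]` that are common to all `P_ε` with `ε` near `0`. -/
def regularPaths {d : ℕ} (𝒴 𝒜 : Set ℝ) (𝒲 : Set (Fin d → ℝ)) :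
    Set (ℝ → ProbabilityMeasure (Obs d)) :=
  {P | ∃ δ > 0, ∃ η > 0, ∃ C : ℝ, ∀ ε : ℝ, |ε| ≤ δ → P ε ∈ boundedModel 𝒴 𝒜 𝒲 η C}

end

/-! Write `weightedReg φ P` for the integral of `φ(a) μ_P(a,w)` against `F_P ⊗ Q_P`. By Fubini
`Ω_P(a₀)` is `weightedReg` at the indicator of `(-∞, a₀]` minus `F_P(a₀)` times `weightedReg` at
`1`, so differentiability reduces to that of `weightedReg φ` for bounded `φ`, plus the product rule.

Differentiability in quadratic mean gives `∫ f dP_ε - ∫ f dP₀ ≈ ε ∫ f k dP₀`, with `k` a bounded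
`L²` approximation of the score and an error `τ |ε| √S` uniform over all `f` with second moment at
most `S` under both laws (`IsDQM.exists_expansion`). Uniformity matters because `f` may then depend
on `ε`. The regression `μ_{P_ε}` is never differentiated: it only serves as a test function. With `b
= 1/g₀`, the measures `F_ε ⊗ Q_ε` and `b · P_ε^{A,W}` agree to zeroth order, since `b · P₀^{A,W} =
F₀ ⊗ Q₀`. Expanding both gives `weightedReg φ P_ε ≈ E_{P_ε}[φ b μ_{P_ε}] + ε E_{P_ε}[φ b ρ
μ_{P_ε}]`, where `ρ = k_A + k_W - k_{A,W}` combines the conditional expectations of `k`. By the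
tower property `μ_{P_ε}` may be replaced here by `Y`, and expectations of a function of the data
linear in `Y` can be expanded directly (`abs_weightedReg_sub_le`).

The expansion requires `μ_{P_ε}` to be square integrable under laws built from `P₀`, which nothing
guarantees. Hence `μ_{P_ε}` is truncated to a set on which the laws under `P₀` are at most twice
those under `P_ε`; its complement has probability `o(ε²)` (`IsDQM.eventually_exists_dominated`), so
by Cauchy–Schwarz the truncation costs `o(ε)`.

For membership in the tangent space, every bounded mean-zero `k` is shown to be a score, and such
functions are dense among mean-zero `L²` functions. The tilt `(1 + ε k) P₀` may destroy the
continuity of `θ`. It is therefore conditioned on a compact exposure set, depending on `ε` and of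
`F₀`-probability at least `1 - ε⁴/4`, on which `θ` is continuous by a Lusin argument
(`exists_isCompact_continuousOn_integral`). Conditioning on `A` leaves `μ` unchanged but alters `Q`,
so the Lusin set must work for all covariate laws dominated by a multiple of `Q₀`. -/

/-! ### Square-integral bounds -/

/-- `f` is a.e.-measurable with `∫ f² ≤ S`. -/
structure L2Bound {α : Type*} [MeasurableSpace α] (f : α → ℝ) (μ : Measure α) (S : ℝ) : Prop where
  aesm : AEStronglyMeasurable f μ
  le : ∫⁻ x, ENNReal.ofReal (f x ^ 2) ∂μ ≤ ENNReal.ofReal S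

namespace L2Bound

variable {α β : Type*} [MeasurableSpace α] [MeasurableSpace β] {f g : α → ℝ} {μ ν : Measure α}
  {S T : ℝ}

lemma enorm_sq_eq (x : ℝ) : ‖x‖ₑ ^ (2 : ℝ) = ENNReal.ofReal (x ^ 2) := by
  rw [Real.enorm_eq_ofReal_abs, ENNReal.ofReal_rpow_of_nonneg (abs_nonneg x) (by norm_num)]
  norm_num

lemma eLpNorm_le (h : L2Bound f μ S) : eLpNorm f 2 μ ≤ ENNReal.ofReal √S := by
  rw [eLpNorm_eq_lintegral_rpow_enorm_toReal (by norm_num) (by norm_num)]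
  simp only [ENNReal.toReal_ofNat, enorm_sq_eq]
  rcases le_or_gt 0 S with hS | hS
  · rw [Real.sqrt_eq_rpow, ← ENNReal.ofReal_rpow_of_nonneg hS (by norm_num)]
    exact ENNReal.rpow_le_rpow h.le (by norm_num)
  · have := h.le
    rw [ENNReal.ofReal_of_nonpos hS.le, nonpos_iff_eq_zero] at this
    simp [this]

lemma of_eLpNorm_le (hf : AEStronglyMeasurable f μ) (hS : 0 ≤ S)
    (h : eLpNorm f 2 μ ≤ ENNReal.ofReal S) : L2Bound f μ (S ^ 2) := by
  refine ⟨hf, ?_⟩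
  rw [eLpNorm_eq_lintegral_rpow_enorm_toReal (by norm_num) (by norm_num)] at h
  simp only [ENNReal.toReal_ofNat, enorm_sq_eq] at h
  have := ENNReal.rpow_le_rpow h (z := 2) (by norm_num)
  rw [← ENNReal.rpow_mul] at this
  norm_num at this
  rwa [← ENNReal.ofReal_pow hS] at this

lemma memLp (h : L2Bound f μ S) : MemLp f 2 μ :=
  ⟨h.aesm, h.eLpNorm_le.trans_lt ENNReal.ofReal_lt_top⟩

lemma integrable [IsFiniteMeasure μ] (h : L2Bound f μ S) : Integrable f μ :=
  h.memLp.integrable (by norm_num)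

lemma mono (h : L2Bound f μ S) (hST : S ≤ T) : L2Bound f μ T :=
  ⟨h.aesm, h.le.trans (ENNReal.ofReal_le_ofReal hST)⟩

lemma congr (h : L2Bound f μ S) (hfg : f =ᵐ[μ] g) : L2Bound g μ S := by
  refine ⟨h.aesm.congr hfg, le_of_eq_of_le (lintegral_congr_ae ?_) h.le⟩
  filter_upwards [hfg] with x hx
  rw [hx]

lemma of_abs_le (h : L2Bound f μ S) (hg : AEStronglyMeasurable g μ) {c : ℝ}
    (hgf : ∀ᵐ x ∂μ, |g x| ≤ c * |f x|) : L2Bound g μ (c ^ 2 * S) := by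
  refine ⟨hg, ?_⟩
  calc ∫⁻ x, ENNReal.ofReal (g x ^ 2) ∂μ
      ≤ ∫⁻ x, ENNReal.ofReal (c ^ 2) * ENNReal.ofReal (f x ^ 2) ∂μ := by
        refine lintegral_mono_ae ?_
        filter_upwards [hgf] with x hx
        rw [← ENNReal.ofReal_mul (sq_nonneg c)]
        refine ENNReal.ofReal_le_ofReal ?_
        rw [← sq_abs (g x), ← sq_abs (f x), ← mul_pow]
        exact pow_le_pow_left₀ (abs_nonneg _) hx 2
    _ = ENNReal.ofReal (c ^ 2) * ∫⁻ x, ENNReal.ofReal (f x ^ 2) ∂μ :=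
        lintegral_const_mul' _ _ ENNReal.ofReal_ne_top
    _ ≤ ENNReal.ofReal (c ^ 2) * ENNReal.ofReal S := by gcongr; exact h.le
    _ = ENNReal.ofReal (c ^ 2 * S) := (ENNReal.ofReal_mul (sq_nonneg c)).symm

lemma mul_left (h : L2Bound f μ S) (hg : AEStronglyMeasurable g μ) {c : ℝ}
    (hc : ∀ᵐ x ∂μ, |g x| ≤ c) : L2Bound (fun x => g x * f x) μ (c ^ 2 * S) := by
  refine h.of_abs_le (hg.mul h.aesm) ?_
  filter_upwards [hc] with x hx
  simp only [Pi.mul_apply, abs_mul]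
  gcongr

lemma of_bounded [IsProbabilityMeasure μ] (hg : AEStronglyMeasurable g μ) {c : ℝ}
    (hc : ∀ᵐ x ∂μ, |g x| ≤ c) : L2Bound g μ (c ^ 2) := by
  have h1 : L2Bound (fun _ => (1 : ℝ)) μ 1 := ⟨aestronglyMeasurable_const, by simp⟩
  simpa using h1.of_abs_le hg (c := c) (by simpa using hc)

lemma of_measure_le (h : L2Bound f μ S) {c : ℝ} (hc : 0 ≤ c)
    (hν : ν ≤ ENNReal.ofReal c • μ) : L2Bound f ν (c * S) := by
  refine ⟨(h.aesm.smul_measure _).mono_measure hν, ?_⟩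
  calc ∫⁻ x, ENNReal.ofReal (f x ^ 2) ∂ν
      ≤ ∫⁻ x, ENNReal.ofReal (f x ^ 2) ∂(ENNReal.ofReal c • μ) := lintegral_mono' hν le_rfl
    _ = ENNReal.ofReal c * ∫⁻ x, ENNReal.ofReal (f x ^ 2) ∂μ := by
        rw [lintegral_smul_measure, smul_eq_mul]
    _ ≤ ENNReal.ofReal c * ENNReal.ofReal S := by gcongr; exact h.le
    _ = ENNReal.ofReal (c * S) := (ENNReal.ofReal_mul hc).symm

lemma comp_map {T : β → α} {ρ : Measure β} (hT : Measurable T) (h : L2Bound f (ρ.map T) S) :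
    L2Bound (fun x => f (T x)) ρ S := by
  refine ⟨h.aesm.comp_measurable hT, le_of_eq_of_le ?_ h.le⟩
  rw [lintegral_map' _ hT.aemeasurable]
  exact (h.aesm.aemeasurable.pow_const 2).ennreal_ofReal

lemma map {T : β → α} {ρ : Measure β} (hT : Measurable T) (hf : Measurable f)
    (h : L2Bound (fun x => f (T x)) ρ S) : L2Bound f (ρ.map T) S := by
  refine ⟨hf.aestronglyMeasurable, le_of_eq_of_le ?_ h.le⟩
  rw [lintegral_map (by fun_prop) hT]

/-- Cauchy–Schwarz. -/
lemma lintegral_abs_mul_le (hf : L2Bound f μ S) (hg : L2Bound g μ T) :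
    ∫⁻ x, ENNReal.ofReal |f x * g x| ∂μ ≤ ENNReal.ofReal (√S * √T) := by
  have h1 := ENNReal.lintegral_mul_le_Lp_mul_Lq μ Real.HolderConjugate.two_two
    hf.aesm.aemeasurable.enorm hg.aesm.aemeasurable.enorm
  have e1 := hf.eLpNorm_le
  have e2 := hg.eLpNorm_le
  rw [eLpNorm_eq_lintegral_rpow_enorm_toReal (by norm_num) (by norm_num)] at e1 e2
  simp only [ENNReal.toReal_ofNat] at e1 e2
  calc ∫⁻ x, ENNReal.ofReal |f x * g x| ∂μ = ∫⁻ x, ‖f x‖ₑ * ‖g x‖ₑ ∂μ := by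
        refine lintegral_congr fun x => ?_
        rw [← Real.enorm_eq_ofReal_abs, enorm_mul]
    _ ≤ _ := h1
    _ ≤ ENNReal.ofReal √S * ENNReal.ofReal √T := mul_le_mul' e1 e2
    _ = _ := (ENNReal.ofReal_mul (Real.sqrt_nonneg _)).symm

lemma integrable_mul (hf : L2Bound f μ S) (hg : L2Bound g μ T) :
    Integrable (fun x => f x * g x) μ := by
  have := hf.memLp.integrable_mul hg.memLp
  exact this

lemma integral_abs_mul_le (hf : L2Bound f μ S) (hg : L2Bound g μ T) :
    ∫ x, |f x * g x| ∂μ ≤ √S * √T := by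
  have hm : AEStronglyMeasurable (fun x => |f x * g x|) μ := (hf.aesm.mul hg.aesm).norm
  rw [integral_eq_lintegral_of_nonneg_ae (Eventually.of_forall fun x => abs_nonneg _) hm]
  exact ENNReal.toReal_le_of_le_ofReal (by positivity) (hf.lintegral_abs_mul_le hg)

lemma abs_integral_mul_le (hf : L2Bound f μ S) (hg : L2Bound g μ T) :
    |∫ x, f x * g x ∂μ| ≤ √S * √T :=
  (abs_integral_le_integral_abs).trans (hf.integral_abs_mul_le hg)

lemma abs_integral_le [IsProbabilityMeasure μ] (hf : L2Bound f μ S) : |∫ x, f x ∂μ| ≤ √S := by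
  have h1 : L2Bound (fun _ => (1 : ℝ)) μ 1 := ⟨aestronglyMeasurable_const, by simp⟩
  simpa using hf.abs_integral_mul_le h1

lemma abs_setIntegral_le [IsFiniteMeasure μ] (hf : L2Bound f μ S) {E : Set α}
    (hE : MeasurableSet E) {t : ℝ} (ht : μ E ≤ ENNReal.ofReal t) :
    |∫ x in E, f x ∂μ| ≤ √S * √t := by
  have h1 : L2Bound (E.indicator fun _ => (1 : ℝ)) μ t := by
    refine ⟨(measurable_const.indicator hE).aestronglyMeasurable, ?_⟩
    have : (fun x => ENNReal.ofReal ((E.indicator (fun _ => (1 : ℝ)) x) ^ 2))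
        = E.indicator fun _ => 1 := by
      ext x; by_cases hx : x ∈ E <;> simp [hx]
    rw [this, lintegral_indicator hE]
    simpa using ht
  have h2 := hf.abs_integral_mul_le h1
  have : (fun x => f x * E.indicator (fun _ => (1 : ℝ)) x) = E.indicator f := by
    ext x; by_cases hx : x ∈ E <;> simp [hx]
  rwa [this, integral_indicator hE] at h2

lemma add (hf : L2Bound f μ S) (hg : L2Bound g μ T) (hS : 0 ≤ S) (hT : 0 ≤ T) :
    L2Bound (fun x => f x + g x) μ (2 * S + 2 * T) := by
  have h2 : (2 : ENNReal) = ENNReal.ofReal 2 := by simp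
  refine ⟨hf.aesm.add hg.aesm, ?_⟩
  calc ∫⁻ x, ENNReal.ofReal ((f x + g x) ^ 2) ∂μ
      ≤ ∫⁻ x, (2 * ENNReal.ofReal (f x ^ 2) + 2 * ENNReal.ofReal (g x ^ 2)) ∂μ := by
        refine lintegral_mono fun x => ?_
        rw [h2, ← ENNReal.ofReal_mul (by norm_num), ← ENNReal.ofReal_mul (by norm_num),
          ← ENNReal.ofReal_add (by positivity) (by positivity)]
        exact ENNReal.ofReal_le_ofReal (by nlinarith [sq_nonneg (f x - g x)])
    _ = 2 * ∫⁻ x, ENNReal.ofReal (f x ^ 2) ∂μ + 2 * ∫⁻ x, ENNReal.ofReal (g x ^ 2) ∂μ := by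
        rw [lintegral_add_left', lintegral_const_mul' _ _ (by norm_num),
          lintegral_const_mul' _ _ (by norm_num)]
        exact ((hf.aesm.aemeasurable.pow_const 2).ennreal_ofReal).const_mul _
    _ ≤ 2 * ENNReal.ofReal S + 2 * ENNReal.ofReal T := by
        gcongr
        · exact hf.le
        · exact hg.le
    _ = _ := by
        rw [h2, ← ENNReal.ofReal_mul (by norm_num), ← ENNReal.ofReal_mul (by norm_num),
          ← ENNReal.ofReal_add (by positivity) (by positivity)]

end L2Bound

/-! ### Expansion of expectations along a path differentiable in quadratic mean -/

section Expansion

variable {Ω : Type*} [MeasurableSpace Ω]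

/-- A square-integrable function is approximated in `L²` by a bounded measurable one. -/
lemma exists_bounded_L2Bound_sub {μ : Measure Ω} {h : Ω → ℝ} (hh : MemLp h 2 μ) {τ : ℝ}
    (hτ : 0 < τ) :
    ∃ k : Ω → ℝ, ∃ K : ℝ, 0 < K ∧ Measurable k ∧ (∀ o, |k o| ≤ K) ∧
      L2Bound (fun o => h o - k o) μ (τ ^ 2) := by
  obtain ⟨g, hg, hg2⟩ := hh.exists_simpleFunc_eLpNorm_sub_lt (by norm_num)
    (ε := ENNReal.ofReal τ) (by simpa using hτ)
  obtain ⟨K, hK⟩ := g.exists_forall_norm_le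
  refine ⟨g, max K 1, by positivity, g.measurable, fun o => (hK o).trans (le_max_left _ _), ?_⟩
  exact L2Bound.of_eLpNorm_le (hh.aestronglyMeasurable.sub hg2.aestronglyMeasurable) hτ.le hg.le

/-- Second-order control of the difference of expectations under two measures by the square roots
of their densities. -/
lemma abs_integral_sub_le_of_sqrt_rnDeriv (P Q : Measure Ω) [IsProbabilityMeasure P]
    [IsProbabilityMeasure Q] {ε K τ S : ℝ} (hε : ε ≠ 0) (hK : 0 < K) (hτ : 0 ≤ τ)
    (hεK : |ε| * K ≤ 1) (hετ : |ε| * K ^ 2 ≤ τ) (hS : 0 ≤ S) {k f : Ω → ℝ}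
    (hk : Measurable k) (hkK : ∀ o, |k o| ≤ K) (hf : Measurable f)
    (hA : L2Bound (fun o => (√(P.rnDeriv (P + Q) o).toReal - √(Q.rnDeriv (P + Q) o).toReal) / ε
      - (1 / 2) * k o * √(Q.rnDeriv (P + Q) o).toReal) (P + Q) (τ ^ 2))
    (hfP : L2Bound f P S) (hfQ : L2Bound f Q S) :
    |∫ o, f o ∂P - ∫ o, f o ∂Q - ε * ∫ o, f o * k o ∂Q| ≤ 5 * τ * |ε| * √S := by
  set s : Ω → ℝ := fun o => √(P.rnDeriv (P + Q) o).toReal with hs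
  set t : Ω → ℝ := fun o => √(Q.rnDeriv (P + Q) o).toReal with ht
  have hPac : P ≪ P + Q := Measure.AbsolutelyContinuous.rfl.add_right Q
  have hQac : Q ≪ P + Q := by
    rw [add_comm]; exact Measure.AbsolutelyContinuous.rfl.add_right P
  have hs2 : ∀ o, s o ^ 2 = (P.rnDeriv (P + Q) o).toReal := fun o =>
    Real.sq_sqrt ENNReal.toReal_nonneg
  have ht2 : ∀ o, t o ^ 2 = (Q.rnDeriv (P + Q) o).toReal := fun o =>
    Real.sq_sqrt ENNReal.toReal_nonneg
  have hsm : Measurable s := (Measure.measurable_rnDeriv _ _).ennreal_toReal.sqrt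
  have htm : Measurable t := (Measure.measurable_rnDeriv _ _).ennreal_toReal.sqrt
  have iP : ∀ u : Ω → ℝ, ∫ o, u o ∂P = ∫ o, s o ^ 2 * u o ∂(P + Q) := fun u => by
    simp_rw [hs2, ← smul_eq_mul]
    exact (integral_rnDeriv_smul hPac).symm
  have iQ : ∀ u : Ω → ℝ, ∫ o, u o ∂Q = ∫ o, t o ^ 2 * u o ∂(P + Q) := fun u => by
    simp_rw [ht2, ← smul_eq_mul]
    exact (integral_rnDeriv_smul hQac).symm
  have jP : ∀ u : Ω → ℝ, Integrable u P → Integrable (fun o => s o ^ 2 * u o) (P + Q) :=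
    fun u hu => by
      simp_rw [hs2, ← smul_eq_mul]
      exact (integrable_rnDeriv_smul_iff hPac).2 hu
  have jQ : ∀ u : Ω → ℝ, Integrable u Q → Integrable (fun o => t o ^ 2 * u o) (P + Q) :=
    fun u hu => by
      simp_rw [ht2, ← smul_eq_mul]
      exact (integrable_rnDeriv_smul_iff hQac).2 hu
  have lift : ∀ (R : Measure Ω) [IsProbabilityMeasure R] (r : Ω → ℝ), R ≪ P + Q → Measurable r →
      (∀ o, r o ^ 2 = (R.rnDeriv (P + Q) o).toReal) → L2Bound f R S →
      L2Bound (fun o => f o * r o) (P + Q) S := by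
    intro R _ r hR hr hr2 hfR
    refine ⟨(hf.mul hr).aestronglyMeasurable, le_of_eq_of_le ?_ hfR.le⟩
    rw [← lintegral_rnDeriv_mul hR (by fun_prop)]
    refine lintegral_congr_ae ?_
    filter_upwards [Measure.rnDeriv_ne_top R (P + Q)] with o ho
    rw [mul_pow, hr2, mul_comm, ENNReal.ofReal_mul ENNReal.toReal_nonneg, ENNReal.ofReal_toReal ho]
  have hfs := lift P s hPac hsm hs2 hfP
  have hft := lift Q t hQac htm ht2 hfQ
  set A : Ω → ℝ := fun o => (s o - t o) / ε - (1 / 2) * k o * t o with hAdef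
  -- Since `|ε| K ≤ 1`, the factor `1 + ε k / 2` is at most `3/2`; the resulting bound `6.5 S` is at
  -- most `9 S`, whence the factor `3 √S` below.
  have hB : L2Bound (fun o => f o * s o + (1 + (1 / 2) * ε * k o) * (f o * t o)) (P + Q)
      (2 * S + 2 * ((3 / 2) ^ 2 * S)) := by
    refine hfs.add (hft.mul_left (c := 3 / 2) (by fun_prop) (Eventually.of_forall fun o => ?_))
      hS (by positivity)
    have h1 : |ε * k o| ≤ 1 := by
      rw [abs_mul]
      exact (mul_le_mul_of_nonneg_left (hkK o) (abs_nonneg _)).trans hεK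
    rw [abs_le] at h1 ⊢
    constructor <;> linarith [h1.1, h1.2]
  have hfk : L2Bound (fun o => k o * f o) Q (K ^ 2 * S) :=
    hfQ.mul_left hk.aestronglyMeasurable (Eventually.of_forall hkK)
  have hkk : L2Bound (fun o => k o * (k o * f o)) Q (K ^ 2 * (K ^ 2 * S)) :=
    hfk.mul_left hk.aestronglyMeasurable (Eventually.of_forall hkK)
  -- From `s = (1 + ε k / 2) t + ε A`, a difference of squares gives `s² - (1 + ε k / 2)² t² = ε A
  -- (s + (1 + ε k / 2) t)`, and `(1 + ε k / 2)²` exceeds `1 + ε k` by `ε² k² / 4`.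
  have key : ∫ o, f o ∂P - ∫ o, f o ∂Q - ε * ∫ o, f o * k o ∂Q
      = ε * ∫ o, A o * (f o * s o + (1 + (1 / 2) * ε * k o) * (f o * t o)) ∂(P + Q)
        + (1 / 4) * ε ^ 2 * ∫ o, k o * (k o * f o) ∂Q := by
    rw [iP f, iQ f, iQ, iQ (fun o => k o * (k o * f o)), ← integral_const_mul,
      ← integral_const_mul, ← integral_const_mul, ← integral_sub, ← integral_sub, ← integral_add]
    · refine integral_congr_ae (Eventually.of_forall fun o => ?_)
      simp only [hAdef]
      field_simp
      ring
    · exact (hA.integrable_mul hB).const_mul _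
    · exact (jQ _ hkk.integrable).const_mul _
    · exact (jP _ hfP.integrable).sub (jQ _ hfQ.integrable)
    · refine (jQ _ ?_).const_mul _
      simpa only [mul_comm] using hfk.integrable
    · exact jP _ hfP.integrable
    · exact jQ _ hfQ.integrable
  rw [key]
  have e1 := hA.abs_integral_mul_le hB
  have e2 := hkk.abs_integral_le
  have hr1 : √(2 * S + 2 * ((3 / 2) ^ 2 * S)) ≤ 3 * √S := by
    rw [show (3 : ℝ) = √9 by rw [show (9 : ℝ) = 3 ^ 2 by norm_num]; simp, ← Real.sqrt_mul (by norm_num)]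
    exact Real.sqrt_le_sqrt (by linarith)
  have hr2 : √(K ^ 2 * (K ^ 2 * S)) = K ^ 2 * √S := by
    rw [← mul_assoc, Real.sqrt_mul (by positivity), ← pow_two, Real.sqrt_sq (by positivity)]
  rw [Real.sqrt_sq hτ] at e1
  rw [hr2] at e2
  refine (abs_add_le _ _).trans ?_
  rw [abs_mul, abs_mul, abs_mul, abs_pow, abs_of_pos (show (0 : ℝ) < 1 / 4 by norm_num)]
  have a0 := abs_nonneg ε
  have s0 := Real.sqrt_nonneg S
  calc _ ≤ |ε| * (τ * (3 * √S)) + 1 / 4 * |ε| ^ 2 * (K ^ 2 * √S) := by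
        gcongr
        exact e1.trans (by gcongr)
    _ = |ε| * (τ * (3 * √S)) + 1 / 4 * |ε| * √S * (|ε| * K ^ 2) := by ring
    _ ≤ |ε| * (τ * (3 * √S)) + 1 / 4 * |ε| * √S * τ := by gcongr
    _ ≤ 5 * τ * |ε| * √S := by
        have : 0 ≤ |ε| * √S * τ := by positivity
        nlinarith

/-- Along a path with score `h`, `P_ε - P₀ ≈ ε k P₀` for a bounded approximation `k` of `h`, when
tested against functions that are square integrable under both measures. -/
theorem IsDQM.exists_expansion {P₀ : ProbabilityMeasure Ω} {P : ℝ → ProbabilityMeasure Ω}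
    {h : Lp ℝ 2 (P₀ : Measure Ω)} (H : IsDQM P₀ P h) {τ : ℝ} (hτ : 0 < τ) :
    ∃ k : Ω → ℝ, ∃ K : ℝ, 0 < K ∧ Measurable k ∧ (∀ o, |k o| ≤ K) ∧
      L2Bound (fun o => h o - k o) (P₀ : Measure Ω) (τ ^ 2) ∧
      ∀ᶠ ε in 𝓝[≠] (0 : ℝ), ∀ (f : Ω → ℝ) (S : ℝ), Measurable f → 0 ≤ S →
        L2Bound f (P ε : Measure Ω) S → L2Bound f (P₀ : Measure Ω) S →
        |∫ o, f o ∂(P ε : Measure Ω) - ∫ o, f o ∂(P₀ : Measure Ω)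
          - ε * ∫ o, f o * k o ∂(P₀ : Measure Ω)| ≤ τ * |ε| * √S := by
  -- Two errors of `L²` size `τ/10`, one from the path and one from replacing `h` by `k`, add up to
  -- at most `τ/5`; the factor `5` of the previous lemma then gives `τ`.
  obtain ⟨k, K, hK, hk, hkK, hhk⟩ := exists_bounded_L2Bound_sub (Lp.memLp h)
    (show 0 < τ / 10 by positivity)
  refine ⟨k, K, hK, hk, hkK, hhk.mono (by nlinarith), ?_⟩
  have hsmall := H.2.eventually (Iic_mem_nhds
    (ENNReal.ofReal_pos.2 (show 0 < (τ / 10) ^ 2 by positivity)))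
  have hlim : ∀ c : ℝ, 0 < c → ∀ᶠ ε in 𝓝[≠] (0 : ℝ), |ε| ≤ c := fun c hc => by
    refine mem_nhdsWithin_of_mem_nhds ?_
    filter_upwards [Metric.closedBall_mem_nhds (0 : ℝ) hc] with ε hε
    simpa using hε
  filter_upwards [hsmall, hlim (1 / K) (by positivity), hlim (τ / 5 / K ^ 2) (by positivity),
    self_mem_nhdsWithin] with ε h1 h2 h3 h4 f S hf hS hfP hfQ
  have hε : ε ≠ 0 := h4
  set R : Measure Ω := (P ε : Measure Ω) + (P₀ : Measure Ω) with hR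
  have hhm : Measurable h := (Lp.stronglyMeasurable h).measurable
  have hB : L2Bound (fun o => (√((P ε : Measure Ω).rnDeriv R o).toReal
            - √((P₀ : Measure Ω).rnDeriv R o).toReal) / ε
          - (1 / 2) * h o * √((P₀ : Measure Ω).rnDeriv R o).toReal) R ((τ / 10) ^ 2) := by
    refine ⟨Measurable.aestronglyMeasurable ?_, h1⟩
    fun_prop
  have hac : (P₀ : Measure Ω) ≪ R := by
    rw [hR, add_comm]; exact Measure.AbsolutelyContinuous.rfl.add_right _
  have hC : L2Bound (fun o => (1 / 2) * (h o - k o) * √((P₀ : Measure Ω).rnDeriv R o).toReal) R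
      ((τ / 10) ^ 2) := by
    refine ⟨Measurable.aestronglyMeasurable (by fun_prop), le_trans ?_ hhk.le⟩
    rw [← lintegral_rnDeriv_mul hac (by fun_prop)]
    refine lintegral_mono_ae ?_
    filter_upwards [Measure.rnDeriv_ne_top (P₀ : Measure Ω) R] with o ho
    rw [mul_pow, Real.sq_sqrt ENNReal.toReal_nonneg, mul_comm,
      ENNReal.ofReal_mul ENNReal.toReal_nonneg, ENNReal.ofReal_toReal ho]
    refine mul_le_mul' le_rfl (ENNReal.ofReal_le_ofReal ?_)
    nlinarith [sq_nonneg (h o - k o)]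
  have hA := (hB.add hC (by positivity) (by positivity)).mono
    (show 2 * (τ / 10) ^ 2 + 2 * (τ / 10) ^ 2 ≤ (τ / 5) ^ 2 by nlinarith)
  have := abs_integral_sub_le_of_sqrt_rnDeriv (P ε : Measure Ω) (P₀ : Measure Ω) (τ := τ / 5)
    hε hK (by positivity) (by rwa [← le_div_iff₀ hK]) (by rwa [← le_div_iff₀ (by positivity)]) hS hk
    hkK hf (hA.congr (Eventually.of_forall fun o => by simp only [hR]; ring)) hfP hfQ
  refine this.trans (le_of_eq (by ring))

/-- Used for terms already multiplied by `ε`, where an error `O(ε)` is enough. The expansion with `τ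
= 1` and `|k| ≤ K` gives `M = 1 + K`. -/
lemma IsDQM.exists_lipschitz {P₀ : ProbabilityMeasure Ω} {P : ℝ → ProbabilityMeasure Ω}
    {h : Lp ℝ 2 (P₀ : Measure Ω)} (H : IsDQM P₀ P h) :
    ∃ M : ℝ, 0 < M ∧ ∀ᶠ ε in 𝓝[≠] (0 : ℝ), ∀ (f : Ω → ℝ) (S : ℝ), Measurable f → 0 ≤ S →
        L2Bound f (P ε : Measure Ω) S → L2Bound f (P₀ : Measure Ω) S →
        |∫ o, f o ∂(P ε : Measure Ω) - ∫ o, f o ∂(P₀ : Measure Ω)| ≤ M * |ε| * √S := by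
  obtain ⟨k, K, hK, hk, hkK, -, hε⟩ := H.exists_expansion one_pos
  refine ⟨1 + K, by positivity, ?_⟩
  filter_upwards [hε] with ε h f S hf hS h1 h2
  have e1 := h f S hf hS h1 h2
  have e2 := (h2.mul_left hk.aestronglyMeasurable (Eventually.of_forall hkK)).abs_integral_le
  rw [Real.sqrt_mul (by positivity), Real.sqrt_sq hK.le] at e2
  simp_rw [mul_comm (k _)] at e2
  have e3 : |ε * ∫ o, f o * k o ∂(P₀ : Measure Ω)| ≤ |ε| * (K * √S) := by
    rw [abs_mul]; gcongr
  calc _ ≤ 1 * |ε| * √S + |ε| * (K * √S) := by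
        rw [← sub_add_cancel (∫ o, f o ∂(P ε : Measure Ω) - ∫ o, f o ∂(P₀ : Measure Ω))
          (ε * ∫ o, f o * k o ∂(P₀ : Measure Ω))]
        exact (abs_add_le _ _).trans (add_le_add e1 e3)
    _ = _ := by ring

/-- All `P_ε` have total mass one, so the expansion of the constant function `1` forces the mean of
`k`, hence that of `h`, to be arbitrarily small. -/
lemma IsDQM.integral_score_eq_zero {P₀ : ProbabilityMeasure Ω} {P : ℝ → ProbabilityMeasure Ω}
    {h : Lp ℝ 2 (P₀ : Measure Ω)} (H : IsDQM P₀ P h) : ∫ o, h o ∂(P₀ : Measure Ω) = 0 := by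
  refine abs_eq_zero.1 (le_antisymm (le_of_forall_pos_le_add fun τ hτ => ?_) (abs_nonneg _))
  obtain ⟨k, K, hK, hk, hkK, hhk, hε⟩ := H.exists_expansion (half_pos hτ)
  obtain ⟨ε, h1, h2⟩ := (hε.and self_mem_nhdsWithin).exists
  have hε0 : 0 < |ε| := abs_pos.2 h2
  have e1 := h1 (fun _ => 1) 1 measurable_const zero_le_one
    ⟨aestronglyMeasurable_const, by simp⟩ ⟨aestronglyMeasurable_const, by simp⟩
  simp only [integral_const, probReal_univ, smul_eq_mul, mul_one, sub_self, one_mul, zero_sub,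
    abs_neg, abs_mul, Real.sqrt_one] at e1
  have e2 : |∫ o, k o ∂(P₀ : Measure Ω)| ≤ τ / 2 := by
    rw [mul_comm] at e1; exact le_of_mul_le_mul_right e1 hε0
  have e3 := hhk.abs_integral_le
  have hki : Integrable k (P₀ : Measure Ω) :=
    (L2Bound.of_bounded hk.aestronglyMeasurable (Eventually.of_forall hkK)).integrable
  rw [Real.sqrt_sq (by positivity),
    integral_sub ((Lp.memLp h).integrable (by norm_num)) hki] at e3
  have := abs_sub_abs_le_abs_sub (∫ o, h o ∂(P₀ : Measure Ω)) (∫ o, k o ∂(P₀ : Measure Ω))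
  linarith

/-- Off a set of probability `o(ε²)`, the law of a statistic under `P₀` is dominated by twice its
law under `P_ε`. -/
lemma IsDQM.eventually_exists_dominated {P₀ : ProbabilityMeasure Ω}
    {P : ℝ → ProbabilityMeasure Ω} {h : Lp ℝ 2 (P₀ : Measure Ω)} (H : IsDQM P₀ P h)
    {Ω' : Type*} [MeasurableSpace Ω'] {T : Ω → Ω'} (hT : Measurable T) {τ : ℝ} (hτ : 0 < τ) :
    ∀ᶠ ε in 𝓝[≠] (0 : ℝ), ∃ E : Set Ω', MeasurableSet E ∧
      ((P₀ : Measure Ω).map T).restrict E ≤ ENNReal.ofReal 2 • ((P ε : Measure Ω).map T) ∧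
      ((P₀ : Measure Ω).map T) Eᶜ ≤ ENNReal.ofReal ((τ * ε) ^ 2) ∧
      ((P ε : Measure Ω).map T) Eᶜ ≤ ENNReal.ofReal ((τ * ε) ^ 2) := by
  obtain ⟨k, K, hK, hk, hkK, -, hev⟩ := H.exists_expansion (show 0 < τ / 4 by positivity)
  have hlim : ∀ᶠ ε in 𝓝[≠] (0 : ℝ), |ε| ≤ 1 / (4 * K) := by
    refine mem_nhdsWithin_of_mem_nhds ?_
    filter_upwards [Metric.closedBall_mem_nhds (0 : ℝ) (show 0 < 1 / (4 * K) by positivity)]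
      with ε hε
    simpa using hε
  filter_upwards [hev, hlim] with ε h1 h2
  set p := (P ε : Measure Ω).map T with hp
  set q := (P₀ : Measure Ω).map T with hq
  have : IsProbabilityMeasure p := Measure.isProbabilityMeasure_map hT.aemeasurable
  have : IsProbabilityMeasure q := Measure.isProbabilityMeasure_map hT.aemeasurable
  have : IsFiniteMeasure (ENNReal.ofReal 2 • p) := Measure.smul_finite _ ENNReal.ofReal_ne_top
  -- On `E` the law `q` is at most `2 p`; on every part of the complement `2 p ≤ q`, so there `q - p
  -- ≥ q/2`, a gap too large for a differentiable path unless `q Eᶜ` is tiny.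
  obtain ⟨E, hE, hE1, hE2⟩ := hahn_decomposition (ENNReal.ofReal 2 • p) q
  have hx : 2 * p.real Eᶜ ≤ q.real Eᶜ := by
    have := ENNReal.toReal_mono (measure_ne_top _ _) (hE2 Eᶜ hE.compl subset_rfl)
    simpa [measureReal_def] using this
  have hqx : q.real Eᶜ ≤ (τ * ε) ^ 2 := by
    set x := q.real Eᶜ with hxdef
    have hx0 : 0 ≤ x := measureReal_nonneg
    set f : Ω → ℝ := (T ⁻¹' Eᶜ).indicator fun _ => 1 with hf
    have hEm : MeasurableSet (T ⁻¹' Eᶜ) := hT hE.compl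
    have hfm : Measurable f := measurable_const.indicator hEm
    have hfsq : ∀ ρ : Measure Ω, ∫⁻ o, ENNReal.ofReal (f o ^ 2) ∂ρ = ρ.map T Eᶜ := fun ρ => by
      rw [Measure.map_apply hT hE.compl, ← lintegral_indicator_one hEm]
      refine lintegral_congr fun o => ?_
      by_cases ho : o ∈ T ⁻¹' Eᶜ
      · simp only [hf, indicator_of_mem ho, Pi.one_apply, one_pow, ENNReal.ofReal_one]
      · simp only [hf, indicator_of_notMem ho]; simp
    have hfi : ∀ ρ : Measure Ω, ∫ o, f o ∂ρ = (ρ.map T).real Eᶜ := fun ρ => by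
      rw [hf, integral_indicator hEm]
      simp [measureReal_def, Measure.map_apply hT hE.compl]
    have e1 := h1 f x hfm hx0
      ⟨hfm.aestronglyMeasurable, by
        rw [hfsq, ← hp, ← ofReal_measureReal (measure_ne_top p _)]
        exact ENNReal.ofReal_le_ofReal (by linarith [measureReal_nonneg (μ := p) (s := Eᶜ)])⟩
      ⟨hfm.aestronglyMeasurable, by
        rw [hfsq, ← hq, ← ofReal_measureReal (measure_ne_top q _)]⟩
    rw [hfi, hfi, ← hp, ← hq, ← hxdef] at e1
    have e2 : |∫ o, f o * k o ∂(P₀ : Measure Ω)| ≤ K * x := by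
      have : ∀ o, f o * k o = (T ⁻¹' Eᶜ).indicator k o := fun o => by
        by_cases ho : o ∈ T ⁻¹' Eᶜ
        · simp only [hf, indicator_of_mem ho, one_mul]
        · simp only [hf, indicator_of_notMem ho, zero_mul]
      simp_rw [this]
      rw [integral_indicator hEm, hxdef, hq, measureReal_def, Measure.map_apply hT hE.compl]
      have hn : ∀ o ∈ T ⁻¹' Eᶜ, ‖k o‖ ≤ K := fun o _ => hkK o
      exact norm_setIntegral_le_of_norm_le_const (μ := (P₀ : Measure Ω)) (measure_lt_top _ _) hn
    have e3 : |ε * ∫ o, f o * k o ∂(P₀ : Measure Ω)| ≤ x / 4 := by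
      rw [abs_mul]
      calc |ε| * |∫ o, f o * k o ∂(P₀ : Measure Ω)| ≤ (1 / (4 * K)) * (K * x) := by gcongr
        _ = x / 4 := by field_simp
    -- The gap is at least `x/2`, the linear term accounts for at most `x/4`, and the remainder of
    -- the expansion must cover the rest. As `x` is also the second moment of the indicator, this
    -- bounds `√x` by a multiple of `|ε|`.
    have e4 : x / 4 ≤ τ / 4 * |ε| * √x := by
      have a1 := (abs_le.1 e1).1
      have a2 := (abs_le.1 e3).1
      linarith
    have e5 : √x ≤ τ * |ε| := by
      rcases hx0.eq_or_lt with h0 | h0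
      · rw [← h0, Real.sqrt_zero]; positivity
      · have : √x * √x ≤ (τ * |ε|) * √x := by rw [Real.mul_self_sqrt hx0]; linarith
        exact le_of_mul_le_mul_right this (Real.sqrt_pos.2 h0)
    calc x = √x ^ 2 := (Real.sq_sqrt hx0).symm
      _ ≤ (τ * |ε|) ^ 2 := pow_le_pow_left₀ (Real.sqrt_nonneg _) e5 2
      _ = (τ * ε) ^ 2 := by rw [mul_pow, mul_pow, sq_abs]
  refine ⟨E, hE, ?_, ?_, ?_⟩
  · refine Measure.le_iff.2 fun s hs => ?_
    rw [Measure.restrict_apply hs]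
    exact (hE1 _ (hs.inter hE) inter_subset_right).trans (measure_mono inter_subset_left)
  · rw [← ofReal_measureReal (measure_ne_top q _)]
    exact ENNReal.ofReal_le_ofReal hqx
  · rw [← ofReal_measureReal (measure_ne_top p _)]
    exact ENNReal.ofReal_le_ofReal (by linarith [measureReal_nonneg (μ := p) (s := Eᶜ)])

/-- The conditional expectation of a bounded function given a statistic `T`, as a bounded
function of `T`. -/
lemma exists_bounded_condExp (μ : Measure Ω) [IsProbabilityMeasure μ] {Ω' : Type*}
    [MeasurableSpace Ω'] {T : Ω → Ω'} (hT : Measurable T) {k : Ω → ℝ} {K : ℝ} (hK : 0 < K)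
    (hk : Measurable k) (hkK : ∀ o, |k o| ≤ K) :
    ∃ r : Ω' → ℝ, Measurable r ∧ (∀ t, |r t| ≤ K) ∧
      ∀ f : Ω' → ℝ, Measurable f → Integrable (fun o => f (T o)) μ →
        ∫ o, f (T o) * k o ∂μ = ∫ t, f t * r t ∂(μ.map T) := by
  have hle : MeasurableSpace.comap T inferInstance ≤ _ := hT.comap_le
  have hsm : StronglyMeasurable[MeasurableSpace.comap T inferInstance] (μ[k | MeasurableSpace.comap T inferInstance]) := stronglyMeasurable_condExp
  obtain ⟨r, hr, hrk⟩ := hsm.measurable.exists_eq_measurable_comp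
  have hki : Integrable k μ :=
    (L2Bound.of_bounded hk.aestronglyMeasurable (Eventually.of_forall hkK)).integrable
  have hbd : ∀ᵐ o ∂μ, |(μ[k | MeasurableSpace.comap T inferInstance]) o| ≤ K := by
    exact ae_bdd_abs_condExp_of_ae_bdd_abs (Eventually.of_forall hkK)
  -- The function `r` obeys the bound `K` only almost everywhere; clamping makes the bound hold
  -- everywhere without changing the integrals.
  refine ⟨fun t => max (-K) (min K (r t)), by fun_prop, fun t => ?_, fun f hf hfi => ?_⟩
  · rw [abs_le]
    exact ⟨le_max_left _ _, max_le (by linarith) (min_le_left _ _)⟩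
  · have h1 : ∫ o, f (T o) * k o ∂μ = ∫ o, (μ[fun o => f (T o) * k o | MeasurableSpace.comap T inferInstance]) o ∂μ :=
      (integral_condExp hle).symm
    have hfm : StronglyMeasurable[MeasurableSpace.comap T inferInstance] (fun o => f (T o)) :=
      (hf.comp (comap_measurable T)).stronglyMeasurable
    have hfk : Integrable (fun o => f (T o) * k o) μ :=
      hfi.mul_bdd hk.aestronglyMeasurable (Eventually.of_forall hkK)
    rw [h1, integral_map hT.aemeasurable (by fun_prop)]
    refine integral_congr_ae ?_
    filter_upwards [condExp_mul_of_stronglyMeasurable_left hfm hfk hki, hbd] with o ho hb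
    rw [hrk] at hb
    simp only [Function.comp_apply, abs_le] at hb
    have ho' : (μ[fun o => f (T o) * k o | MeasurableSpace.comap T inferInstance]) o = f (T o) * r (T o) := by
      rw [← show (μ[k | MeasurableSpace.comap T inferInstance]) o = r (T o) by rw [hrk]; rfl]; exact ho
    rw [ho', min_eq_right hb.2, max_eq_right hb.1]

end Expansion

/-! ### Jensen's inequality for partial integrals -/

section Partial

variable {α β : Type*} [MeasurableSpace α] [MeasurableSpace β]

lemma ofReal_sq_integral_le (Q : Measure β) [IsProbabilityMeasure Q] {g : β → ℝ}
    (hg : Measurable g) :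
    ENNReal.ofReal ((∫ w, g w ∂Q) ^ 2) ≤ ∫⁻ w, ENNReal.ofReal (g w ^ 2) ∂Q := by
  by_cases h : ∫⁻ w, ENNReal.ofReal (g w ^ 2) ∂Q = ⊤
  · rw [h]; exact le_top
  · have hb : L2Bound g Q (∫⁻ w, ENNReal.ofReal (g w ^ 2) ∂Q).toReal :=
      ⟨hg.aestronglyMeasurable, by rw [ENNReal.ofReal_toReal h]⟩
    rw [← ENNReal.ofReal_toReal h]
    refine ENNReal.ofReal_le_ofReal ?_
    rw [← sq_abs, ← Real.sq_sqrt (ENNReal.toReal_nonneg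
      (a := ∫⁻ w, ENNReal.ofReal (g w ^ 2) ∂Q))]
    exact pow_le_pow_left₀ (abs_nonneg _) hb.abs_integral_le 2

variable {F : Measure α} {Q : Measure β} {ζ : α × β → ℝ} {S : ℝ}

lemma L2Bound.integral_right [SFinite F] [IsProbabilityMeasure Q] (hζ : Measurable ζ)
    (h : L2Bound ζ (F.prod Q) S) : L2Bound (fun a => ∫ w, ζ (a, w) ∂Q) F S := by
  refine ⟨(hζ.stronglyMeasurable.integral_prod_right').aestronglyMeasurable, le_trans ?_ h.le⟩
  rw [lintegral_prod _ (by fun_prop)]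
  exact lintegral_mono fun a => ofReal_sq_integral_le Q (by fun_prop)

lemma L2Bound.integral_left [IsProbabilityMeasure F] [SFinite Q] (hζ : Measurable ζ)
    (h : L2Bound ζ (F.prod Q) S) : L2Bound (fun w => ∫ a, ζ (a, w) ∂F) Q S := by
  refine ⟨(hζ.stronglyMeasurable.integral_prod_left').aestronglyMeasurable, le_trans ?_ h.le⟩
  rw [lintegral_prod_symm _ (by fun_prop)]
  exact lintegral_mono fun w => ofReal_sq_integral_le F (by fun_prop)

end Partial

/-! ### Densities and regressions in the bounded model -/

section Model

variable {d : ℕ}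

/-- The joint distribution of exposure and covariates. -/
noncomputable def jointLaw (P : ProbabilityMeasure (Obs d)) : Measure (ℝ × (Fin d → ℝ)) :=
  (P : Measure (Obs d)).map Prod.snd

instance (P : ProbabilityMeasure (Obs d)) : IsProbabilityMeasure (jointLaw P) :=
  Measure.isProbabilityMeasure_map measurable_snd.aemeasurable

instance (P : ProbabilityMeasure (Obs d)) : IsProbabilityMeasure (exposureLaw P) :=
  Measure.isProbabilityMeasure_map (by fun_prop)

instance (P : ProbabilityMeasure (Obs d)) : IsProbabilityMeasure (covariateLaw P) :=
  Measure.isProbabilityMeasure_map (by fun_prop)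

instance (P : ProbabilityMeasure (Obs d)) : IsMarkovKernel (exposureCondLaw P) := by
  unfold exposureCondLaw; infer_instance

lemma map_fst_jointLaw (P : ProbabilityMeasure (Obs d)) :
    (jointLaw P).map Prod.fst = exposureLaw P :=
  Measure.map_map measurable_fst measurable_snd

lemma map_snd_jointLaw (P : ProbabilityMeasure (Obs d)) :
    (jointLaw P).map Prod.snd = covariateLaw P :=
  Measure.map_map measurable_snd measurable_snd

@[fun_prop]
lemma measurable_propensity (P : ProbabilityMeasure (Obs d)) :
    Measurable fun z : ℝ × (Fin d → ℝ) => propensity P z.1 z.2 :=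
  ((Kernel.measurable_rnDeriv (exposureCondLaw P)
    (Kernel.const (Fin d → ℝ) (exposureLaw P))).comp measurable_swap).ennreal_toReal

@[fun_prop]
lemma measurable_outcomeReg (P : ProbabilityMeasure (Obs d)) :
    Measurable fun z : ℝ × (Fin d → ℝ) => outcomeReg P z.1 z.2 :=
  (StronglyMeasurable.integral_condDistrib (X := fun o : Obs d => o.2) (Y := fun o : Obs d => o.1)
    (μ := (P : Measure (Obs d))) (f := fun q : (ℝ × (Fin d → ℝ)) × ℝ => q.2)
    measurable_snd.stronglyMeasurable).measurable

lemma covariateLaw_compProd_exposureCondLaw (P : ProbabilityMeasure (Obs d)) :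
    covariateLaw P ⊗ₘ exposureCondLaw P = (jointLaw P).map Prod.swap := by
  unfold covariateLaw exposureCondLaw jointLaw
  rw [compProd_map_condDistrib (by fun_prop), Measure.map_map measurable_swap measurable_snd]
  rfl

/-- Disintegrate over `W` and use, for almost every `w`, that `G_P(·, w)` has density `g_P(·, w)`
with respect to `F_P`. -/
lemma jointLaw_eq_withDensity (P : ProbabilityMeasure (Obs d))
    (h : ∀ᵐ w ∂(covariateLaw P), exposureCondLaw P w ≪ exposureLaw P) :
    jointLaw P = ((exposureLaw P).prod (covariateLaw P)).withDensity
      fun z => ENNReal.ofReal (propensity P z.1 z.2) := by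
  have h1 : jointLaw P = (covariateLaw P ⊗ₘ exposureCondLaw P).map Prod.swap := by
    rw [covariateLaw_compProd_exposureCondLaw, Measure.map_map measurable_swap measurable_swap]
    simp
  refine Measure.ext fun s hs => ?_
  rw [h1, Measure.map_apply measurable_swap hs, Measure.compProd_apply (measurable_swap hs),
    withDensity_apply _ hs, ← lintegral_indicator hs,
    lintegral_prod_symm _ (Measurable.aemeasurable (by
      refine Measurable.indicator ?_ hs
      exact (measurable_propensity P).ennreal_ofReal))]
  refine lintegral_congr_ae ?_
  filter_upwards [h] with w hw
  have hsw : MeasurableSet (Prod.mk w ⁻¹' (Prod.swap ⁻¹' s) : Set ℝ) :=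
    measurable_prodMk_left (measurable_swap hs)
  have h2 := Kernel.setLIntegral_rnDeriv (κ := exposureCondLaw P)
    (η := Kernel.const (Fin d → ℝ) (exposureLaw P)) (a := w) (by simpa using hw) hsw
  rw [← h2, ← lintegral_indicator hsw, Kernel.const_apply]
  refine lintegral_congr_ae ?_
  have h3 := Kernel.rnDeriv_ne_top (exposureCondLaw P)
    (Kernel.const (Fin d → ℝ) (exposureLaw P)) (a := w)
  rw [Kernel.const_apply] at h3
  filter_upwards [h3] with a ha
  by_cases hz : (a, w) ∈ s
  · rw [indicator_of_mem (by simpa using hz), indicator_of_mem hz, propensity,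
      ENNReal.ofReal_toReal ha]
  · rw [indicator_of_notMem (by simpa using hz), indicator_of_notMem hz]

/-- A bounded version of the inverse propensity, for propensities bounded below by `η`. -/
noncomputable def invPropensity (P : ProbabilityMeasure (Obs d)) (η : ℝ)
    (z : ℝ × (Fin d → ℝ)) : ℝ :=
  (max η (propensity P z.1 z.2))⁻¹

@[fun_prop]
lemma measurable_invPropensity (P : ProbabilityMeasure (Obs d)) (η : ℝ) :
    Measurable (invPropensity P η) := by
  unfold invPropensity; fun_prop

lemma invPropensity_nonneg (P : ProbabilityMeasure (Obs d)) {η : ℝ} (hη : 0 < η)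
    (z : ℝ × (Fin d → ℝ)) : 0 ≤ invPropensity P η z :=
  inv_nonneg.2 (hη.le.trans (le_max_left _ _))

lemma invPropensity_le (P : ProbabilityMeasure (Obs d)) {η : ℝ} (hη : 0 < η)
    (z : ℝ × (Fin d → ℝ)) : invPropensity P η z ≤ η⁻¹ :=
  inv_anti₀ hη (le_max_left _ _)

lemma abs_invPropensity_le (P : ProbabilityMeasure (Obs d)) {η : ℝ} (hη : 0 < η)
    (z : ℝ × (Fin d → ℝ)) : |invPropensity P η z| ≤ η⁻¹ := by
  rw [abs_of_nonneg (invPropensity_nonneg P hη z)]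
  exact invPropensity_le P hη z

variable {𝒴 𝒜 : Set ℝ} {𝒲 : Set (Fin d → ℝ)} {P : ProbabilityMeasure (Obs d)} {η C : ℝ}

lemma boundedModel_mono {η' C' : ℝ} (hη : η' ≤ η) (hC : C ≤ C')
    (hP : P ∈ boundedModel 𝒴 𝒜 𝒲 η C) : P ∈ boundedModel 𝒴 𝒜 𝒲 η' C' :=
  ⟨hP.1, hP.2.1, hP.2.2.1.mono fun _ h => hη.trans h,
    hP.2.2.2.trans (ENNReal.ofReal_le_ofReal hC)⟩

/-- Since `g_P ≥ η` almost everywhere, the density of the joint law can be inverted. This is what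
turns integrals over independent copies of `A` and `W` into weighted expectations over the data. -/
lemma prod_eq_withDensity (hη : 0 < η) (hP : P ∈ boundedModel 𝒴 𝒜 𝒲 η C) :
    (exposureLaw P).prod (covariateLaw P)
      = (jointLaw P).withDensity fun z => ENNReal.ofReal (invPropensity P η z) := by
  have hm : Measurable fun z : ℝ × (Fin d → ℝ) => ENNReal.ofReal (propensity P z.1 z.2) :=
    (measurable_propensity P).ennreal_ofReal
  rw [jointLaw_eq_withDensity P hP.2.1,
    ← withDensity_mul _ hm (measurable_invPropensity P η).ennreal_ofReal]
  have : (fun z : ℝ × (Fin d → ℝ) => ENNReal.ofReal (propensity P z.1 z.2))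
      * (fun z => ENNReal.ofReal (invPropensity P η z))
      =ᵐ[(exposureLaw P).prod (covariateLaw P)] 1 := by
    filter_upwards [hP.2.2.1] with z hz
    have : 0 < propensity P z.1 z.2 := hη.trans_le hz
    rw [Pi.mul_apply, ← ENNReal.ofReal_mul this.le, invPropensity, max_eq_right hz,
      mul_inv_cancel₀ this.ne']
    simp
  rw [withDensity_congr_ae this, withDensity_one]

lemma prod_le_smul_jointLaw (hη : 0 < η) (hP : P ∈ boundedModel 𝒴 𝒜 𝒲 η C) :
    (exposureLaw P).prod (covariateLaw P) ≤ ENNReal.ofReal η⁻¹ • jointLaw P := by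
  rw [prod_eq_withDensity hη hP, ← withDensity_const]
  exact withDensity_mono (Eventually.of_forall fun z =>
    ENNReal.ofReal_le_ofReal (invPropensity_le P hη z))

lemma jointLaw_absolutelyContinuous (hP : P ∈ boundedModel 𝒴 𝒜 𝒲 η C) :
    jointLaw P ≪ (exposureLaw P).prod (covariateLaw P) := by
  rw [jointLaw_eq_withDensity P hP.2.1]
  exact withDensity_absolutelyContinuous _ _

lemma integral_prod_eq_integral_jointLaw (hη : 0 < η) (hP : P ∈ boundedModel 𝒴 𝒜 𝒲 η C)
    (f : ℝ × (Fin d → ℝ) → ℝ) :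
    ∫ z, f z ∂((exposureLaw P).prod (covariateLaw P))
      = ∫ z, invPropensity P η z * f z ∂(jointLaw P) := by
  rw [prod_eq_withDensity hη hP, integral_withDensity_eq_integral_toReal_smul
    (measurable_invPropensity P η).ennreal_ofReal (Eventually.of_forall fun z => ENNReal.ofReal_lt_top)]
  refine integral_congr_ae (Eventually.of_forall fun z => ?_)
  simp [ENNReal.toReal_ofReal (invPropensity_nonneg P hη z)]

lemma integral_jointLaw {f : ℝ × (Fin d → ℝ) → ℝ} (hf : Measurable f) :
    ∫ z, f z ∂(jointLaw P) = ∫ o, f o.2 ∂(P : Measure (Obs d)) :=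
  integral_map measurable_snd.aemeasurable hf.aestronglyMeasurable

lemma integral_exposureLaw {f : ℝ → ℝ} (hf : Measurable f) :
    ∫ z, f z ∂(exposureLaw P) = ∫ o, f o.2.1 ∂(P : Measure (Obs d)) :=
  integral_map (by fun_prop) hf.aestronglyMeasurable

lemma l2Bound_outcome (hP : P ∈ boundedModel 𝒴 𝒜 𝒲 η C) :
    L2Bound (fun o : Obs d => o.1) (P : Measure (Obs d)) C :=
  ⟨measurable_fst.aestronglyMeasurable, hP.2.2.2⟩

lemma condExp_outcome_ae_eq (hi : Integrable (fun o : Obs d => o.1) (P : Measure (Obs d))) :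
    (P : Measure (Obs d))[fun o : Obs d => o.1 |
        MeasurableSpace.comap (fun o : Obs d => o.2) inferInstance]
      =ᵐ[(P : Measure (Obs d))] fun o => outcomeReg P o.2.1 o.2.2 :=
  condExp_ae_eq_integral_condDistrib' measurable_snd hi

/-- Conditional expectation is a contraction on `L²`. -/
lemma l2Bound_outcomeReg (hC : 0 ≤ C) (hP : P ∈ boundedModel 𝒴 𝒜 𝒲 η C) :
    L2Bound (fun z : ℝ × (Fin d → ℝ) => outcomeReg P z.1 z.2) (jointLaw P) C := by
  have hy := l2Bound_outcome hP
  refine L2Bound.map measurable_snd (measurable_outcomeReg P) ?_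
  rw [← Real.sq_sqrt hC]
  refine L2Bound.of_eLpNorm_le (Measurable.aestronglyMeasurable
    ((measurable_outcomeReg P).comp measurable_snd)) (Real.sqrt_nonneg _) ?_
  rw [← eLpNorm_congr_ae (condExp_outcome_ae_eq hy.integrable)]
  exact (eLpNorm_condExp_le_eLpNorm _ (by norm_num)).trans hy.eLpNorm_le

lemma l2Bound_outcomeReg_prod (hη : 0 < η) (hC : 0 ≤ C) (hP : P ∈ boundedModel 𝒴 𝒜 𝒲 η C) :
    L2Bound (fun z : ℝ × (Fin d → ℝ) => outcomeReg P z.1 z.2)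
      ((exposureLaw P).prod (covariateLaw P)) (η⁻¹ * C) :=
  (l2Bound_outcomeReg hC hP).of_measure_le (by positivity) (prod_le_smul_jointLaw hη hP)

/-- The tower property of the outcome regression. -/
lemma integral_mul_outcome (hi : Integrable (fun o : Obs d => o.1) (P : Measure (Obs d)))
    {f : ℝ × (Fin d → ℝ) → ℝ} (hf : Measurable f)
    (hfi : Integrable (fun o : Obs d => f o.2 * o.1) (P : Measure (Obs d))) :
    ∫ o, f o.2 * o.1 ∂(P : Measure (Obs d)) = ∫ z, f z * outcomeReg P z.1 z.2 ∂(jointLaw P) := by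
  have hle : MeasurableSpace.comap (fun o : Obs d => o.2) inferInstance
    ≤ (inferInstance : MeasurableSpace (Obs d)) := measurable_snd.comap_le
  have hfm : StronglyMeasurable[MeasurableSpace.comap (fun o : Obs d => o.2) inferInstance]
      (fun o : Obs d => f o.2) :=
    (hf.comp (comap_measurable (fun o : Obs d => o.2))).stronglyMeasurable
  rw [integral_jointLaw (f := fun z => f z * outcomeReg P z.1 z.2) (by fun_prop), ← integral_condExp hle]
  refine integral_congr_ae ?_
  filter_upwards [condExp_mul_of_stronglyMeasurable_left hfm hfi hi, condExp_outcome_ae_eq hi]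
    with o h1 h2
  rw [← h2]
  exact h1

/-- `∫ φ(a) μ_P(a, w) F_P(da) Q_P(dw)`. -/
noncomputable def weightedReg (φ : ℝ → ℝ) (P : ProbabilityMeasure (Obs d)) : ℝ :=
  ∫ z, φ z.1 * outcomeReg P z.1 z.2 ∂((exposureLaw P).prod (covariateLaw P))

lemma weightedReg_eq_integral_gCompReg (hη : 0 < η) (hC : 0 ≤ C)
    (hP : P ∈ boundedModel 𝒴 𝒜 𝒲 η C) {φ : ℝ → ℝ} (hφ : Measurable φ) {c : ℝ}
    (hc : ∀ a, |φ a| ≤ c) :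
    weightedReg φ P = ∫ a, φ a * gCompReg P a ∂(exposureLaw P) := by
  have hi : Integrable (fun z : ℝ × (Fin d → ℝ) => φ z.1 * outcomeReg P z.1 z.2)
      ((exposureLaw P).prod (covariateLaw P)) :=
    ((l2Bound_outcomeReg_prod hη hC hP).mul_left (g := fun z => φ z.1)
      (Measurable.aestronglyMeasurable (by fun_prop)) (Eventually.of_forall fun z => hc z.1)).integrable
  rw [weightedReg, integral_prod _ hi]
  simp_rw [integral_const_mul]
  rfl

lemma primitiveParam_eq (hη : 0 < η) (hC : 0 ≤ C) (hP : P ∈ boundedModel 𝒴 𝒜 𝒲 η C) (a₀ : ℝ) :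
    primitiveParam a₀ P = weightedReg ((Iic a₀).indicator 1) P
      - weightedReg (fun _ => 1) P * exposureCDF P a₀ := by
  rw [weightedReg_eq_integral_gCompReg hη hC hP (measurable_one.indicator measurableSet_Iic)
      (c := 1), weightedReg_eq_integral_gCompReg hη hC hP measurable_const (c := 1)]
  · have : (fun a => (Iic a₀).indicator 1 a * gCompReg P a) = (Iic a₀).indicator (gCompReg P) := by
      ext a; by_cases h : a ∈ Iic a₀
      · simp only [indicator_of_mem h, Pi.one_apply, one_mul]
      · simp only [indicator_of_notMem h, zero_mul]
    simp only [primitiveParam, regPrimitive, meanReg, one_mul]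
    rw [this, integral_indicator measurableSet_Iic]
  · simp
  · intro a; by_cases h : a ∈ Iic a₀
    · simp only [indicator_of_mem h, Pi.one_apply, abs_one, le_refl]
    · simp only [indicator_of_notMem h, abs_zero, zero_le_one]

end Model

/-! ### First-order expansion of the weighted regression mean -/

section Expands

variable {Ω α β : Type*} [MeasurableSpace Ω] [MeasurableSpace α] [MeasurableSpace β]

/-- `P - Q` is `ε k Q` up to an error that is at most `c |ε|` relative to square-integral bounds. -/
def ExpandsAt (P Q : Measure Ω) (k : Ω → ℝ) (ε c : ℝ) : Prop :=
  ∀ (f : Ω → ℝ) (S : ℝ), Measurable f → 0 ≤ S → L2Bound f P S → L2Bound f Q S →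
    |∫ o, f o ∂P - ∫ o, f o ∂Q - ε * ∫ o, f o * k o ∂Q| ≤ c * |ε| * √S

/-- `r` is the conditional expectation of `k` given `T` under `Q`, tested on integrable functions
of `T`. -/
def IsRegression (Q : Measure Ω) (T : Ω → α) (k : Ω → ℝ) (r : α → ℝ) : Prop :=
  ∀ f : α → ℝ, Measurable f → Integrable (fun o => f (T o)) Q →
    ∫ o, f (T o) * k o ∂Q = ∫ t, f t * r t ∂(Q.map T)

/-- With `k = 0`, `ExpandsAt` is a Lipschitz estimate; this lets it be pushed forward by the same
lemma as the expansions. -/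
lemma isRegression_zero (Q : Measure Ω) (T : Ω → α) : IsRegression Q T 0 0 := by
  intro f _ _; simp

lemma ExpandsAt.map {P Q : Measure Ω} [IsFiniteMeasure Q] {k : Ω → ℝ} {ε c : ℝ}
    (H : ExpandsAt P Q k ε c) {T : Ω → α} (hT : Measurable T) {r : α → ℝ}
    (hr : IsRegression Q T k r) : ExpandsAt (P.map T) (Q.map T) r ε c := by
  intro f S hf hS hP hQ
  have h := H (fun o => f (T o)) S (hf.comp hT) hS (hP.comp_map hT) (hQ.comp_map hT)
  rw [hr f hf (hQ.comp_map hT).integrable] at h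
  rwa [integral_map hT.aemeasurable hf.aestronglyMeasurable,
    integral_map hT.aemeasurable hf.aestronglyMeasurable]

/-- Integrating out the other coordinate yields a test function with the same bound on its second
moment, by Jensen, and the weight `r` factors out of the inner integral. -/
lemma ExpandsAt.integral_prod_left {p q : Measure α} [IsProbabilityMeasure p]
    [IsProbabilityMeasure q] {R : Measure β} [IsProbabilityMeasure R] {r : α → ℝ} {ε c K S : ℝ}
    (H : ExpandsAt p q r ε c) (hr : Measurable r) (hrK : ∀ t, |r t| ≤ K) (hS : 0 ≤ S)
    {ζ : α × β → ℝ} (hζ : Measurable ζ) (hp : L2Bound ζ (p.prod R) S)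
    (hq : L2Bound ζ (q.prod R) S) :
    |∫ z, ζ z ∂(p.prod R) - ∫ z, ζ z ∂(q.prod R) - ε * ∫ z, ζ z * r z.1 ∂(q.prod R)|
      ≤ c * |ε| * √S := by
  have h := H _ S (hζ.stronglyMeasurable.integral_prod_right').measurable hS
    (hp.integral_right hζ) (hq.integral_right hζ)
  have hi : Integrable (fun z => ζ z * r z.1) (q.prod R) :=
    hq.integrable.mul_bdd (Measurable.aestronglyMeasurable (by fun_prop))
      (Eventually.of_forall fun z => hrK z.1)
  rw [integral_prod _ hp.integrable, integral_prod _ hq.integrable, integral_prod _ hi]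
  simp_rw [integral_mul_const]
  exact h

lemma ExpandsAt.integral_prod_right {p q : Measure β} [IsProbabilityMeasure p]
    [IsProbabilityMeasure q] {R : Measure α} [IsProbabilityMeasure R] {r : β → ℝ} {ε c K S : ℝ}
    (H : ExpandsAt p q r ε c) (hr : Measurable r) (hrK : ∀ t, |r t| ≤ K) (hS : 0 ≤ S)
    {ζ : α × β → ℝ} (hζ : Measurable ζ) (hp : L2Bound ζ (R.prod p) S)
    (hq : L2Bound ζ (R.prod q) S) :
    |∫ z, ζ z ∂(R.prod p) - ∫ z, ζ z ∂(R.prod q) - ε * ∫ z, ζ z * r z.2 ∂(R.prod q)|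
      ≤ c * |ε| * √S := by
  have h := H _ S (hζ.stronglyMeasurable.integral_prod_left').measurable hS
    (hp.integral_left hζ) (hq.integral_left hζ)
  have hi : Integrable (fun z => ζ z * r z.2) (R.prod q) :=
    hq.integrable.mul_bdd (Measurable.aestronglyMeasurable (by fun_prop))
      (Eventually.of_forall fun z => hrK z.2)
  rw [integral_prod_symm _ hp.integrable, integral_prod_symm _ hq.integrable,
    integral_prod_symm _ hi]
  simp_rw [integral_mul_const]
  exact h

lemma L2Bound.of_restrict {μ : Measure α} {f : α → ℝ} {S : ℝ} {E : Set α} (hE : MeasurableSet E)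
    (hf : Measurable f) (h0 : ∀ x ∉ E, f x = 0) (h : L2Bound f (μ.restrict E) S) :
    L2Bound f μ S := by
  refine ⟨hf.aestronglyMeasurable, le_of_eq_of_le ?_ h.le⟩
  rw [← lintegral_indicator hE]
  refine lintegral_congr fun x => ?_
  by_cases hx : x ∈ E
  · rw [indicator_of_mem hx]
  · rw [indicator_of_notMem hx, h0 x hx]; simp

end Expands

/-! ### Expansion of the weighted regression mean along a path -/

section WeightedReg

variable {d : ℕ}

/-- The uncentered gradient of `weightedReg φ` at `P`. -/
noncomputable def weightedRegGradient (φ : ℝ → ℝ) (P : ProbabilityMeasure (Obs d)) (η : ℝ)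
    (o : Obs d) : ℝ :=
  φ o.2.1 * invPropensity P η o.2 * (o.1 - outcomeReg P o.2.1 o.2.2) + φ o.2.1 * gCompReg P o.2.1
    + ∫ u, φ u * outcomeReg P u o.2.2 ∂(exposureLaw P)

variable {𝒴 𝒜 : Set ℝ} {𝒲 : Set (Fin d → ℝ)} {P P₀ : ProbabilityMeasure (Obs d)} {η C : ℝ}

@[fun_prop]
lemma measurable_gCompReg (P : ProbabilityMeasure (Obs d)) : Measurable (gCompReg P) :=
  ((measurable_outcomeReg P).stronglyMeasurable.integral_prod_right').measurable

/-- The regression weighted by `φ` and truncated to a set where the laws under `P` dominate those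
under `P₀` has square integrals that are bounded under all the laws involved. -/
lemma l2Bound_truncated (hη : 0 < η) (hC : 0 ≤ C) (hP : P ∈ boundedModel 𝒴 𝒜 𝒲 η C)
    (hP₀ : P₀ ∈ boundedModel 𝒴 𝒜 𝒲 η C) {ζ : ℝ × (Fin d → ℝ) → ℝ} (hζ : Measurable ζ)
    (hle : ∀ z, |ζ z| ≤ 1 * |outcomeReg P z.1 z.2|) {EA : Set ℝ} {Em : Set (ℝ × (Fin d → ℝ))}
    (hEA : MeasurableSet EA) (hEm : MeasurableSet Em)
    (h0 : ∀ z, ¬ (z.1 ∈ EA ∧ z ∈ Em) → ζ z = 0)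
    (hdA : (exposureLaw P₀).restrict EA ≤ ENNReal.ofReal 2 • exposureLaw P)
    (hdm : (jointLaw P₀).restrict Em ≤ ENNReal.ofReal 2 • jointLaw P) :
    let S := 2 * C * (1 + η⁻¹)
    0 ≤ S ∧ L2Bound ζ (jointLaw P) S ∧ L2Bound ζ (jointLaw P₀) S ∧
      L2Bound ζ ((exposureLaw P).prod (covariateLaw P)) S ∧
      L2Bound ζ ((exposureLaw P₀).prod (covariateLaw P)) S ∧
      L2Bound ζ ((exposureLaw P₀).prod (covariateLaw P₀)) S := by
  intro S
  have hη' : 0 ≤ η⁻¹ := by positivity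
  have hCη : 0 ≤ C * η⁻¹ := by positivity
  have h1 : L2Bound ζ (jointLaw P) C := by
    simpa using (l2Bound_outcomeReg hC hP).of_abs_le hζ.aestronglyMeasurable
      (Eventually.of_forall hle)
  have h2 := h1.of_measure_le hη' (prod_le_smul_jointLaw hη hP)
  have h3 : L2Bound ζ (jointLaw P₀) (2 * C) :=
    L2Bound.of_restrict hEm hζ (fun z hz => h0 z fun h => hz h.2)
      (h1.of_measure_le (by norm_num) hdm)
  have h4 := h3.of_measure_le hη' (prod_le_smul_jointLaw hη hP₀)
  -- For the mixed product only the exposure law has to be compared: `F₀` is at most `2 F` on `EA`,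
  -- with the covariate law of `P` kept.
  have h5 : L2Bound ζ ((exposureLaw P₀).prod (covariateLaw P)) (2 * (η⁻¹ * C)) := by
    refine L2Bound.of_restrict (hEA.prod MeasurableSet.univ) hζ
      (fun z hz => h0 z fun h => hz ⟨h.1, trivial⟩) (h2.of_measure_le (by norm_num) ?_)
    rw [← Measure.prod_restrict, Measure.restrict_univ, ← Measure.prod_smul_left]
    exact Measure.prod_mono hdA le_rfl
  refine ⟨by positivity, h1.mono ?_, h3.mono ?_, h2.mono ?_, h5.mono ?_, h4.mono ?_⟩ <;>
    simp only [S] <;> nlinarith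

lemma integral_outcome_eq (hP : P ∈ boundedModel 𝒴 𝒜 𝒲 η C)
    {f : ℝ × (Fin d → ℝ) → ℝ} (hf : Measurable f) {c : ℝ} (hc : ∀ z, |f z| ≤ c) :
    ∫ o, f o.2 * o.1 ∂(P : Measure (Obs d)) = ∫ z, f z * outcomeReg P z.1 z.2 ∂(jointLaw P) := by
  have hy := l2Bound_outcome hP
  exact integral_mul_outcome hy.integrable hf
    (hy.mul_left (g := fun o : Obs d => f o.2) (Measurable.aestronglyMeasurable (by fun_prop))
      (Eventually.of_forall fun o => hc o.2)).integrable

/-- The weighted outcome regression, its weighted mean over the covariates and its weighted mean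
over the exposure are square integrable. -/
lemma l2Bound_gradient_parts (hη : 0 < η) (hC : 0 ≤ C) (hP : P ∈ boundedModel 𝒴 𝒜 𝒲 η C)
    {φ : ℝ → ℝ} (hφ : Measurable φ) (hφ1 : ∀ a, |φ a| ≤ 1) :
    L2Bound (fun o : Obs d => (φ o.2.1 * invPropensity P η o.2) * o.1) (P : Measure (Obs d))
      (η⁻¹ ^ 2 * C) ∧
    L2Bound (fun o : Obs d => (φ o.2.1 * invPropensity P η o.2) * outcomeReg P o.2.1 o.2.2)
      (P : Measure (Obs d)) (η⁻¹ ^ 2 * C) ∧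
    L2Bound (fun o : Obs d => φ o.2.1 * gCompReg P o.2.1) (P : Measure (Obs d)) (η⁻¹ * C) ∧
    L2Bound (fun o : Obs d => ∫ u, φ u * outcomeReg P u o.2.2 ∂(exposureLaw P))
      (P : Measure (Obs d)) (η⁻¹ * C) := by
  have hb : ∀ z : ℝ × (Fin d → ℝ), |φ z.1 * invPropensity P η z| ≤ η⁻¹ := fun z => by
    rw [abs_mul]
    calc |φ z.1| * |invPropensity P η z| ≤ 1 * η⁻¹ :=
          mul_le_mul (hφ1 _) (abs_invPropensity_le P hη z) (abs_nonneg _) zero_le_one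
      _ = η⁻¹ := one_mul _
  have hμ := l2Bound_outcomeReg_prod hη hC hP
  have hζ : L2Bound (fun z : ℝ × (Fin d → ℝ) => φ z.1 * outcomeReg P z.1 z.2)
      ((exposureLaw P).prod (covariateLaw P)) (η⁻¹ * C) := by
    simpa using hμ.mul_left (g := fun z => φ z.1) (c := 1)
      (Measurable.aestronglyMeasurable (by fun_prop)) (Eventually.of_forall fun z => hφ1 z.1)
  have hζm : Measurable (fun z : ℝ × (Fin d → ℝ) => φ z.1 * outcomeReg P z.1 z.2) := by fun_prop
  refine ⟨(l2Bound_outcome hP).mul_left (g := fun o : Obs d => φ o.2.1 * invPropensity P η o.2)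
      (Measurable.aestronglyMeasurable (by fun_prop)) (Eventually.of_forall fun o => hb o.2),
    ((l2Bound_outcomeReg hC hP).comp_map measurable_snd).mul_left
      (g := fun o : Obs d => φ o.2.1 * invPropensity P η o.2)
      (Measurable.aestronglyMeasurable (by fun_prop)) (Eventually.of_forall fun o => hb o.2), ?_, ?_⟩
  · have h := hζ.integral_right hζm
    simp_rw [integral_const_mul] at h
    exact h.comp_map (T := fun o : Obs d => o.2.1) (by fun_prop)
  · exact (hζ.integral_left hζm).comp_map (T := fun o : Obs d => o.2.2) (by fun_prop)

lemma l2Bound_weightedRegGradient (hη : 0 < η) (hC : 0 ≤ C) (hP : P ∈ boundedModel 𝒴 𝒜 𝒲 η C)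
    {φ : ℝ → ℝ} (hφ : Measurable φ) (hφ1 : ∀ a, |φ a| ≤ 1) :
    ∃ S, 0 ≤ S ∧ L2Bound (weightedRegGradient φ P η) (P : Measure (Obs d)) S := by
  obtain ⟨h1, h2, h3, h4⟩ := l2Bound_gradient_parts hη hC hP hφ hφ1
  have hη' : 0 ≤ η⁻¹ := by positivity
  have h2' : L2Bound (fun o : Obs d =>
      -((φ o.2.1 * invPropensity P η o.2) * outcomeReg P o.2.1 o.2.2)) (P : Measure (Obs d))
      (1 ^ 2 * (η⁻¹ ^ 2 * C)) :=
    h2.of_abs_le h2.aesm.neg (Eventually.of_forall fun o => by simp)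
  have h := (((h1.add h2' (by positivity) (by positivity)).add h3 (by positivity)
    (by positivity)).add h4 (by positivity) (by positivity)).congr
    (g := weightedRegGradient φ P η) (Eventually.of_forall fun o => by
      simp only [weightedRegGradient]; ring)
  exact ⟨_, by positivity, h⟩

/-- The terms with `θ_P(a)` and with the integral over `u` depend on `a` alone and on `w` alone, so
`k` may be projected to `kA` and `kW`. Both become integrals over `F_P ⊗ Q_P`, hence over the joint
law with weight `invPropensity`, where they combine with the projection `kJ` of the residual's
regression part. -/
lemma integral_weightedRegGradient_mul (hη : 0 < η) (hC : 0 ≤ C)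
    (hP : P ∈ boundedModel 𝒴 𝒜 𝒲 η C) {φ : ℝ → ℝ} (hφ : Measurable φ) (hφ1 : ∀ a, |φ a| ≤ 1)
    {k : Obs d → ℝ} {K : ℝ} (hk : Measurable k) (hkK : ∀ o, |k o| ≤ K) {kA : ℝ → ℝ}
    {kW : (Fin d → ℝ) → ℝ} {kJ : ℝ × (Fin d → ℝ) → ℝ} (hkA : Measurable kA) (hkW : Measurable kW)
    (hkJ : Measurable kJ) (hkAK : ∀ t, |kA t| ≤ K) (hkWK : ∀ t, |kW t| ≤ K)
    (hkJK : ∀ t, |kJ t| ≤ K)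
    (hA : IsRegression (P : Measure (Obs d)) (fun o => o.2.1) k kA)
    (hW : IsRegression (P : Measure (Obs d)) (fun o => o.2.2) k kW)
    (hJ : IsRegression (P : Measure (Obs d)) Prod.snd k kJ) :
    ∫ o, weightedRegGradient φ P η o * k o ∂(P : Measure (Obs d))
      = ∫ o, (φ o.2.1 * invPropensity P η o.2) * o.1 * k o ∂(P : Measure (Obs d))
        + ∫ z, (φ z.1 * invPropensity P η z * (kA z.1 + kW z.2 - kJ z)) * outcomeReg P z.1 z.2
          ∂(jointLaw P) := by
  obtain ⟨h1, h2, h3, h4⟩ := l2Bound_gradient_parts hη hC hP hφ hφ1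
  have hkb : ∀ {f : Obs d → ℝ} {S : ℝ}, L2Bound f (P : Measure (Obs d)) S →
      Integrable (fun o => f o * k o) (P : Measure (Obs d)) := fun hf =>
    hf.integrable.mul_bdd hk.aestronglyMeasurable (Eventually.of_forall hkK)
  have hμ := l2Bound_outcomeReg_prod hη hC hP
  have hζ : L2Bound (fun z : ℝ × (Fin d → ℝ) => φ z.1 * outcomeReg P z.1 z.2)
      ((exposureLaw P).prod (covariateLaw P)) (η⁻¹ * C) := by
    simpa using hμ.mul_left (g := fun z => φ z.1) (c := 1)
      (Measurable.aestronglyMeasurable (by fun_prop)) (Eventually.of_forall fun z => hφ1 z.1)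
  have hζm : Measurable (fun z : ℝ × (Fin d → ℝ) => φ z.1 * outcomeReg P z.1 z.2) := by fun_prop
  have hiA : Integrable (fun z : ℝ × (Fin d → ℝ) => φ z.1 * outcomeReg P z.1 z.2 * kA z.1)
      ((exposureLaw P).prod (covariateLaw P)) :=
    hζ.integrable.mul_bdd (Measurable.aestronglyMeasurable (by fun_prop))
      (Eventually.of_forall fun z => hkAK z.1)
  have hiW : Integrable (fun z : ℝ × (Fin d → ℝ) => φ z.1 * outcomeReg P z.1 z.2 * kW z.2)
      ((exposureLaw P).prod (covariateLaw P)) :=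
    hζ.integrable.mul_bdd (Measurable.aestronglyMeasurable (by fun_prop))
      (Eventually.of_forall fun z => hkWK z.2)
  have eA : ∫ o, φ o.2.1 * gCompReg P o.2.1 * k o ∂(P : Measure (Obs d))
      = ∫ z, φ z.1 * outcomeReg P z.1 z.2 * kA z.1 ∂((exposureLaw P).prod (covariateLaw P)) := by
    rw [hA (fun a => φ a * gCompReg P a) (by fun_prop) h3.integrable, integral_prod _ hiA]
    simp_rw [integral_mul_const, integral_const_mul]
    rfl
  have eW : ∫ o, (∫ u, φ u * outcomeReg P u o.2.2 ∂(exposureLaw P)) * k o ∂(P : Measure (Obs d))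
      = ∫ z, φ z.1 * outcomeReg P z.1 z.2 * kW z.2 ∂((exposureLaw P).prod (covariateLaw P)) := by
    rw [hW (fun w => ∫ u, φ u * outcomeReg P u w ∂(exposureLaw P))
      (hζm.stronglyMeasurable.integral_prod_left').measurable h4.integrable,
      integral_prod_symm _ hiW]
    simp_rw [integral_mul_const]
    rfl
  have eJ : ∫ o, (φ o.2.1 * invPropensity P η o.2) * outcomeReg P o.2.1 o.2.2 * k o
        ∂(P : Measure (Obs d))
      = ∫ z, (φ z.1 * invPropensity P η z) * outcomeReg P z.1 z.2 * kJ z ∂(jointLaw P) :=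
    hJ (fun z => (φ z.1 * invPropensity P η z) * outcomeReg P z.1 z.2) (by fun_prop) h2.integrable
  have hjint : ∀ r : ℝ × (Fin d → ℝ) → ℝ, Measurable r → (∀ z, |r z| ≤ K) →
      Integrable (fun z => (φ z.1 * invPropensity P η z) * outcomeReg P z.1 z.2 * r z)
        (jointLaw P) := fun r hr hrK =>
    (L2Bound.map measurable_snd (f := fun z : ℝ × (Fin d → ℝ) =>
      (φ z.1 * invPropensity P η z) * outcomeReg P z.1 z.2) (by fun_prop) h2).integrable.mul_bdd
      hr.aestronglyMeasurable (Eventually.of_forall hrK)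
  have hsplit : ∫ z, (φ z.1 * invPropensity P η z * (kA z.1 + kW z.2 - kJ z))
        * outcomeReg P z.1 z.2 ∂(jointLaw P)
      = ∫ z, φ z.1 * outcomeReg P z.1 z.2 * kA z.1 ∂((exposureLaw P).prod (covariateLaw P))
        + ∫ z, φ z.1 * outcomeReg P z.1 z.2 * kW z.2 ∂((exposureLaw P).prod (covariateLaw P))
        - ∫ z, (φ z.1 * invPropensity P η z) * outcomeReg P z.1 z.2 * kJ z ∂(jointLaw P) := by
    rw [integral_prod_eq_integral_jointLaw hη hP, integral_prod_eq_integral_jointLaw hη hP,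
      ← integral_add, ← integral_sub]
    · exact integral_congr_ae (Eventually.of_forall fun z => by ring)
    · refine ((hjint (fun z => kA z.1) (by fun_prop) fun z => hkAK z.1).add
        (hjint (fun z => kW z.2) (by fun_prop) fun z => hkWK z.2)).congr
        (Eventually.of_forall fun z => ?_)
      simp only [Pi.add_apply]; ring
    · exact hjint kJ hkJ hkJK
    · exact (hjint (fun z => kA z.1) (by fun_prop) fun z => hkAK z.1).congr
        (Eventually.of_forall fun z => by ring)
    · exact (hjint (fun z => kW z.2) (by fun_prop) fun z => hkWK z.2).congr
        (Eventually.of_forall fun z => by ring)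
  have i13 : Integrable (fun o : Obs d => (φ o.2.1 * invPropensity P η o.2) * o.1 * k o
      + φ o.2.1 * gCompReg P o.2.1 * k o) (P : Measure (Obs d)) := (hkb h1).add (hkb h3)
  have i134 : Integrable (fun o : Obs d => (φ o.2.1 * invPropensity P η o.2) * o.1 * k o
      + φ o.2.1 * gCompReg P o.2.1 * k o
      + (∫ u, φ u * outcomeReg P u o.2.2 ∂(exposureLaw P)) * k o) (P : Measure (Obs d)) :=
    i13.add (hkb h4)
  rw [hsplit, ← eA, ← eW, ← eJ, ← add_sub_assoc, ← add_assoc, ← integral_add (hkb h1) (hkb h3),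
    ← integral_add i13 (hkb h4), ← integral_sub i134 (hkb h2)]
  exact integral_congr_ae (Eventually.of_forall fun o => by simp only [weightedRegGradient]; ring)

/-- The bookkeeping of error terms in `abs_weightedReg_sub_le`. -/
lemma abs_sub_le_of_expansions {Zν Z01 Z00 Zb U U0 V W X Y D G ψ R1 R2 R3 ε τ M K B c s : ℝ}
    (hτ : 0 ≤ τ) (hM : 0 ≤ M) (hK : 0 ≤ K) (hB : 0 ≤ B) (hcs : c ≤ s)
    (t1 : |Zb + R2 - ψ - ε * D| ≤ τ * |ε| * (B * c))
    (t5 : |X + R3 - G| ≤ M * |ε| * (B * (3 * K) * c))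
    (r1 : |R1| ≤ B * s * (2 * (τ * |ε|))) (r2 : |R2| ≤ B * s * (2 * (τ * |ε|)))
    (r3 : |R3| ≤ B * (3 * K) * s * (2 * (τ * |ε|)))
    (e1 : |Zν - Z01 - ε * U| ≤ τ * |ε| * s) (e2 : |Z01 - Z00 - ε * V| ≤ τ * |ε| * s)
    (e3 : |Zb - Z00 - ε * W| ≤ τ * |ε| * (B * s)) (e4 : |U - U0| ≤ M * |ε| * (K * s))
    (e5 : |X - Y| ≤ M * |ε| * (B * (3 * K) * s)) (hY : Y = U0 + V - W) :
    |Zν + R1 - ψ - ε * (D + G)| ≤ τ * |ε| * (s * (6 * B + 2))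
      + |ε| ^ 2 * (K * s * (M + 6 * B * M + 6 * B * τ)) := by
  have a0 := abs_nonneg ε
  have t1' : |Zb + R2 - ψ - ε * D| ≤ τ * |ε| * (B * s) := t1.trans (by gcongr)
  have t5' : |X + R3 - G| ≤ M * |ε| * (B * (3 * K) * s) := t5.trans (by gcongr)
  -- Here `U + V - W = Y + (U - U0)`, `Y` is close to `X`, and `X + R3` is close to `G`. All of
  -- these errors are `O(ε)`, and the whole is multiplied by `ε` afterwards.
  have hT : |U + V - W - G| ≤ |ε| * (K * s * (M + 6 * B * M + 6 * B * τ)) := by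
    rw [abs_le] at *
    constructor <;> linarith [t5'.1, t5'.2, r3.1, r3.2, e4.1, e4.2, e5.1, e5.2]
  have hT' : |ε * (U + V - W - G)| ≤ |ε| ^ 2 * (K * s * (M + 6 * B * M + 6 * B * τ)) := by
    rw [abs_mul, pow_two, mul_assoc]
    gcongr
  clear hT e4 e5 t1 t5 t5' r3
  rw [abs_le] at *
  constructor <;> linarith [t1'.1, t1'.2, r1.1, r1.2, r2.1, r2.2, e1.1, e1.2, e2.1, e2.2, e3.1,
    e3.2, hT'.1, hT'.2]

/-- Quantitative first-order expansion of `weightedReg φ`. -/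
lemma abs_weightedReg_sub_le (hη : 0 < η) (hC : 0 ≤ C) (hP : P ∈ boundedModel 𝒴 𝒜 𝒲 η C)
    (hP₀ : P₀ ∈ boundedModel 𝒴 𝒜 𝒲 η C) {φ : ℝ → ℝ} (hφ : Measurable φ) (hφ1 : ∀ a, |φ a| ≤ 1)
    {k : Obs d → ℝ} {K ε τ M : ℝ} (hK : 0 < K) (hk : Measurable k) (hkK : ∀ o, |k o| ≤ K)
    (hτ : 0 ≤ τ) (hM : 0 ≤ M)
    (hexp : ExpandsAt (P : Measure (Obs d)) (P₀ : Measure (Obs d)) k ε τ)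
    (hlip : ExpandsAt (P : Measure (Obs d)) (P₀ : Measure (Obs d)) 0 ε M)
    {EA : Set ℝ} {Em : Set (ℝ × (Fin d → ℝ))} (hEA : MeasurableSet EA) (hEm : MeasurableSet Em)
    (hdA : (exposureLaw P₀).restrict EA ≤ ENNReal.ofReal 2 • exposureLaw P)
    (hdm : (jointLaw P₀).restrict Em ≤ ENNReal.ofReal 2 • jointLaw P)
    (hEAc : exposureLaw P EAᶜ ≤ ENNReal.ofReal ((τ * ε) ^ 2))
    (hEmc : jointLaw P Emᶜ ≤ ENNReal.ofReal ((τ * ε) ^ 2)) :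
    |weightedReg φ P - weightedReg φ P₀
        - ε * ∫ o, weightedRegGradient φ P₀ η o * k o ∂(P₀ : Measure (Obs d))|
      ≤ τ * |ε| * (√(2 * C * (1 + η⁻¹)) * (6 * η⁻¹ + 2))
        + |ε| ^ 2 * (K * √(2 * C * (1 + η⁻¹)) * (M + 6 * η⁻¹ * M + 6 * η⁻¹ * τ)) := by
  set B := η⁻¹ with hB
  have hB0 : 0 ≤ B := by positivity
  set b := invPropensity P₀ η with hb
  have hbB : ∀ z, |b z| ≤ B := abs_invPropensity_le P₀ hη
  have hbm : Measurable b := measurable_invPropensity P₀ η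
  obtain ⟨kA, hkA, hkAK, hA⟩ := exists_bounded_condExp (P₀ : Measure (Obs d))
    (T := fun o : Obs d => o.2.1) (by fun_prop) hK hk hkK
  obtain ⟨kW, hkW, hkWK, hW⟩ := exists_bounded_condExp (P₀ : Measure (Obs d))
    (T := fun o : Obs d => o.2.2) (by fun_prop) hK hk hkK
  obtain ⟨kJ, hkJ, hkJK, hJ⟩ := exists_bounded_condExp (P₀ : Measure (Obs d))
    (T := (Prod.snd : Obs d → ℝ × (Fin d → ℝ))) measurable_snd hK hk hkK
  rw [integral_weightedRegGradient_mul hη hC hP₀ hφ hφ1 hk hkK hkA hkW hkJ hkAK hkWK hkJK hA hW hJ]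
  have expA : ExpandsAt (exposureLaw P) (exposureLaw P₀) kA ε τ := hexp.map (by fun_prop) hA
  have expW : ExpandsAt (covariateLaw P) (covariateLaw P₀) kW ε τ := hexp.map (by fun_prop) hW
  have expJ : ExpandsAt (jointLaw P) (jointLaw P₀) kJ ε τ := hexp.map measurable_snd hJ
  have lipW : ExpandsAt (covariateLaw P) (covariateLaw P₀) 0 ε M :=
    hlip.map (by fun_prop) (isRegression_zero _ _)
  have lipJ : ExpandsAt (jointLaw P) (jointLaw P₀) 0 ε M :=
    hlip.map measurable_snd (isRegression_zero _ _)
  -- On `E` the laws of `A` and of `(A, W)` under `P₀` are both at most twice those under `P`, so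
  -- the truncation `ζ` of `φ μ_P` is a legitimate test function for every law involved.
  set E : Set (ℝ × (Fin d → ℝ)) := {z | z.1 ∈ EA ∧ z ∈ Em} with hE
  have hEmeas : MeasurableSet E := (measurable_fst hEA).inter hEm
  set q : ℝ × (Fin d → ℝ) → ℝ := fun z => φ z.1 * outcomeReg P z.1 z.2 with hq
  have hqm : Measurable q := by fun_prop
  set ζ := E.indicator q with hζ
  have hζm : Measurable ζ := hqm.indicator hEmeas
  have hq1 : ∀ z, |q z| ≤ 1 * |outcomeReg P z.1 z.2| := fun z => by
    rw [hq, abs_mul]; gcongr; exact hφ1 _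
  have hζq : ∀ z, |ζ z| ≤ 1 * |outcomeReg P z.1 z.2| := fun z => by
    by_cases hz : z ∈ E
    · rw [hζ, indicator_of_mem hz]; exact hq1 z
    · rw [hζ, indicator_of_notMem hz, abs_zero]; positivity
  obtain ⟨hS0, bJ, bJ0, bN, b0N, bN0⟩ := l2Bound_truncated hη hC hP hP₀ hζm hζq hEA hEm
    (fun z hz => indicator_of_notMem (s := E) hz q) hdA hdm
  set S := 2 * C * (1 + B) with hS
  set s := √S with hs
  have hs0 : 0 ≤ s := Real.sqrt_nonneg _
  have hCS : C ≤ S := by rw [hS]; nlinarith [mul_nonneg hC hB0]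
  have hcs : √C ≤ s := Real.sqrt_le_sqrt hCS
  have hqJ : L2Bound q (jointLaw P) S := by
    have := (l2Bound_outcomeReg hC hP).of_abs_le hqm.aestronglyMeasurable
      (Eventually.of_forall hq1)
    exact this.mono (by linarith)
  have hqN : L2Bound q ((exposureLaw P).prod (covariateLaw P)) (B * S) :=
    hqJ.of_measure_le hB0 (prod_le_smul_jointLaw hη hP)
  have hεsq : √(2 * (τ * ε) ^ 2) ≤ 2 * (τ * |ε|) := by
    rw [Real.sqrt_le_left (by positivity), mul_pow, mul_pow, mul_pow, sq_abs]
    nlinarith [sq_nonneg (τ * ε)]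
  have hEc : jointLaw P Eᶜ ≤ ENNReal.ofReal (2 * (τ * ε) ^ 2) := by
    have hsub : Eᶜ ⊆ Prod.fst ⁻¹' EAᶜ ∪ Emᶜ := by
      intro z hz
      by_contra hcon
      simp only [mem_union, mem_preimage, mem_compl_iff, not_or, not_not] at hcon
      exact hz hcon
    calc jointLaw P Eᶜ ≤ jointLaw P (Prod.fst ⁻¹' EAᶜ) + jointLaw P Emᶜ :=
          (measure_mono hsub).trans (measure_union_le _ _)
      _ = exposureLaw P EAᶜ + jointLaw P Emᶜ := by
          rw [← map_fst_jointLaw, Measure.map_apply measurable_fst hEA.compl]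
      _ ≤ _ := add_le_add hEAc hEmc
      _ = _ := by rw [← ENNReal.ofReal_add (by positivity) (by positivity)]; congr 1; ring
  have hEcN : ((exposureLaw P).prod (covariateLaw P)) Eᶜ
      ≤ ENNReal.ofReal (B * (2 * (τ * ε) ^ 2)) := by
    refine (prod_le_smul_jointLaw hη hP Eᶜ).trans ?_
    rw [Measure.smul_apply, smul_eq_mul, ENNReal.ofReal_mul hB0]
    gcongr
  -- the weight `ρ`
  set ρ : ℝ × (Fin d → ℝ) → ℝ := fun z => kA z.1 + kW z.2 - kJ z with hρ
  have hρm : Measurable ρ := by fun_prop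
  have hρK : ∀ z, |ρ z| ≤ 3 * K := fun z => by
    have h1 := abs_le.1 (hkAK z.1)
    have h2 := abs_le.1 (hkWK z.2)
    have h3 := abs_le.1 (hkJK z)
    rw [abs_le]; constructor <;> simp only [hρ] <;> linarith [h1.1, h1.2, h2.1, h2.2, h3.1, h3.2]
  have hbρ : ∀ z, |b z * ρ z| ≤ B * (3 * K) := fun z => by
    rw [abs_mul]
    exact mul_le_mul (hbB z) (hρK z) (abs_nonneg _) hB0
  have hφb : ∀ z : ℝ × (Fin d → ℝ), |φ z.1 * b z| ≤ B := fun z => by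
    rw [abs_mul]
    calc |φ z.1| * |b z| ≤ 1 * B := mul_le_mul (hφ1 _) (hbB z) (abs_nonneg _) zero_le_one
      _ = B := one_mul _
  have hφbρ : ∀ z : ℝ × (Fin d → ℝ), |φ z.1 * b z * ρ z| ≤ B * (3 * K) := fun z => by
    rw [abs_mul]
    exact mul_le_mul (hφb z) (hρK z) (abs_nonneg _) hB0
  have sqrtmul : ∀ {x y : ℝ}, 0 ≤ x → √(x ^ 2 * y) = x * √y := fun {x y} hx => by
    rw [Real.sqrt_mul (by positivity), Real.sqrt_sq hx]
  -- integrals of the observed outcome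
  have tower : ∀ (R : ProbabilityMeasure (Obs d)), R ∈ boundedModel 𝒴 𝒜 𝒲 η C →
      ∀ (g : ℝ × (Fin d → ℝ) → ℝ) (c : ℝ), Measurable g → (∀ z, |g z| ≤ c) →
      ∫ o, g o.2 * o.1 ∂(R : Measure (Obs d)) = ∫ z, g z * outcomeReg R z.1 z.2 ∂(jointLaw R) :=
    fun R hR g c hg hgc => integral_outcome_eq hR hg hgc
  have ybd : ∀ (R : ProbabilityMeasure (Obs d)), R ∈ boundedModel 𝒴 𝒜 𝒲 η C →
      ∀ (g : ℝ × (Fin d → ℝ) → ℝ) (c : ℝ), Measurable g → (∀ z, |g z| ≤ c) →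
      L2Bound (fun o : Obs d => g o.2 * o.1) (R : Measure (Obs d)) (c ^ 2 * C) :=
    fun R hR g c hg hgc => (l2Bound_outcome hR).mul_left (g := fun o : Obs d => g o.2)
      (Measurable.aestronglyMeasurable (by fun_prop)) (Eventually.of_forall fun o => hgc o.2)
  -- Expanding with `Y` itself needs no truncation, because its second moment is bounded under both
  -- laws. The tower property is applied afterwards, under each law with its own regression.
  have t1 := hexp (fun o => (φ o.2.1 * b o.2) * o.1) (B ^ 2 * C) (by fun_prop) (by positivity)
    (ybd P hP (fun z => φ z.1 * b z) B (by fun_prop) hφb)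
    (ybd P₀ hP₀ (fun z => φ z.1 * b z) B (by fun_prop) hφb)
  have t5 := hlip (fun o => (φ o.2.1 * b o.2 * ρ o.2) * o.1) ((B * (3 * K)) ^ 2 * C) (by fun_prop)
    (by positivity)
    (ybd P hP (fun z => φ z.1 * b z * ρ z) _ (by fun_prop) hφbρ)
    (ybd P₀ hP₀ (fun z => φ z.1 * b z * ρ z) _ (by fun_prop) hφbρ)
  rw [tower P hP (fun z => φ z.1 * b z) B (by fun_prop) hφb,
    tower P₀ hP₀ (fun z => φ z.1 * b z) B (by fun_prop) hφb, sqrtmul hB0] at t1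
  rw [tower P hP (fun z => φ z.1 * b z * ρ z) _ (by fun_prop) hφbρ,
    tower P₀ hP₀ (fun z => φ z.1 * b z * ρ z) _ (by fun_prop) hφbρ, sqrtmul (by positivity)] at t5
  have hψ₀ : ∫ z, (φ z.1 * b z) * outcomeReg P₀ z.1 z.2 ∂(jointLaw P₀) = weightedReg φ P₀ := by
    rw [weightedReg, integral_prod_eq_integral_jointLaw hη hP₀]
    exact integral_congr_ae (Eventually.of_forall fun z => by simp only [← hb]; ring)
  rw [hψ₀] at t1
  -- the truncation
  have hbq : L2Bound (fun z => b z * q z) (jointLaw P) (B ^ 2 * S) :=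
    hqJ.mul_left hbm.aestronglyMeasurable (Eventually.of_forall hbB)
  have hbρq : L2Bound (fun z => (b z * ρ z) * q z) (jointLaw P) ((B * (3 * K)) ^ 2 * S) :=
    hqJ.mul_left (hbm.mul hρm).aestronglyMeasurable (Eventually.of_forall hbρ)
  have split : ∀ (κ : Measure (ℝ × (Fin d → ℝ))) (g : ℝ × (Fin d → ℝ) → ℝ),
      Integrable (fun z => g z * q z) κ →
      ∫ z, g z * q z ∂κ = ∫ z, g z * ζ z ∂κ + ∫ z in Eᶜ, g z * q z ∂κ := fun κ g hg => by
    rw [← integral_add_compl hEmeas hg, ← integral_indicator hEmeas]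
    congr 1
    refine integral_congr_ae (Eventually.of_forall fun z => ?_)
    by_cases hz : z ∈ E
    · simp only [hζ, indicator_of_mem hz]
    · simp only [hζ, indicator_of_notMem hz, mul_zero]
  have s1 : weightedReg φ P = ∫ z, ζ z ∂((exposureLaw P).prod (covariateLaw P))
      + ∫ z in Eᶜ, q z ∂((exposureLaw P).prod (covariateLaw P)) := by
    have := split ((exposureLaw P).prod (covariateLaw P)) (fun _ => 1)
      (by simpa using hqN.integrable)
    simp only [one_mul] at this
    exact this
  have s2 : ∫ z, (φ z.1 * b z) * outcomeReg P z.1 z.2 ∂(jointLaw P)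
      = ∫ z, b z * ζ z ∂(jointLaw P) + ∫ z in Eᶜ, b z * q z ∂(jointLaw P) := by
    rw [← split _ b hbq.integrable]
    exact integral_congr_ae (Eventually.of_forall fun z => by simp only [hq]; ring)
  have s3 : ∫ z, (φ z.1 * b z * ρ z) * outcomeReg P z.1 z.2 ∂(jointLaw P)
      = ∫ z, (b z * ρ z) * ζ z ∂(jointLaw P) + ∫ z in Eᶜ, (b z * ρ z) * q z ∂(jointLaw P) := by
    rw [← split _ (fun z => b z * ρ z) hbρq.integrable]
    exact integral_congr_ae (Eventually.of_forall fun z => by simp only [hq]; ring)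
  have r1 : |∫ z in Eᶜ, q z ∂((exposureLaw P).prod (covariateLaw P))|
      ≤ B * s * (2 * (τ * |ε|)) := by
    refine (hqN.abs_setIntegral_le hEmeas.compl hEcN).trans ?_
    rw [Real.sqrt_mul hB0, Real.sqrt_mul hB0]
    calc √B * √S * (√B * √(2 * (τ * ε) ^ 2)) = (√B * √B) * s * √(2 * (τ * ε) ^ 2) := by ring
      _ ≤ B * s * (2 * (τ * |ε|)) := by rw [Real.mul_self_sqrt hB0]; gcongr
  have r2 : |∫ z in Eᶜ, b z * q z ∂(jointLaw P)| ≤ B * s * (2 * (τ * |ε|)) := by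
    refine (hbq.abs_setIntegral_le hEmeas.compl hEc).trans ?_
    rw [sqrtmul hB0]
    gcongr
  have r3 : |∫ z in Eᶜ, (b z * ρ z) * q z ∂(jointLaw P)|
      ≤ B * (3 * K) * s * (2 * (τ * |ε|)) := by
    refine (hbρq.abs_setIntegral_le hEmeas.compl hEc).trans ?_
    rw [sqrtmul (by positivity)]
    gcongr
  -- the four expansions
  have e1 := expA.integral_prod_left hkA hkAK hS0 hζm bN b0N
  have e2 := expW.integral_prod_right hkW hkWK hS0 hζm b0N bN0
  have e3 := expJ (fun z => b z * ζ z) (B ^ 2 * S) (by fun_prop) (by positivity)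
    (bJ.mul_left hbm.aestronglyMeasurable (Eventually.of_forall hbB))
    (bJ0.mul_left hbm.aestronglyMeasurable (Eventually.of_forall hbB))
  have hkAm : Measurable fun z : ℝ × (Fin d → ℝ) => kA z.1 := by fun_prop
  have e4 := lipW.integral_prod_right (K := 0) measurable_zero (by simp)
    (show 0 ≤ K ^ 2 * S by positivity) (ζ := fun z => kA z.1 * ζ z) (by fun_prop)
    (b0N.mul_left hkAm.aestronglyMeasurable (Eventually.of_forall fun z => hkAK z.1))
    (bN0.mul_left hkAm.aestronglyMeasurable (Eventually.of_forall fun z => hkAK z.1))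
  have e5 := lipJ (fun z => (b z * ρ z) * ζ z) ((B * (3 * K)) ^ 2 * S) (by fun_prop)
    (by positivity)
    (bJ.mul_left (hbm.mul hρm).aestronglyMeasurable (Eventually.of_forall hbρ))
    (bJ0.mul_left (hbm.mul hρm).aestronglyMeasurable (Eventually.of_forall hbρ))
  rw [sqrtmul hB0] at e3
  rw [sqrtmul hK.le] at e4
  rw [sqrtmul (by positivity)] at e5
  simp only [Pi.zero_apply, mul_zero, integral_zero, sub_zero] at t5 e4 e5
  -- identities under `P₀`
  have i0 : ∫ z, b z * ζ z ∂(jointLaw P₀)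
      = ∫ z, ζ z ∂((exposureLaw P₀).prod (covariateLaw P₀)) :=
    (integral_prod_eq_integral_jointLaw hη hP₀ ζ).symm
  -- This identity explains the choice of `ρ`: the first-order terms of the three expansions, two on
  -- the product side and one on the joint side, collapse into a single integral over the joint law.
  have i1 : ∫ z, (b z * ρ z) * ζ z ∂(jointLaw P₀)
      = ∫ z, kA z.1 * ζ z ∂((exposureLaw P₀).prod (covariateLaw P₀))
        + ∫ z, ζ z * kW z.2 ∂((exposureLaw P₀).prod (covariateLaw P₀))
        - ∫ z, b z * ζ z * kJ z ∂(jointLaw P₀) := by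
    have hj : ∀ r : ℝ × (Fin d → ℝ) → ℝ, Measurable r → (∀ z, |r z| ≤ K) →
        Integrable (fun z => b z * ζ z * r z) (jointLaw P₀) := fun r hr hrK =>
      (bJ0.mul_left hbm.aestronglyMeasurable (Eventually.of_forall hbB)).integrable.mul_bdd
        hr.aestronglyMeasurable (Eventually.of_forall hrK)
    have j1 : Integrable (fun z => b z * (kA z.1 * ζ z)) (jointLaw P₀) :=
      (hj (fun z => kA z.1) hkAm fun z => hkAK z.1).congr
        (Eventually.of_forall fun z => by simp only []; ring)
    have j2 : Integrable (fun z => b z * (ζ z * kW z.2)) (jointLaw P₀) :=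
      (hj (fun z => kW z.2) (by fun_prop) fun z => hkWK z.2).congr
        (Eventually.of_forall fun z => by simp only []; ring)
    have j12 : Integrable (fun z => b z * (kA z.1 * ζ z) + b z * (ζ z * kW z.2)) (jointLaw P₀) :=
      j1.add j2
    rw [integral_prod_eq_integral_jointLaw hη hP₀, integral_prod_eq_integral_jointLaw hη hP₀,
      ← integral_add j1 j2, ← integral_sub j12 (hj kJ hkJ hkJK)]
    exact integral_congr_ae (Eventually.of_forall fun z => by simp only [hρ]; ring)
  have comm : ∀ κ : Measure (ℝ × (Fin d → ℝ)),
      ∫ z, ζ z * kA z.1 ∂κ = ∫ z, kA z.1 * ζ z ∂κ := fun κ =>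
    integral_congr_ae (Eventually.of_forall fun z => mul_comm _ _)
  rw [comm] at e1
  rw [i0] at e3
  rw [s2] at t1
  rw [s3] at t5
  rw [s1]
  exact abs_sub_le_of_expansions hτ hM hK.le hB0 hcs t1 t5 r1 r2 r3 e1 e2 e3 e4 e5 i1

end WeightedReg

/-! ### Differentiability of the primitive parameter along regular paths -/

section Derivative

lemma hasDerivAt_zero_of_eventually_le {f : ℝ → ℝ} {f' : ℝ}
    (h : ∀ c > 0, ∀ᶠ ε in 𝓝[≠] (0 : ℝ), |f ε - f 0 - ε * f'| ≤ c * |ε|) : HasDerivAt f f' 0 := by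
  rw [hasDerivAt_iff_isLittleO, Asymptotics.isLittleO_iff]
  intro c hc
  filter_upwards [eventually_nhdsWithin_iff.1 (h c hc)] with ε hε
  rcases eq_or_ne ε 0 with rfl | h0
  · simp
  · simpa using hε h0

lemma eventually_abs_mul_le (A : ℝ) {c : ℝ} (hc : 0 < c) :
    ∀ᶠ ε in 𝓝[≠] (0 : ℝ), |ε| * A ≤ c := by
  have h : Tendsto (fun ε : ℝ => |ε| * A) (𝓝 0) (𝓝 0) := by
    have : Continuous fun ε : ℝ => |ε| * A := by fun_prop
    simpa using this.tendsto 0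
  exact mem_nhdsWithin_of_mem_nhds (h.eventually (Iic_mem_nhds hc))

variable {Ω : Type*} [MeasurableSpace Ω]

/-- Passes from the bounded approximation `k` back to the true score, by Cauchy–Schwarz. -/
lemma abs_integral_mul_score_sub_le {μ : Measure Ω} [IsProbabilityMeasure μ] {h k D : Ω → ℝ}
    {K S τ : ℝ} (hh : MemLp h 2 μ) (hk : Measurable k) (hkK : ∀ o, |k o| ≤ K)
    (hhk : L2Bound (fun o => h o - k o) μ (τ ^ 2)) (hτ : 0 ≤ τ) (hD : L2Bound D μ S) :
    |∫ o, D o * k o ∂μ - ∫ o, D o * h o ∂μ| ≤ √S * τ := by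
  have hi : Integrable (fun o => D o * k o) μ :=
    hD.integrable.mul_bdd hk.aestronglyMeasurable (Eventually.of_forall hkK)
  have hi2 : Integrable (fun o => D o * h o) μ := hD.memLp.integrable_mul hh
  rw [abs_sub_comm, ← integral_sub hi2 hi]
  have := hD.abs_integral_mul_le hhk
  rw [Real.sqrt_sq hτ] at this
  simpa only [mul_sub] using this

lemma IsDQM.hasDerivAt_integral {P₀ : ProbabilityMeasure Ω} {P : ℝ → ProbabilityMeasure Ω}
    {h : Lp ℝ 2 (P₀ : Measure Ω)} (H : IsDQM P₀ P h) {f : Ω → ℝ} (hf : Measurable f) {B : ℝ}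
    (hfB : ∀ o, |f o| ≤ B) :
    HasDerivAt (fun ε => ∫ o, f o ∂(P ε : Measure Ω)) (∫ o, f o * h o ∂(P₀ : Measure Ω)) 0 := by
  refine hasDerivAt_zero_of_eventually_le fun c hc => ?_
  have hb : ∀ R : ProbabilityMeasure Ω, L2Bound f (R : Measure Ω) (B ^ 2) := fun R =>
    L2Bound.of_bounded hf.aestronglyMeasurable (Eventually.of_forall hfB)
  set s := √(B ^ 2) with hs
  have hs0 : 0 ≤ s := Real.sqrt_nonneg _
  set τ := c / (2 * (s + 1)) with hτ
  have hτ0 : 0 < τ := by positivity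
  have hτs : τ * s ≤ c / 2 := by
    rw [hτ, div_mul_eq_mul_div, div_le_div_iff₀ (by positivity) (by norm_num)]
    nlinarith
  obtain ⟨k, K, hK, hk, hkK, hhk, hev⟩ := H.exists_expansion hτ0
  filter_upwards [hev] with ε hε
  have e1 := hε f (B ^ 2) hf (sq_nonneg _) (hb _) (hb _)
  have e2 := abs_integral_mul_score_sub_le (Lp.memLp h) hk hkK hhk hτ0.le (hb P₀)
  have e3 : |ε * (∫ o, f o * k o ∂(P₀ : Measure Ω) - ∫ o, f o * h o ∂(P₀ : Measure Ω))|
      ≤ |ε| * (c / 2) := by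
    rw [abs_mul]; gcongr; exact e2.trans (by rw [mul_comm]; exact hτs)
  have e1' : τ * |ε| * s ≤ |ε| * (c / 2) := by
    rw [mul_comm τ, mul_assoc]; gcongr
  rw [H.1]
  replace e1 := e1.trans e1'
  rw [abs_le] at *
  constructor <;> linarith [e1.1, e1.2, e3.1, e3.2]

variable {d : ℕ} {𝒴 𝒜 : Set ℝ} {𝒲 : Set (Fin d → ℝ)} {P₀ : ProbabilityMeasure (Obs d)} {η C : ℝ}

/-- The quantitative expansion leaves errors `O(τ |ε|)`, with a constant independent of `τ`, and
`O(ε²)`, with a constant depending on `τ` through `K` and `M`. So `τ` is fixed first in terms of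
`c`, and `ε` is made small afterwards. -/
theorem hasDerivAt_weightedReg (hη : 0 < η) (hC : 0 ≤ C) {P : ℝ → ProbabilityMeasure (Obs d)}
    {δ : ℝ} (hδ : 0 < δ) (hP : ∀ ε : ℝ, |ε| ≤ δ → P ε ∈ boundedModel 𝒴 𝒜 𝒲 η C)
    {h : Lp ℝ 2 (P₀ : Measure (Obs d))} (H : IsDQM P₀ P h) {φ : ℝ → ℝ} (hφ : Measurable φ)
    (hφ1 : ∀ a, |φ a| ≤ 1) :
    HasDerivAt (fun ε => weightedReg φ (P ε))
      (∫ o, weightedRegGradient φ P₀ η o * h o ∂(P₀ : Measure (Obs d))) 0 := by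
  have hP₀ : P₀ ∈ boundedModel 𝒴 𝒜 𝒲 η C := by
    have := hP 0 (by simpa using hδ.le)
    rwa [H.1] at this
  refine hasDerivAt_zero_of_eventually_le fun c hc => ?_
  obtain ⟨S, hS, hD⟩ := l2Bound_weightedRegGradient hη hC hP₀ hφ hφ1
  set A := √(2 * C * (1 + η⁻¹)) * (6 * η⁻¹ + 2) with hA
  have hA0 : 0 ≤ A := by positivity
  set τ := c / (2 * (A + √S + 1)) with hτ
  have hs0 : 0 ≤ √S := Real.sqrt_nonneg _
  have hτ0 : 0 < τ := by positivity
  have hτs : τ * (A + √S) ≤ c / 2 := by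
    rw [hτ, div_mul_eq_mul_div, div_le_div_iff₀ (by positivity) (by norm_num)]
    nlinarith
  obtain ⟨k, K, hK, hk, hkK, hhk, hexp⟩ := H.exists_expansion hτ0
  obtain ⟨M, hM, hlip⟩ := H.exists_lipschitz
  have hA := H.eventually_exists_dominated (T := fun o : Obs d => o.2.1) (by fun_prop) hτ0
  have hJ := H.eventually_exists_dominated (T := (Prod.snd : Obs d → ℝ × (Fin d → ℝ)))
    measurable_snd hτ0
  have hδ' := eventually_abs_mul_le 1 hδ
  have hsm := eventually_abs_mul_le
    (K * √(2 * C * (1 + η⁻¹)) * (M + 6 * η⁻¹ * M + 6 * η⁻¹ * τ)) (half_pos hc)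
  filter_upwards [hexp, hlip, hA, hJ, hδ', hsm] with ε h1 h2 ⟨EA, hEA, hdA, _, hEAc⟩
    ⟨Em, hEm, hdm, _, hEmc⟩ h5 h6
  have hlip' : ExpandsAt (P ε : Measure (Obs d)) (P₀ : Measure (Obs d)) 0 ε M := by
    intro f S hf hS b1 b2
    simpa using h2 f S hf hS b1 b2
  have key := abs_weightedReg_sub_le hη hC (hP ε (by simpa using h5)) hP₀ hφ hφ1 hK hk hkK hτ0.le
    hM.le h1 hlip' hEA hEm hdA hdm hEAc hEmc
  have e2 := abs_integral_mul_score_sub_le (Lp.memLp h) hk hkK hhk hτ0.le hD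
  have e3 : |ε * (∫ o, weightedRegGradient φ P₀ η o * k o ∂(P₀ : Measure (Obs d))
      - ∫ o, weightedRegGradient φ P₀ η o * h o ∂(P₀ : Measure (Obs d)))| ≤ |ε| * (√S * τ) := by
    rw [abs_mul]; gcongr
  have e4 : τ * |ε| * A + |ε| ^ 2 *
      (K * √(2 * C * (1 + η⁻¹)) * (M + 6 * η⁻¹ * M + 6 * η⁻¹ * τ)) + |ε| * (√S * τ)
      ≤ c * |ε| := by
    have a1 := mul_le_mul_of_nonneg_left h6 (abs_nonneg ε)
    have a2 := mul_le_mul_of_nonneg_left hτs (abs_nonneg ε)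
    rw [pow_two]
    linarith
  rw [H.1]
  rw [abs_le] at *
  constructor <;> linarith [key.1, key.2, e3.1, e3.2]

end Derivative

/-! ### The influence function of the primitive parameter -/

section Influence

variable {d : ℕ} {𝒴 𝒜 : Set ℝ} {𝒲 : Set (Fin d → ℝ)} {P₀ : ProbabilityMeasure (Obs d)} {η C : ℝ}

lemma abs_indicator_Iic_le (a₀ a : ℝ) : |(Iic a₀).indicator (1 : ℝ → ℝ) a| ≤ 1 := by
  by_cases h : a ∈ Iic a₀
  · simp only [indicator_of_mem h, Pi.one_apply, abs_one, le_refl]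
  · simp only [indicator_of_notMem h, abs_zero, zero_le_one]

@[fun_prop]
lemma measurable_indicator_Iic (a₀ : ℝ) : Measurable ((Iic a₀).indicator (1 : ℝ → ℝ)) :=
  measurable_one.indicator measurableSet_Iic

lemma exposureCDF_eq_integral (P : ProbabilityMeasure (Obs d)) (a₀ : ℝ) :
    exposureCDF P a₀ = ∫ o, (Iic a₀).indicator 1 o.2.1 ∂(P : Measure (Obs d)) := by
  rw [← integral_exposureLaw (measurable_indicator_Iic a₀), integral_indicator_one measurableSet_Iic]
  rfl

/-- The influence function in terms of the gradients of the weighted regression means. -/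
lemma eif_ae_eq (hη : 0 < η) (hC : 0 ≤ C) (hP₀ : P₀ ∈ boundedModel 𝒴 𝒜 𝒲 η C) (a₀ : ℝ) :
    eif a₀ P₀ =ᵐ[(P₀ : Measure (Obs d))] fun o =>
      weightedRegGradient ((Iic a₀).indicator 1) P₀ η o
        - exposureCDF P₀ a₀ * weightedRegGradient (fun _ => 1) P₀ η o
        - meanReg P₀ * ((Iic a₀).indicator 1 o.2.1 - exposureCDF P₀ a₀)
        - 2 * primitiveParam a₀ P₀ := by
  have h1 : ∀ᵐ o ∂(P₀ : Measure (Obs d)), η ≤ propensity P₀ o.2.1 o.2.2 :=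
    ae_of_ae_map (f := Prod.snd) measurable_snd.aemeasurable
      ((jointLaw_absolutelyContinuous hP₀).ae_le hP₀.2.2.1)
  have h2 : ∀ᵐ o ∂(P₀ : Measure (Obs d)),
      Integrable (fun u => outcomeReg P₀ u o.2.2) (exposureLaw P₀) := by
    have := (l2Bound_outcomeReg_prod hη hC hP₀).integrable.prod_left_ae
    exact ae_of_ae_map (f := fun o : Obs d => o.2.2) (by fun_prop) this
  filter_upwards [h1, h2] with o ho hi
  have hi' : Integrable (fun u => (Iic a₀).indicator 1 u * outcomeReg P₀ u o.2.2)
      (exposureLaw P₀) :=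
    hi.bdd_mul (measurable_indicator_Iic a₀).aestronglyMeasurable
      (Eventually.of_forall fun u => abs_indicator_Iic_le a₀ u)
  have e : ∫ u, ((Iic a₀).indicator 1 u - exposureCDF P₀ a₀) * outcomeReg P₀ u o.2.2
        ∂(exposureLaw P₀)
      = ∫ u, (Iic a₀).indicator 1 u * outcomeReg P₀ u o.2.2 ∂(exposureLaw P₀)
        - exposureCDF P₀ a₀ * ∫ u, 1 * outcomeReg P₀ u o.2.2 ∂(exposureLaw P₀) := by
    simp only [one_mul]
    rw [← integral_const_mul, ← integral_sub hi' (hi.const_mul _)]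
    simp only [sub_mul]
  simp only [eif, weightedRegGradient, invPropensity, max_eq_right ho, e]
  ring

/-- Take `k = 1`, whose regressions are all `1`: the weight `kA + kW - kJ` is then `1`, and each of
the two remaining integrals equals `weightedReg φ P₀`. -/
lemma integral_weightedRegGradient (hη : 0 < η) (hC : 0 ≤ C)
    (hP₀ : P₀ ∈ boundedModel 𝒴 𝒜 𝒲 η C) {φ : ℝ → ℝ} (hφ : Measurable φ) (hφ1 : ∀ a, |φ a| ≤ 1) :
    ∫ o, weightedRegGradient φ P₀ η o ∂(P₀ : Measure (Obs d)) = 2 * weightedReg φ P₀ := by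
  have hreg : ∀ {α : Type} [MeasurableSpace α] (T : Obs d → α), Measurable T →
      IsRegression (P₀ : Measure (Obs d)) T (fun _ => 1) (fun _ => 1) := by
    intro α _ T hT f hf _
    simp only [mul_one]
    rw [integral_map hT.aemeasurable hf.aestronglyMeasurable]
  have h := integral_weightedRegGradient_mul hη hC hP₀ hφ hφ1 (k := fun _ => 1) (K := 1)
    measurable_const (by simp) measurable_const measurable_const measurable_const
    (by simp) (by simp) (by simp) (hreg _ (by fun_prop)) (hreg _ (by fun_prop))
    (hreg _ measurable_snd)
  have hb : ∀ z : ℝ × (Fin d → ℝ), |φ z.1 * invPropensity P₀ η z| ≤ η⁻¹ := fun z => by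
    rw [abs_mul]
    calc |φ z.1| * |invPropensity P₀ η z| ≤ 1 * η⁻¹ :=
          mul_le_mul (hφ1 _) (abs_invPropensity_le P₀ hη z) (abs_nonneg _) zero_le_one
      _ = η⁻¹ := one_mul _
  have hψ : ∫ z, (φ z.1 * invPropensity P₀ η z) * outcomeReg P₀ z.1 z.2 ∂(jointLaw P₀)
      = weightedReg φ P₀ := by
    rw [weightedReg, integral_prod_eq_integral_jointLaw hη hP₀]
    exact integral_congr_ae (Eventually.of_forall fun z => by ring)
  have hy := integral_outcome_eq hP₀ (f := fun z => φ z.1 * invPropensity P₀ η z) (by fun_prop) hb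
  simp only [mul_one, add_sub_cancel_right] at h
  rw [h, hy, hψ]
  ring

lemma meanReg_eq_weightedReg (hη : 0 < η) (hC : 0 ≤ C) (hP₀ : P₀ ∈ boundedModel 𝒴 𝒜 𝒲 η C) :
    meanReg P₀ = weightedReg (fun _ => 1) P₀ := by
  rw [weightedReg_eq_integral_gCompReg hη hC hP₀ measurable_const (c := 1) (by simp)]
  simp [meanReg]

lemma memLp_eif (hη : 0 < η) (hC : 0 ≤ C) (hP₀ : P₀ ∈ boundedModel 𝒴 𝒜 𝒲 η C) (a₀ : ℝ) :
    MemLp (eif a₀ P₀) 2 (P₀ : Measure (Obs d)) := by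
  obtain ⟨S1, -, h1⟩ := l2Bound_weightedRegGradient hη hC hP₀ (measurable_indicator_Iic a₀)
    (abs_indicator_Iic_le a₀)
  obtain ⟨S2, -, h2⟩ := l2Bound_weightedRegGradient hη hC hP₀ (φ := fun _ => 1) measurable_const
    (by simp)
  have h3 : MemLp (fun o : Obs d => (Iic a₀).indicator (1 : ℝ → ℝ) o.2.1) 2
      (P₀ : Measure (Obs d)) :=
    (L2Bound.of_bounded (c := 1)
      ((measurable_indicator_Iic a₀).comp (by fun_prop)).aestronglyMeasurable
      (Eventually.of_forall fun o => abs_indicator_Iic_le a₀ _)).memLp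
  refine MemLp.ae_eq (eif_ae_eq hη hC hP₀ a₀).symm ?_
  exact (((h1.memLp.sub (h2.memLp.const_mul _)).sub ((h3.sub (memLp_const _)).const_mul _)).sub
    (memLp_const _))

lemma integral_eif (hη : 0 < η) (hC : 0 ≤ C) (hP₀ : P₀ ∈ boundedModel 𝒴 𝒜 𝒲 η C) (a₀ : ℝ) :
    ∫ o, eif a₀ P₀ o ∂(P₀ : Measure (Obs d)) = 0 := by
  obtain ⟨S1, -, h1⟩ := l2Bound_weightedRegGradient hη hC hP₀ (measurable_indicator_Iic a₀)
    (abs_indicator_Iic_le a₀)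
  obtain ⟨S2, -, h2⟩ := l2Bound_weightedRegGradient hη hC hP₀ (φ := fun _ => 1) measurable_const
    (by simp)
  have h3 : Integrable (fun o : Obs d => (Iic a₀).indicator (1 : ℝ → ℝ) o.2.1)
      (P₀ : Measure (Obs d)) :=
    (L2Bound.of_bounded (c := 1)
      ((measurable_indicator_Iic a₀).comp (by fun_prop)).aestronglyMeasurable
      (Eventually.of_forall fun o => abs_indicator_Iic_le a₀ _)).integrable
  have i12 : Integrable (fun o => weightedRegGradient ((Iic a₀).indicator 1) P₀ η o
      - exposureCDF P₀ a₀ * weightedRegGradient (fun _ => 1) P₀ η o) (P₀ : Measure (Obs d)) :=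
    h1.integrable.sub (h2.integrable.const_mul _)
  have i3 : Integrable (fun o : Obs d => meanReg P₀ * ((Iic a₀).indicator (1 : ℝ → ℝ) o.2.1
      - exposureCDF P₀ a₀)) (P₀ : Measure (Obs d)) :=
    (h3.sub (integrable_const _)).const_mul _
  have i123 : Integrable (fun o => weightedRegGradient ((Iic a₀).indicator 1) P₀ η o
      - exposureCDF P₀ a₀ * weightedRegGradient (fun _ => 1) P₀ η o
      - meanReg P₀ * ((Iic a₀).indicator (1 : ℝ → ℝ) o.2.1 - exposureCDF P₀ a₀))
      (P₀ : Measure (Obs d)) := i12.sub i3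
  rw [integral_congr_ae (eif_ae_eq hη hC hP₀ a₀), integral_sub i123 (integrable_const _),
    integral_sub i12 i3, integral_sub h1.integrable (h2.integrable.const_mul _),
    integral_const_mul, integral_const_mul, integral_sub h3 (integrable_const _),
    ← exposureCDF_eq_integral, integral_weightedRegGradient hη hC hP₀ (measurable_indicator_Iic a₀)
    (abs_indicator_Iic_le a₀), integral_weightedRegGradient hη hC hP₀ measurable_const (by simp),
    primitiveParam_eq hη hC hP₀ a₀]
  simp
  ring

/-- Product rule for the decomposition `primitiveParam_eq`. The constants in the influence function
do not contribute, as scores have mean zero. -/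
theorem hasDerivAt_primitiveParam {P : ℝ → ProbabilityMeasure (Obs d)}
    (hP : P ∈ regularPaths 𝒴 𝒜 𝒲) {h : Lp ℝ 2 (P₀ : Measure (Obs d))} (H : IsDQM P₀ P h) (a₀ : ℝ) :
    HasDerivAt (fun ε => primitiveParam a₀ (P ε))
      (∫ o, eif a₀ P₀ o * h o ∂(P₀ : Measure (Obs d))) 0 := by
  obtain ⟨δ, hδ, η, hη, C', hP'⟩ := hP
  -- The constant `C'` may be negative, in which case its `ENNReal.ofReal` is zero.
  set C := max C' 0
  have hC : 0 ≤ C := le_max_right _ _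
  have hP : ∀ ε : ℝ, |ε| ≤ δ → P ε ∈ boundedModel 𝒴 𝒜 𝒲 η C := fun ε hε =>
    boundedModel_mono le_rfl (le_max_left _ _) (hP' ε hε)
  have hP₀ : P₀ ∈ boundedModel 𝒴 𝒜 𝒲 η C := by
    have := hP 0 (by simpa using hδ.le)
    rwa [H.1] at this
  have d1 := hasDerivAt_weightedReg hη hC hδ hP H (measurable_indicator_Iic a₀)
    (abs_indicator_Iic_le a₀)
  have d2 := hasDerivAt_weightedReg hη hC hδ hP H (φ := fun _ => 1) measurable_const (by simp)
  have d3 := H.hasDerivAt_integral (f := fun o : Obs d => (Iic a₀).indicator (1 : ℝ → ℝ) o.2.1)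
    (by fun_prop) (fun o => abs_indicator_Iic_le a₀ o.2.1)
  have d4 := d1.sub (d2.mul d3)
  have hev : (fun ε => primitiveParam a₀ (P ε)) =ᶠ[𝓝 0]
      fun ε => weightedReg ((Iic a₀).indicator 1) (P ε) - weightedReg (fun _ => 1) (P ε)
        * ∫ o, (Iic a₀).indicator (1 : ℝ → ℝ) o.2.1 ∂(P ε : Measure (Obs d)) := by
    filter_upwards [Metric.closedBall_mem_nhds (0 : ℝ) hδ] with ε hε
    rw [primitiveParam_eq hη hC (hP ε (by simpa using hε)), exposureCDF_eq_integral]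
  refine (d4.congr_of_eventuallyEq hev).congr_deriv ?_
  obtain ⟨S1, -, h1⟩ := l2Bound_weightedRegGradient hη hC hP₀ (measurable_indicator_Iic a₀)
    (abs_indicator_Iic_le a₀)
  obtain ⟨S2, -, h2⟩ := l2Bound_weightedRegGradient hη hC hP₀ (φ := fun _ => 1) measurable_const
    (by simp)
  have hh := Lp.memLp h
  have hhi : Integrable h (P₀ : Measure (Obs d)) := hh.integrable (by norm_num)
  have i1 : Integrable (fun o => weightedRegGradient ((Iic a₀).indicator 1) P₀ η o * h o)
    (P₀ : Measure (Obs d)) := h1.memLp.integrable_mul hh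
  have i2 : Integrable (fun o => weightedRegGradient (fun _ => 1) P₀ η o * h o)
    (P₀ : Measure (Obs d)) := h2.memLp.integrable_mul hh
  have i3 : Integrable (fun o => (Iic a₀).indicator (1 : ℝ → ℝ) o.2.1 * h o)
    (P₀ : Measure (Obs d)) :=
    hhi.bdd_mul (c := 1) (Measurable.aestronglyMeasurable (by fun_prop))
      (Eventually.of_forall fun o => abs_indicator_Iic_le a₀ o.2.1)
  have e : ∫ o, eif a₀ P₀ o * h o ∂(P₀ : Measure (Obs d))
      = ∫ o, (weightedRegGradient ((Iic a₀).indicator 1) P₀ η o * h o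
        - exposureCDF P₀ a₀ * (weightedRegGradient (fun _ => 1) P₀ η o * h o)
        - meanReg P₀ * ((Iic a₀).indicator 1 o.2.1 * h o)
        + (meanReg P₀ * exposureCDF P₀ a₀ - 2 * primitiveParam a₀ P₀) * h o)
        ∂(P₀ : Measure (Obs d)) := by
    refine integral_congr_ae ?_
    filter_upwards [eif_ae_eq hη hC hP₀ a₀] with o ho
    rw [ho]
    ring
  have j2 := i2.const_mul (exposureCDF P₀ a₀)
  have j3 := i3.const_mul (meanReg P₀)
  have j4 := hhi.const_mul (meanReg P₀ * exposureCDF P₀ a₀ - 2 * primitiveParam a₀ P₀)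
  have k12 : Integrable (fun o => weightedRegGradient ((Iic a₀).indicator 1) P₀ η o * h o
      - exposureCDF P₀ a₀ * (weightedRegGradient (fun _ => 1) P₀ η o * h o))
      (P₀ : Measure (Obs d)) := i1.sub j2
  have k123 : Integrable (fun o => weightedRegGradient ((Iic a₀).indicator 1) P₀ η o * h o
      - exposureCDF P₀ a₀ * (weightedRegGradient (fun _ => 1) P₀ η o * h o)
      - meanReg P₀ * ((Iic a₀).indicator (1 : ℝ → ℝ) o.2.1 * h o))
      (P₀ : Measure (Obs d)) := k12.sub j3
  rw [e, integral_add k123 j4, integral_sub k12 j3, integral_sub i1 j2,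
    integral_const_mul, integral_const_mul, integral_const_mul, H.integral_score_eq_zero, H.1,
    ← exposureCDF_eq_integral, ← meanReg_eq_weightedReg hη hC hP₀]
  ring

end Influence

/-! ### A Lusin-type theorem for partial integrals -/

section Lusin

/-- A function integrable under a product measure has, off a set of small measure of the first
coordinate, partial integrals that are continuous, simultaneously for all measures dominated by a
multiple of the second factor. -/
lemma exists_isCompact_continuousOn_integral {β : Type*} [PseudoEMetricSpace β]
    [SecondCountableTopology β] [MeasurableSpace β] [BorelSpace β] (F : Measure ℝ)
    [IsProbabilityMeasure F] (Q : Measure β) [IsProbabilityMeasure Q] {u : ℝ × β → ℝ}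
    (hum : Measurable u) (hu : Integrable u (F.prod Q)) {τ : ℝ} (hτ : 0 < τ) :
    ∃ K : Set ℝ, IsCompact K ∧ F Kᶜ ≤ ENNReal.ofReal τ ∧
      ∀ (Q' : Measure β) [IsFiniteMeasure Q'] (c : ENNReal), c ≠ ⊤ → Q' ≤ c • Q →
        ContinuousOn (fun a => ∫ w, u (a, w) ∂Q') K := by
  -- Continuous approximations within `4⁻ⁿ` in `L¹` leave room for the weights `2ⁿ`: the weighted
  -- sum of the sectional errors still has integral at most `2`.
  have h4 : ∀ n : ℕ, ((4 : ENNReal)⁻¹) ^ n ≠ 0 := fun n => pow_ne_zero _ (by simp)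
  choose g hg _ using fun n : ℕ => hu.exists_boundedContinuous_lintegral_sub_le (h4 n)
  set H : ℕ → ℝ → ENNReal := fun n a => ∫⁻ w, ‖u (a, w) - g n (a, w)‖ₑ ∂Q with hH
  have hsub : ∀ n, Measurable fun z : ℝ × β => ‖u z - g n z‖ₑ := fun n =>
    (hum.sub (g n).continuous.measurable).enorm
  have hHm : ∀ n, Measurable (H n) := fun n => (hsub n).lintegral_prod_right'
  have hHint : ∀ n, ∫⁻ a, H n a ∂F ≤ (4 : ENNReal)⁻¹ ^ n := fun n => by
    rw [hH, ← lintegral_prod _ (hsub n).aemeasurable]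
    exact hg n
  set G : ℝ → ENNReal := fun a => ∑' n, 2 ^ n * H n a with hG
  have hGm : Measurable G := Measurable.tsum fun n => (hHm n).const_mul _
  have hGint : ∫⁻ a, G a ∂F ≤ 2 := by
    rw [hG, lintegral_tsum fun n => ((hHm n).const_mul _).aemeasurable]
    calc ∑' n, ∫⁻ a, 2 ^ n * H n a ∂F ≤ ∑' n : ℕ, ((2 : ENNReal)⁻¹) ^ n := by
          refine ENNReal.tsum_le_tsum fun n => ?_
          rw [lintegral_const_mul _ (hHm n)]
          calc 2 ^ n * ∫⁻ a, H n a ∂F ≤ 2 ^ n * (4 : ENNReal)⁻¹ ^ n := by gcongr; exact hHint n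
            _ = (2 : ENNReal)⁻¹ ^ n := by
              rw [← mul_pow]
              congr 1
              rw [show (4 : ENNReal) = 2 * 2 by norm_num, ENNReal.mul_inv (by simp) (by simp),
                ← mul_assoc, ENNReal.mul_inv_cancel (by simp) (by simp), one_mul]
      _ = 2 := by rw [ENNReal.tsum_geometric, ENNReal.one_sub_inv_two, inv_inv]
  -- By Markov, `{G ≥ L}` has measure at most `2 / L = τ / 2`; the other `τ / 2` is spent on inner
  -- regularity.
  set L : ENNReal := ENNReal.ofReal (4 / τ) with hL
  have hL0 : L ≠ 0 := by simpa [hL] using hτ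
  have hB : MeasurableSet {a | G a < L} := measurableSet_lt hGm measurable_const
  obtain ⟨K, hKB, hK, hKd⟩ := hB.exists_isCompact_sdiff_lt (μ := F) (measure_ne_top _ _)
    (ε := ENNReal.ofReal (τ / 2)) (by simpa using hτ)
  refine ⟨K, hK, ?_, ?_⟩
  · have h1 : F {a | G a < L}ᶜ ≤ ENNReal.ofReal (τ / 2) := by
      have hc : {a | G a < L}ᶜ = {a | L ≤ G a} := by ext a; simp
      rw [hc]
      refine (meas_ge_le_lintegral_div hGm.aemeasurable hL0 ENNReal.ofReal_ne_top).trans ?_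
      calc (∫⁻ a, G a ∂F) / L ≤ 2 / L := by gcongr
        _ = ENNReal.ofReal (τ / 2) := by
          rw [hL, show (2 : ENNReal) = ENNReal.ofReal 2 by simp,
            ← ENNReal.ofReal_div_of_pos (by positivity)]
          congr 1; field_simp; norm_num
    calc F Kᶜ ≤ F ({a | G a < L}ᶜ ∪ ({a | G a < L} \ K)) := by
          refine measure_mono fun a ha => ?_
          by_cases hb : G a < L
          · exact Or.inr ⟨hb, ha⟩
          · exact Or.inl hb
      _ ≤ ENNReal.ofReal (τ / 2) + ENNReal.ofReal (τ / 2) :=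
          (measure_union_le _ _).trans (add_le_add h1 hKd.le)
      _ = ENNReal.ofReal τ := by
          rw [← ENNReal.ofReal_add (by positivity) (by positivity)]; congr 1; ring
  · intro Q' _ c hc hQ'
    -- On `K` every sectional error is at most `L 2⁻ⁿ` under `Q`, hence at most `c` times that under
    -- any `Q' ≤ c Q`. The set `K` was chosen before `Q'`, so it serves all of them.
    have hbound : ∀ n, ∀ a ∈ K, ∫⁻ w, ‖u (a, w) - g n (a, w)‖ₑ ∂Q' ≤ c * (L * (2 : ENNReal)⁻¹ ^ n) := by
      intro n a ha
      have h1 : 2 ^ n * H n a ≤ L := (ENNReal.le_tsum n).trans (hKB ha).le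
      have h2 : H n a ≤ L * (2 : ENNReal)⁻¹ ^ n := by
        calc H n a = (2 : ENNReal)⁻¹ ^ n * (2 ^ n * H n a) := by
              rw [← mul_assoc, ← mul_pow, ENNReal.inv_mul_cancel (by simp) (by simp), one_pow,
                one_mul]
          _ ≤ (2 : ENNReal)⁻¹ ^ n * L := by gcongr
          _ = _ := mul_comm _ _
      calc _ ≤ ∫⁻ w, ‖u (a, w) - g n (a, w)‖ₑ ∂(c • Q) := lintegral_mono' hQ' le_rfl
        _ = c * H n a := by rw [lintegral_smul_measure, smul_eq_mul]
        _ ≤ _ := by gcongr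
    have hfin : ∀ n, c * (L * (2 : ENNReal)⁻¹ ^ n) ≠ ⊤ := fun n =>
      ENNReal.mul_ne_top hc (ENNReal.mul_ne_top ENNReal.ofReal_ne_top
        (ENNReal.pow_ne_top (by simp)))
    have hgi : ∀ n a, Integrable (fun w => g n (a, w)) Q' := fun n a =>
      (integrable_const ‖g n‖).mono'
        ((g n).continuous.comp (by fun_prop)).measurable.aestronglyMeasurable
        (Eventually.of_forall fun w => (g n).norm_coe_le_norm _)
    have hdi : ∀ n, ∀ a ∈ K, Integrable (fun w => u (a, w) - g n (a, w)) Q' := fun n a ha =>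
      ⟨((hum.comp measurable_prodMk_left).sub
        (((g n).continuous.comp (by fun_prop)).measurable)).aestronglyMeasurable,
        (hbound n a ha).trans_lt (hfin n).lt_top⟩
    have hlim : Tendsto (fun n : ℕ => (c * (L * (2 : ENNReal)⁻¹ ^ n)).toReal) atTop (𝓝 0) := by
      have : (fun n : ℕ => (c * (L * (2 : ENNReal)⁻¹ ^ n)).toReal)
          = fun n : ℕ => c.toReal * L.toReal * (1 / 2) ^ n := by
        ext n; simp [ENNReal.toReal_mul, mul_assoc]
      rw [this]
      simpa using (tendsto_pow_atTop_nhds_zero_of_lt_one (by norm_num : (0 : ℝ) ≤ 1 / 2)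
        (by norm_num)).const_mul (c.toReal * L.toReal)
    have hunif : TendstoUniformlyOn (fun n a => ∫ w, g n (a, w) ∂Q')
        (fun a => ∫ w, u (a, w) ∂Q') atTop K := by
      rw [Metric.tendstoUniformlyOn_iff]
      intro e he
      filter_upwards [hlim.eventually (gt_mem_nhds he)] with n hn a ha
      refine lt_of_le_of_lt ?_ hn
      have hui : Integrable (fun w => u (a, w)) Q' := by
        exact ((hdi n a ha).add (hgi n a)).congr (Eventually.of_forall fun w => by simp)
      rw [dist_eq_norm, ← integral_sub hui (hgi n a)]
      refine (norm_integral_le_lintegral_norm _).trans ?_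
      simp_rw [ofReal_norm]
      exact ENNReal.toReal_mono (hfin n) (hbound n a ha)
    refine hunif.continuousOn (Frequently.of_forall fun n => Continuous.continuousOn ?_)
    exact continuous_of_dominated (bound := fun _ => ‖g n‖)
      (fun a => (hgi n a).aestronglyMeasurable)
      (fun a => Eventually.of_forall fun w => (g n).norm_coe_le_norm _) (integrable_const _)
      (Eventually.of_forall fun w => (g n).continuous.comp (by fun_prop))

end Lusin

/-! ### Differentiability in quadratic mean of dominated paths -/

section Dominated

variable {Ω : Type*} [MeasurableSpace Ω]

/-- When `P` has density `p` with respect to `P₀`, the factor `√(dP₀/dR)` comes out of the bracket,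
with `R = P + P₀`, and its square changes the measure back to `P₀`. -/
lemma lintegral_sqrt_rnDeriv_withDensity (P P₀ : Measure Ω) [IsProbabilityMeasure P]
    [IsProbabilityMeasure P₀] {p h : Ω → ℝ} (hp : Measurable p) (hp0 : ∀ o, 0 ≤ p o)
    (hP : P = P₀.withDensity fun o => ENNReal.ofReal (p o)) (hh : Measurable h) (ε : ℝ) :
    ∫⁻ o, ENNReal.ofReal (((√(P.rnDeriv (P + P₀) o).toReal - √(P₀.rnDeriv (P + P₀) o).toReal) / ε
        - (1 / 2) * h o * √(P₀.rnDeriv (P + P₀) o).toReal) ^ 2) ∂(P + P₀)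
      = ∫⁻ o, ENNReal.ofReal (((√(p o) - 1) / ε - (1 / 2) * h o) ^ 2) ∂P₀ := by
  set R := P + P₀ with hR
  have hac : P₀ ≪ R := by
    rw [hR, add_comm]; exact Measure.AbsolutelyContinuous.rfl.add_right _
  have hPR : P = R.withDensity (fun o => P₀.rnDeriv R o * ENNReal.ofReal (p o)) := by
    conv_lhs => rw [hP, ← Measure.withDensity_rnDeriv_eq P₀ R hac]
    exact (withDensity_mul _ (Measure.measurable_rnDeriv _ _) hp.ennreal_ofReal).symm
  have hrn : P.rnDeriv R =ᵐ[R] fun o => P₀.rnDeriv R o * ENNReal.ofReal (p o) := by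
    conv_lhs => rw [hPR]
    exact Measure.rnDeriv_withDensity _ (by fun_prop)
  rw [← lintegral_rnDeriv_mul hac (by fun_prop)]
  refine lintegral_congr_ae ?_
  filter_upwards [hrn, Measure.rnDeriv_ne_top P₀ R] with o ho ho'
  rw [ho, ENNReal.toReal_mul, ENNReal.toReal_ofReal (hp0 o), Real.sqrt_mul ENNReal.toReal_nonneg]
  have e : (√(P₀.rnDeriv R o).toReal * √(p o) - √(P₀.rnDeriv R o).toReal) / ε
      - 1 / 2 * h o * √(P₀.rnDeriv R o).toReal
      = √(P₀.rnDeriv R o).toReal * ((√(p o) - 1) / ε - 1 / 2 * h o) := by ring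
  rw [e, mul_pow, Real.sq_sqrt ENNReal.toReal_nonneg, ENNReal.ofReal_mul ENNReal.toReal_nonneg,
    ENNReal.ofReal_toReal ho']

lemma ae_of_rnDeriv_ne_zero {P ρ : Measure Ω} [SigmaFinite P] [SigmaFinite ρ] (hac : P ≪ ρ)
    {q : Ω → Prop} (h : ∀ᵐ o ∂P, q o) : ∀ᵐ o ∂ρ, P.rnDeriv ρ o ≠ 0 → q o := by
  rw [← Measure.withDensity_rnDeriv_eq P ρ hac] at h
  exact (ae_withDensity_iff (Measure.measurable_rnDeriv _ _)).1 h

/-- With `u = (1 + ε x)/Z` and `r = √u`, one has `r - 1 = (u - 1)/2 - (r - 1)²/2`. Both `u - 1 - ε x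
= u (1 - Z)` and `(r - 1)² ≤ (u - 1)²` are of order `ε²`. -/
lemma sq_sqrt_density_sub_le {ε H x Z : ℝ} (hε : ε ≠ 0) (hε1 : |ε| ≤ 1) (hx : |x| ≤ H)
    (hεH : |ε| * H ≤ 1 / 2) (hZ1 : Z ≤ 1) (hZ : 1 - Z ≤ ε ^ 2 / 2) :
    ((√((1 + ε * x) / Z) - 1) / ε - 1 / 2 * x) ^ 2 ≤ ε ^ 2 * (H + 2) ^ 4 := by
  have hH : 0 ≤ H := (abs_nonneg x).trans hx
  have hε2 : ε ^ 2 ≤ 1 := by rw [← sq_abs]; nlinarith [abs_nonneg ε]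
  have hZ2 : 1 / 2 ≤ Z := by linarith
  have hZ0 : 0 < Z := by linarith
  have ht : |ε * x| ≤ |ε| * H := by rw [abs_mul]; gcongr
  have ht2 := abs_le.1 (ht.trans hεH)
  set t := ε * x with htdef
  set u := (1 + t) / Z with hu
  have huZ : u * Z = 1 + t := by rw [hu]; field_simp
  have hu0 : 0 ≤ u := div_nonneg (by linarith [ht2.1]) hZ0.le
  have hu3 : u ≤ 3 := by nlinarith [ht2.2]
  set r := √u with hr
  have hr0 : 0 ≤ r := Real.sqrt_nonneg _
  have hr2 : r ^ 2 = u := Real.sq_sqrt hu0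
  have hd0 : 0 ≤ u - 1 - t := by nlinarith
  have hd1 : u - 1 - t ≤ 3 / 2 * ε ^ 2 := by nlinarith
  have hu1 : |u - 1| ≤ |ε| * (H + 3 / 2) := by
    have h1 : ε ^ 2 ≤ |ε| := by rw [← sq_abs]; nlinarith [abs_nonneg ε]
    have h2 := abs_le.1 ht
    rw [abs_le]; constructor <;> nlinarith [h2.1, h2.2]
  have hr1 : (r - 1) ^ 2 ≤ (u - 1) ^ 2 := by
    have : u - 1 = (r - 1) * (r + 1) := by rw [← hr2]; ring
    rw [this, mul_pow]
    nlinarith [sq_nonneg (r - 1)]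
  have hu1' : (u - 1) ^ 2 ≤ ε ^ 2 * (H + 3 / 2) ^ 2 := by
    rw [← sq_abs (u - 1), ← sq_abs ε, ← mul_pow]
    exact pow_le_pow_left₀ (abs_nonneg _) hu1 2
  have hmain : |r - 1 - t / 2| ≤ ε ^ 2 * (H + 2) ^ 2 := by
    have e : r - 1 - t / 2 = (u - 1 - t) / 2 - (r - 1) ^ 2 / 2 := by rw [← hr2]; ring
    have hpos := mul_nonneg (sq_nonneg ε) hH
    have hpos2 := mul_nonneg (sq_nonneg ε) (sq_nonneg H)
    rw [e, abs_le]
    constructor <;> nlinarith [sq_nonneg (r - 1)]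
  have e : (r - 1) / ε - 1 / 2 * x = (r - 1 - t / 2) / ε := by rw [htdef]; field_simp
  rw [e, div_pow, div_le_iff₀ (by positivity), ← sq_abs]
  calc |r - 1 - t / 2| ^ 2 ≤ (ε ^ 2 * (H + 2) ^ 2) ^ 2 := pow_le_pow_left₀ (abs_nonneg _) hmain 2
    _ = _ := by ring

end Dominated

/-! ### Perturbations inside the model -/

section Perturbation

variable {d : ℕ} {𝒴 𝒜 : Set ℝ} {𝒲 : Set (Fin d → ℝ)} {P P₀ : ProbabilityMeasure (Obs d)} {η C : ℝ}

lemma exposureCondLaw_ae_absolutelyContinuous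
    (h : jointLaw P ≪ (exposureLaw P).prod (covariateLaw P)) :
    ∀ᵐ w ∂(covariateLaw P), exposureCondLaw P w ≪ exposureLaw P := by
  have h1 : covariateLaw P ⊗ₘ exposureCondLaw P
      ≪ covariateLaw P ⊗ₘ Kernel.const (Fin d → ℝ) (exposureLaw P) := by
    rw [covariateLaw_compProd_exposureCondLaw, Measure.compProd_const, ← Measure.prod_swap]
    exact h.map measurable_swap
  simpa using h1.kernel_of_compProd

/-- The joint law has density `g_P` with respect to the product, so the comparison of measures is
the pointwise bound `1 ≤ η⁻¹ g_P`. -/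
lemma ae_le_propensity (hη : 0 < η)
    (hac : ∀ᵐ w ∂(covariateLaw P), exposureCondLaw P w ≪ exposureLaw P)
    (hle : (exposureLaw P).prod (covariateLaw P) ≤ ENNReal.ofReal η⁻¹ • jointLaw P) :
    ∀ᵐ z ∂((exposureLaw P).prod (covariateLaw P)), η ≤ propensity P z.1 z.2 := by
  have hm : Measurable fun z : ℝ × (Fin d → ℝ) => ENNReal.ofReal (propensity P z.1 z.2) :=
    (measurable_propensity P).ennreal_ofReal
  have h1 : (fun _ => 1) ≤ᵐ[(exposureLaw P).prod (covariateLaw P)]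
      fun z => ENNReal.ofReal η⁻¹ * ENNReal.ofReal (propensity P z.1 z.2) := by
    refine ae_le_of_forall_setLIntegral_le_of_sigmaFinite measurable_const fun s hs _ => ?_
    have hj : ∫⁻ z in s, ENNReal.ofReal (propensity P z.1 z.2)
        ∂((exposureLaw P).prod (covariateLaw P)) = jointLaw P s := by
      rw [← withDensity_apply _ hs, ← jointLaw_eq_withDensity P hac]
    rw [lintegral_const_mul _ hm, hj]
    simpa using hle s
  filter_upwards [h1] with z hz
  rw [← ENNReal.ofReal_mul (by positivity)] at hz
  have : 1 ≤ η⁻¹ * propensity P z.1 z.2 := ENNReal.one_le_ofReal.1 hz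
  rwa [inv_mul_eq_div, one_le_div hη] at this

lemma jointLaw_mono {c : ENNReal} (h : (P : Measure (Obs d)) ≤ c • (P₀ : Measure (Obs d))) :
    jointLaw P ≤ c • jointLaw P₀ := by
  unfold jointLaw; rw [← Measure.map_smul]; exact Measure.map_mono h measurable_snd

lemma exposureLaw_mono {c : ENNReal} (h : (P : Measure (Obs d)) ≤ c • (P₀ : Measure (Obs d))) :
    exposureLaw P ≤ c • exposureLaw P₀ := by
  unfold exposureLaw; rw [← Measure.map_smul]; exact Measure.map_mono h (by fun_prop)

lemma covariateLaw_mono {c : ENNReal} (h : (P : Measure (Obs d)) ≤ c • (P₀ : Measure (Obs d))) :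
    covariateLaw P ≤ c • covariateLaw P₀ := by
  unfold covariateLaw; rw [← Measure.map_smul]; exact Measure.map_mono h (by fun_prop)

/-- Positivity is inherited by distributions comparable to `P₀` restricted to an exposure set. -/
lemma positivity_of_comparable (hη : 0 < η) (hP₀ : P₀ ∈ boundedModel 𝒴 𝒜 𝒲 η C) {K : Set ℝ}
    (hK : MeasurableSet K) (hK0 : exposureLaw P₀ K ≠ 0)
    (hle : (P : Measure (Obs d)) ≤ ENNReal.ofReal 3 • (P₀ : Measure (Obs d)))
    (hge : (P₀ : Measure (Obs d)).restrict ((fun o => o.2.1) ⁻¹' K)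
      ≤ ENNReal.ofReal 2 • (P : Measure (Obs d)))
    (hKc : exposureLaw P Kᶜ = 0) :
    jointLaw P ≪ (exposureLaw P).prod (covariateLaw P) ∧
    (exposureLaw P).prod (covariateLaw P) ≤ ENNReal.ofReal (η / 18)⁻¹ • jointLaw P := by
  set V : Set (ℝ × (Fin d → ℝ)) := K ×ˢ univ with hV
  have hVm : MeasurableSet V := hK.prod MeasurableSet.univ
  have hJ0 : (jointLaw P₀).restrict V ≤ ENNReal.ofReal 2 • jointLaw P := by
    have : (jointLaw P₀).restrict V
        = ((P₀ : Measure (Obs d)).restrict ((fun o => o.2.1) ⁻¹' K)).map Prod.snd := by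
      rw [jointLaw, Measure.restrict_map measurable_snd hVm]
      congr 2
      ext o; simp [hV]
    rw [this, jointLaw, ← Measure.map_smul]
    exact Measure.map_mono hge measurable_snd
  have hN : (exposureLaw P₀).prod (covariateLaw P₀) ≤ ENNReal.ofReal η⁻¹ • jointLaw P₀ :=
    prod_le_smul_jointLaw hη hP₀
  have hFr : exposureLaw P = (exposureLaw P).restrict K :=
    (Measure.restrict_eq_self_of_ae_mem (mem_ae_iff.2 hKc)).symm
  have hprodr : ((exposureLaw P₀).restrict K).prod (covariateLaw P₀)
      = ((exposureLaw P₀).prod (covariateLaw P₀)).restrict V := by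
    rw [hV, ← Measure.prod_restrict, Measure.restrict_univ]
  constructor
  · have hF : (exposureLaw P₀).restrict K ≪ exposureLaw P := by
      have : (exposureLaw P₀).restrict K ≤ ENNReal.ofReal 2 • exposureLaw P := by
        have h2 : (exposureLaw P₀).restrict K
            = ((P₀ : Measure (Obs d)).restrict ((fun o => o.2.1) ⁻¹' K)).map (fun o => o.2.1) := by
          rw [exposureLaw, Measure.restrict_map (by fun_prop) hK]
        rw [h2, exposureLaw, ← Measure.map_smul]
        exact Measure.map_mono hge (by fun_prop)
      exact (Measure.absolutelyContinuous_of_le this).trans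
        (Measure.smul_absolutelyContinuous)
    -- Positivity of `g₀` is essential: if `K × t` is null for the joint law under `P₀`, then `F₀(K)
    -- Q₀(t) = 0`, and `F₀(K) ≠ 0`.
    have hQ : covariateLaw P₀ ≪ covariateLaw P := by
      refine Measure.AbsolutelyContinuous.mk fun t ht ht0 => ?_
      have h1 : jointLaw P (univ ×ˢ t) = 0 := by
        rw [← map_snd_jointLaw, Measure.map_apply measurable_snd ht] at ht0
        rwa [univ_prod]
      have h2 : jointLaw P₀ (K ×ˢ t) = 0 := by
        have h3 := hJ0 (univ ×ˢ t)
        rw [Measure.smul_apply, h1, smul_zero, Measure.restrict_apply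
          (MeasurableSet.univ.prod ht), nonpos_iff_eq_zero] at h3
        rw [← h3]
        congr 1
        ext z; simp [hV, and_comm]
      have h4 := hN (K ×ˢ t)
      rw [Measure.smul_apply, h2, smul_zero, nonpos_iff_eq_zero, Measure.prod_prod,
        mul_eq_zero] at h4
      exact h4.resolve_left hK0
    have h5 : jointLaw P = (jointLaw P).restrict V := by
      refine (Measure.restrict_eq_self_of_ae_mem ?_).symm
      have : jointLaw P Vᶜ = 0 := by
        rw [← map_fst_jointLaw, Measure.map_apply measurable_fst hK.compl] at hKc
        rw [← hKc]; congr 1; ext z; simp [hV]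
      exact mem_ae_iff.2 this
    have h6 : jointLaw P ≪ (exposureLaw P₀).prod (covariateLaw P₀) :=
      ((Measure.absolutelyContinuous_of_le (jointLaw_mono hle)).trans
        Measure.smul_absolutelyContinuous).trans (jointLaw_absolutelyContinuous hP₀)
    rw [h5]
    refine (h6.restrict V).trans ?_
    rw [← hprodr]
    exact hF.prod hQ
  -- The constant `18` is `3 · 3 · 2`: both marginals are at most `3` times those of `P₀`, and on
  -- `K` the joint law of `P₀` is at most twice that of `P`.
  · calc (exposureLaw P).prod (covariateLaw P)
        ≤ (ENNReal.ofReal 3 • (exposureLaw P₀).restrict K).prod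
            (ENNReal.ofReal 3 • covariateLaw P₀) := by
          refine Measure.prod_mono ?_ (covariateLaw_mono hle)
          rw [hFr, ← Measure.restrict_smul]
          exact Measure.restrict_mono_measure (exposureLaw_mono hle) K
      _ = ENNReal.ofReal 9 • ((exposureLaw P₀).prod (covariateLaw P₀)).restrict V := by
          rw [Measure.prod_smul_left, Measure.prod_smul_right, smul_smul, hprodr,
            ← ENNReal.ofReal_mul (by norm_num)]
          norm_num
      _ ≤ ENNReal.ofReal 9 • (ENNReal.ofReal η⁻¹ • jointLaw P₀).restrict V := by
          gcongr
      _ = ENNReal.ofReal (9 * η⁻¹) • (jointLaw P₀).restrict V := by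
          rw [Measure.restrict_smul, smul_smul, ← ENNReal.ofReal_mul (by norm_num)]
      _ ≤ ENNReal.ofReal (9 * η⁻¹) • (ENNReal.ofReal 2 • jointLaw P) := by gcongr
      _ = ENNReal.ofReal (η / 18)⁻¹ • jointLaw P := by
          rw [smul_smul, ← ENNReal.ofReal_mul (by positivity)]
          congr 2
          field_simp
          norm_num

/-- Conditioning on an exposure set does not change the outcome regression. -/
lemma outcomeReg_ae_eq_of_restrict {P₁ : ProbabilityMeasure (Obs d)} {K : Set ℝ}
    (hK : MeasurableSet K) {c : ENNReal} (hc : c ≠ ⊤)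
    (hP : (P : Measure (Obs d))
      = c • (P₁ : Measure (Obs d)).restrict ((fun o => o.2.1) ⁻¹' K))
    (hy : Integrable (fun o : Obs d => o.1) (P₁ : Measure (Obs d))) :
    ∀ᵐ z ∂(jointLaw P), outcomeReg P z.1 z.2 = outcomeReg P₁ z.1 z.2 := by
  have hD : MeasurableSet ((fun o : Obs d => o.2.1) ⁻¹' K) := by
    exact (measurable_fst.comp measurable_snd) hK
  have hle : MeasurableSpace.comap (fun o : Obs d => o.2) inferInstance
    ≤ (inferInstance : MeasurableSpace (Obs d)) := measurable_snd.comap_le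
  have lift : ∀ {f : Obs d → ℝ}, Integrable f (P₁ : Measure (Obs d)) →
      Integrable f (P : Measure (Obs d)) := fun hf => by
    rw [hP]; exact hf.integrableOn.smul_measure hc
  have hμ1 : Integrable (fun o : Obs d => outcomeReg P₁ o.2.1 o.2.2) (P₁ : Measure (Obs d)) :=
    integrable_condExp.congr (condExp_outcome_ae_eq hy)
  have hμm : Measurable (fun o : Obs d => outcomeReg P₁ o.2.1 o.2.2) :=
    (measurable_outcomeReg P₁).comp measurable_snd
  have key : (fun o : Obs d => outcomeReg P₁ o.2.1 o.2.2) =ᵐ[(P : Measure (Obs d))]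
      (P : Measure (Obs d))[fun o : Obs d => o.1 |
        MeasurableSpace.comap (fun o : Obs d => o.2) inferInstance] := by
    -- The conditioning event is a function of `(A, W)`, so intersecting it with an event generated
    -- by `(A, W)` gives another such event, on which the tower property under `P₁` applies.
    refine ae_eq_condExp_of_forall_setIntegral_eq hle (lift hy)
      (fun s _ _ => (lift hμ1).integrableOn) ?_ ?_
    · rintro _ ⟨t, ht, rfl⟩ -
      have hs : MeasurableSet ((fun o : Obs d => o.2) ⁻¹' t) := measurable_snd ht
      have hf : Measurable ((t ∩ Prod.fst ⁻¹' K).indicator (fun _ => (1 : ℝ))) :=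
        measurable_const.indicator (ht.inter (measurable_fst hK))
      have hind : ∀ g : Obs d → ℝ, (fun o : Obs d =>
          (t ∩ Prod.fst ⁻¹' K).indicator (fun _ => (1 : ℝ)) o.2 * g o)
          = ((fun o : Obs d => o.2) ⁻¹' t ∩ (fun o : Obs d => o.2.1) ⁻¹' K).indicator g := by
        intro g
        ext o
        by_cases ho : o.2 ∈ t ∩ Prod.fst ⁻¹' K
        · rw [indicator_of_mem ho, indicator_of_mem (by exact ho), one_mul]
        · rw [indicator_of_notMem ho, indicator_of_notMem (by exact ho), zero_mul]
      have h1 := integral_mul_outcome hy hf (by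
        rw [hind]
        exact hy.indicator (hs.inter hD))
      rw [integral_jointLaw (f := fun z => (t ∩ Prod.fst ⁻¹' K).indicator (fun _ => (1 : ℝ)) z
        * outcomeReg P₁ z.1 z.2) (by fun_prop), hind,
        hind (fun o => outcomeReg P₁ o.2.1 o.2.2), integral_indicator (hs.inter hD),
        integral_indicator (hs.inter hD)] at h1
      rw [hP, Measure.restrict_smul, integral_smul_measure, integral_smul_measure,
        Measure.restrict_restrict hs, h1]
    · exact (((measurable_outcomeReg P₁).comp
        (comap_measurable (fun o : Obs d => o.2))).stronglyMeasurable).aestronglyMeasurable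
  have h2 := key.trans (condExp_outcome_ae_eq (lift hy))
  have hset : MeasurableSet {z : ℝ × (Fin d → ℝ) | outcomeReg P z.1 z.2 = outcomeReg P₁ z.1 z.2} :=
    measurableSet_eq_fun (measurable_outcomeReg P) (measurable_outcomeReg P₁)
  rw [jointLaw, ae_map_iff measurable_snd.aemeasurable hset]
  filter_upwards [h2] with o ho
  exact ho.symm

end Perturbation

/-! ### Fullness of the tangent space -/

section TangentSpace

variable {d : ℕ} {𝒴 𝒜 : Set ℝ} {𝒲 : Set (Fin d → ℝ)} {P₀ : ProbabilityMeasure (Obs d)} {η C : ℝ}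

/-- The tilt `(1 + ε k) P₀`, conditioned on a compact set of exposures on which the regression
function is continuous, stays in the model and is second-order close to the tilt. -/
lemma exists_perturbation (hη : 0 < η) (hP₀ : P₀ ∈ boundedModel 𝒴 𝒜 𝒲 η C)
    {k : Obs d → ℝ} {H ε : ℝ} (hk : Measurable k) (hkH : ∀ o, |k o| ≤ H)
    (hk0 : ∫ o, k o ∂(P₀ : Measure (Obs d)) = 0) (hε : ε ≠ 0) (hε1 : |ε| ≤ 1)
    (hεH : |ε| * H ≤ 1 / 2) :
    ∃ P : ProbabilityMeasure (Obs d), P ∈ boundedModel 𝒴 𝒜 𝒲 (η / 18) (3 * C) ∧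
      ∫⁻ o, ENNReal.ofReal
        (((√((P : Measure (Obs d)).rnDeriv ((P : Measure (Obs d)) + (P₀ : Measure (Obs d))) o).toReal
            - √((P₀ : Measure (Obs d)).rnDeriv
              ((P : Measure (Obs d)) + (P₀ : Measure (Obs d))) o).toReal) / ε
          - (1 / 2) * k o * √((P₀ : Measure (Obs d)).rnDeriv
              ((P : Measure (Obs d)) + (P₀ : Measure (Obs d))) o).toReal) ^ 2)
        ∂((P : Measure (Obs d)) + (P₀ : Measure (Obs d)))
      ≤ ENNReal.ofReal (ε ^ 2 * (H + 2) ^ 4 + ε ^ 2) := by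
  have hki : Integrable k (P₀ : Measure (Obs d)) :=
    (L2Bound.of_bounded hk.aestronglyMeasurable (Eventually.of_forall hkH)).integrable
  have hε2 : ε ^ 2 ≤ 1 := by rw [← sq_abs]; nlinarith [abs_nonneg ε]
  set w : Obs d → ℝ := fun o => 1 + ε * k o with hw
  have hwm : Measurable w := by fun_prop
  have hwb : ∀ o, 1 / 2 ≤ w o ∧ w o ≤ 3 / 2 := fun o => by
    have h1 : |ε * k o| ≤ 1 / 2 := by
      rw [abs_mul]
      exact (mul_le_mul_of_nonneg_left (hkH o) (abs_nonneg _)).trans hεH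
    have h2 := abs_le.1 h1
    constructor <;> simp only [hw] <;> linarith [h2.1, h2.2]
  have hwi : Integrable w (P₀ : Measure (Obs d)) := (integrable_const 1).add (hki.const_mul ε)
  have hw1 : ∫ o, w o ∂(P₀ : Measure (Obs d)) = 1 := by
    rw [hw, integral_add (integrable_const 1) (hki.const_mul ε), integral_const_mul, hk0]
    simp
  -- the tilted distribution
  set Q : Measure (Obs d) := (P₀ : Measure (Obs d)).withDensity fun o => ENNReal.ofReal (w o)
    with hQ
  have hQp : IsProbabilityMeasure Q := ⟨by
    rw [hQ, withDensity_apply _ MeasurableSet.univ, Measure.restrict_univ,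
      ← ofReal_integral_eq_lintegral_ofReal hwi (Eventually.of_forall fun o =>
        (by norm_num : (0 : ℝ) ≤ 1 / 2).trans (hwb o).1), hw1, ENNReal.ofReal_one]⟩
  set P₁ : ProbabilityMeasure (Obs d) := ⟨Q, hQp⟩ with hP₁
  have hQle : Q ≤ ENNReal.ofReal (3 / 2) • (P₀ : Measure (Obs d)) := by
    rw [hQ, ← withDensity_const]
    exact withDensity_mono (Eventually.of_forall fun o => ENNReal.ofReal_le_ofReal (hwb o).2)
  have hQge : (P₀ : Measure (Obs d)) ≤ ENNReal.ofReal 2 • Q := by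
    have h1 : ENNReal.ofReal (1 / 2) • (P₀ : Measure (Obs d)) ≤ Q := by
      rw [hQ, ← withDensity_const]
      exact withDensity_mono (Eventually.of_forall fun o => ENNReal.ofReal_le_ofReal (hwb o).1)
    calc (P₀ : Measure (Obs d))
        = ENNReal.ofReal 2 • (ENNReal.ofReal (1 / 2) • (P₀ : Measure (Obs d))) := by
          rw [smul_smul, ← ENNReal.ofReal_mul (by norm_num)]; norm_num
      _ ≤ _ := by gcongr
  have hy : Integrable (fun o : Obs d => o.1) (P₁ : Measure (Obs d)) :=
    ((l2Bound_outcome hP₀).of_measure_le (by norm_num) hQle).integrable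
  have hμ1 : Integrable (fun z : ℝ × (Fin d → ℝ) => outcomeReg P₁ z.1 z.2)
      ((exposureLaw P₀).prod (covariateLaw P₀)) := by
    have h1 : Integrable (fun o : Obs d => outcomeReg P₁ o.2.1 o.2.2) (P₁ : Measure (Obs d)) :=
      integrable_condExp.congr (condExp_outcome_ae_eq hy)
    have h2 : Integrable (fun z : ℝ × (Fin d → ℝ) => outcomeReg P₁ z.1 z.2) (jointLaw P₁) :=
      (integrable_map_measure (measurable_outcomeReg P₁).aestronglyMeasurable
        measurable_snd.aemeasurable).2 h1
    have h3 : Integrable (fun z : ℝ × (Fin d → ℝ) => outcomeReg P₁ z.1 z.2) (jointLaw P₀) :=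
      (h2.smul_measure ENNReal.ofReal_ne_top).mono_measure (jointLaw_mono (P₀ := P₁) hQge)
    exact (h3.smul_measure ENNReal.ofReal_ne_top).mono_measure (prod_le_smul_jointLaw hη hP₀)
  -- Outside `K` the density is set to zero, which costs up to `4/ε²` pointwise in the
  -- quadratic-mean integral; mass `ε⁴/4` reduces this to `ε²`.
  obtain ⟨K, hK, hKc, hcont⟩ := exists_isCompact_continuousOn_integral (exposureLaw P₀)
    (covariateLaw P₀) (measurable_outcomeReg P₁) hμ1 (show 0 < ε ^ 4 / 4 by positivity)
  have hKm : MeasurableSet K := hK.isClosed.measurableSet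
  set D : Set (Obs d) := (fun o => o.2.1) ⁻¹' K with hD
  have hDm : MeasurableSet D := (measurable_fst.comp measurable_snd) hKm
  have hDc : (P₀ : Measure (Obs d)) Dᶜ ≤ ENNReal.ofReal (ε ^ 4 / 4) := by
    rw [exposureLaw, Measure.map_apply (by fun_prop) hKm.compl] at hKc
    exact hKc
  have hε4 : ε ^ 4 ≤ ε ^ 2 := by nlinarith [sq_nonneg ε]
  -- the normalizing constant
  set Z : ℝ := Q.real D with hZ
  have hZ1 : Z ≤ 1 := measureReal_le_one
  have hZc : 1 - Z ≤ ε ^ 2 / 2 := by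
    have h1 : Q Dᶜ ≤ ENNReal.ofReal (3 / 2 * (ε ^ 4 / 4)) := by
      refine (hQle Dᶜ).trans ?_
      rw [Measure.smul_apply, smul_eq_mul, ENNReal.ofReal_mul (by norm_num)]
      gcongr
    have h2 := ENNReal.toReal_le_of_le_ofReal (by positivity) h1
    have h3 : Q.real Dᶜ = 1 - Z := probReal_compl_eq_one_sub hDm
    rw [measureReal_def] at h3
    rw [← h3]
    linarith
  have hZ2 : 1 / 2 ≤ Z := by linarith
  have hZ0 : 0 < Z := by linarith
  have hQD : Q D = ENNReal.ofReal Z := (ofReal_measureReal (measure_ne_top Q D)).symm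
  -- the perturbed distribution
  set p : Obs d → ℝ := D.indicator fun o => w o / Z with hp
  have hpm : Measurable p := (hwm.div_const Z).indicator hDm
  have hp0 : ∀ o, 0 ≤ p o := fun o => by
    refine indicator_nonneg (fun o _ => div_nonneg ?_ hZ0.le) o
    linarith [(hwb o).1]
  have hp3 : ∀ o, p o ≤ 3 := fun o => by
    by_cases ho : o ∈ D
    · rw [hp, indicator_of_mem ho, div_le_iff₀ hZ0]
      linarith [(hwb o).2]
    · rw [hp, indicator_of_notMem ho]; norm_num
  set R : Measure (Obs d) := (P₀ : Measure (Obs d)).withDensity fun o => ENNReal.ofReal (p o)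
    with hR
  have hRQ : R = ENNReal.ofReal Z⁻¹ • Q.restrict D := by
    rw [hQ, restrict_withDensity hDm, ← withDensity_smul _ hwm.ennreal_ofReal,
      ← withDensity_indicator hDm, hR]
    congr 1
    ext o
    by_cases ho : o ∈ D
    · simp only [hp, indicator_of_mem ho, Pi.smul_apply, smul_eq_mul]
      rw [← ENNReal.ofReal_mul (by positivity), div_eq_inv_mul]
    · simp only [hp, indicator_of_notMem ho, ENNReal.ofReal_zero]
  have hRp : IsProbabilityMeasure R := ⟨by
    rw [hRQ, Measure.smul_apply, Measure.restrict_apply_univ, hQD, smul_eq_mul,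
      ← ENNReal.ofReal_mul (by positivity), inv_mul_cancel₀ hZ0.ne', ENNReal.ofReal_one]⟩
  set P : ProbabilityMeasure (Obs d) := ⟨R, hRp⟩ with hP
  have hle : (P : Measure (Obs d)) ≤ ENNReal.ofReal 3 • (P₀ : Measure (Obs d)) := by
    change R ≤ _
    rw [hR, ← withDensity_const]
    exact withDensity_mono (Eventually.of_forall fun o => ENNReal.ofReal_le_ofReal (hp3 o))
  have hge : (P₀ : Measure (Obs d)).restrict D ≤ ENNReal.ofReal 2 • (P : Measure (Obs d)) := by
    change _ ≤ ENNReal.ofReal 2 • R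
    rw [hRQ, smul_smul, ← ENNReal.ofReal_mul (by norm_num)]
    calc (P₀ : Measure (Obs d)).restrict D ≤ (ENNReal.ofReal 2 • Q).restrict D :=
          Measure.restrict_mono_measure hQge D
      _ = ENNReal.ofReal 2 • Q.restrict D := Measure.restrict_smul _ _ _
      _ ≤ _ := by
          gcongr
          linarith [(one_le_inv₀ hZ0).2 hZ1]
  have hPKc : exposureLaw P Kᶜ = 0 := by
    rw [exposureLaw, Measure.map_apply (by fun_prop) hKm.compl]
    change R Dᶜ = 0
    rw [hRQ, Measure.smul_apply, Measure.restrict_apply hDm.compl]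
    simp
  have hK0 : exposureLaw P₀ K ≠ 0 := by
    intro h0
    rw [exposureLaw, Measure.map_apply (by fun_prop) hKm] at h0
    have h1 : Q D = 0 := withDensity_absolutelyContinuous _ _ h0
    rw [hQD, ENNReal.ofReal_eq_zero] at h1
    linarith
  obtain ⟨hac, hpos⟩ := positivity_of_comparable hη hP₀ hKm hK0 hle hge hPKc
  have hacw := exposureCondLaw_ae_absolutelyContinuous hac
  refine ⟨P, ⟨⟨?_, fun a => ∫ w, outcomeReg P₁ a w ∂(covariateLaw P), ?_, ?_, ?_⟩, hacw,
    ae_le_propensity (by positivity) hacw hpos, ?_⟩, ?_⟩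
  · exact ((Measure.absolutelyContinuous_of_le hle).trans
      Measure.smul_absolutelyContinuous).ae_le hP₀.1.1
  · exact (hcont (covariateLaw P) _ ENNReal.ofReal_ne_top (covariateLaw_mono hle)).mono
      (Measure.support_subset_of_isClosed hK.isClosed (mem_ae_iff.2 hPKc))
  · obtain ⟨B, hB⟩ := hK.exists_bound_of_continuousOn
      (hcont (covariateLaw P) _ ENNReal.ofReal_ne_top (covariateLaw_mono hle))
    exact ⟨B, fun a ha => hB a
      (Measure.support_subset_of_isClosed hK.isClosed (mem_ae_iff.2 hPKc) ha)⟩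
  -- The regressions agree almost everywhere for the joint law of `P`; positivity transfers this to
  -- the product law, where it can be integrated in `w`.
  · have h1 := outcomeReg_ae_eq_of_restrict (P := P) (P₁ := P₁) hKm ENNReal.ofReal_ne_top hRQ hy
    have h2 := ((Measure.absolutelyContinuous_of_le hpos).trans
      Measure.smul_absolutelyContinuous).ae_le h1
    filter_upwards [Measure.ae_ae_of_ae_prod h2] with a ha
    exact integral_congr_ae ha
  · exact ((l2Bound_outcome hP₀).of_measure_le (by norm_num) hle).le
  · refine (lintegral_sqrt_rnDeriv_withDensity R (P₀ : Measure (Obs d)) hpm hp0 hR hk ε).trans_le ?_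
    have hb : ∀ o, ENNReal.ofReal (((√(p o) - 1) / ε - (1 / 2) * k o) ^ 2)
        ≤ ENNReal.ofReal (ε ^ 2 * (H + 2) ^ 4)
          + Dᶜ.indicator (fun _ => ENNReal.ofReal (4 / ε ^ 2)) o := by
      intro o
      by_cases ho : o ∈ D
      · refine le_add_right (ENNReal.ofReal_le_ofReal ?_)
        rw [hp, indicator_of_mem ho]
        exact sq_sqrt_density_sub_le hε hε1 (hkH o) hεH hZ1 hZc
      · refine le_add_left ?_
        rw [indicator_of_mem (by exact ho)]
        refine ENNReal.ofReal_le_ofReal ?_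
        rw [hp, indicator_of_notMem ho, Real.sqrt_zero, ← sq_abs]
        have h1 : |(0 - 1) / ε - 1 / 2 * k o| ≤ 2 / |ε| := by
          have h2 : |k o| ≤ 1 / |ε| := by
            rw [le_div_iff₀ (abs_pos.2 hε), mul_comm]
            exact (mul_le_mul_of_nonneg_left (hkH o) (abs_nonneg _)).trans (hεH.trans (by norm_num))
          calc |(0 - 1) / ε - 1 / 2 * k o| ≤ |(0 - 1) / ε| + |1 / 2 * k o| := abs_sub _ _
            _ = 1 / |ε| + 1 / 2 * |k o| := by
                rw [abs_div, abs_mul, abs_of_pos (show (0 : ℝ) < 1 / 2 by norm_num)]; simp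
            _ ≤ 1 / |ε| + 1 / |ε| := by linarith [abs_nonneg (k o)]
            _ = 2 / |ε| := by ring
        calc |(0 - 1) / ε - 1 / 2 * k o| ^ 2 ≤ (2 / |ε|) ^ 2 :=
              pow_le_pow_left₀ (abs_nonneg _) h1 2
          _ = 4 / ε ^ 2 := by rw [div_pow, sq_abs]; norm_num
    calc ∫⁻ o, ENNReal.ofReal (((√(p o) - 1) / ε - (1 / 2) * k o) ^ 2) ∂(P₀ : Measure (Obs d))
        ≤ ∫⁻ o, (ENNReal.ofReal (ε ^ 2 * (H + 2) ^ 4)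
          + Dᶜ.indicator (fun _ => ENNReal.ofReal (4 / ε ^ 2)) o) ∂(P₀ : Measure (Obs d)) :=
          lintegral_mono hb
      _ = ENNReal.ofReal (ε ^ 2 * (H + 2) ^ 4)
          + ENNReal.ofReal (4 / ε ^ 2) * (P₀ : Measure (Obs d)) Dᶜ := by
          rw [lintegral_add_left measurable_const, lintegral_indicator hDm.compl]
          simp
      _ ≤ ENNReal.ofReal (ε ^ 2 * (H + 2) ^ 4)
          + ENNReal.ofReal (4 / ε ^ 2) * ENNReal.ofReal (ε ^ 4 / 4) := by gcongr
      _ = ENNReal.ofReal (ε ^ 2 * (H + 2) ^ 4 + ε ^ 2) := by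
          rw [← ENNReal.ofReal_mul (by positivity), ← ENNReal.ofReal_add (by positivity)
            (by positivity)]
          congr 2
          field_simp

/-- Every bounded mean-zero function is the score of a regular path. -/
lemma exists_regularPath_of_bounded (hη : 0 < η) (hC : 0 ≤ C)
    (hP₀ : P₀ ∈ boundedModel 𝒴 𝒜 𝒲 η C) {k : Obs d → ℝ} {H : ℝ} (hk : Measurable k)
    (hkH : ∀ o, |k o| ≤ H) (hk0 : ∫ o, k o ∂(P₀ : Measure (Obs d)) = 0)
    (hkL : MemLp k 2 (P₀ : Measure (Obs d))) :
    ∃ P ∈ regularPaths 𝒴 𝒜 𝒲, IsDQM P₀ P (hkL.toLp k) := by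
  have hH : 0 ≤ H := (abs_nonneg _).trans (hkH (0, 0, 0))
  -- Ensures `|ε| ≤ 1` and `|ε| H ≤ 1/2`, as `exists_perturbation` requires; the `+ 1` covers `H =
  -- 0`.
  set δ : ℝ := min 1 (1 / (2 * (H + 1))) with hδ
  have hδ0 : 0 < δ := by positivity
  have hδH : ∀ ε : ℝ, |ε| ≤ δ → |ε| ≤ 1 ∧ |ε| * H ≤ 1 / 2 := fun ε hε => by
    refine ⟨hε.trans (min_le_left _ _), ?_⟩
    have h1 := hε.trans (min_le_right _ _)
    rw [le_div_iff₀ (by positivity)] at h1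
    nlinarith [abs_nonneg ε]
  have hex : ∀ ε : ℝ, ∃ P : ProbabilityMeasure (Obs d), (ε = 0 → P = P₀) ∧
      (ε ≠ 0 → |ε| ≤ δ → P ∈ boundedModel 𝒴 𝒜 𝒲 (η / 18) (3 * C) ∧ _) := fun ε => by
    by_cases h : ε ≠ 0 ∧ |ε| ≤ δ
    · obtain ⟨P, hP⟩ := exists_perturbation hη hP₀ hk hkH hk0 h.1 (hδH ε h.2).1 (hδH ε h.2).2
      exact ⟨P, fun h0 => absurd h0 h.1, fun _ _ => hP⟩
    · exact ⟨P₀, fun _ => rfl, fun h1 h2 => absurd ⟨h1, h2⟩ h⟩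
  choose P hPz hP using hex
  refine ⟨P, ⟨δ, hδ0, η / 18, by positivity, 3 * C, fun ε hε => ?_⟩, hPz 0 rfl, ?_⟩
  · rcases eq_or_ne ε 0 with rfl | h0
    · rw [hPz 0 rfl]
      exact boundedModel_mono (by linarith) (by linarith) hP₀
    · exact (hP ε h0 hε).1
  · have hlim : Tendsto (fun ε : ℝ => ENNReal.ofReal (ε ^ 2 * (H + 2) ^ 4 + ε ^ 2)) (𝓝[≠] 0)
        (𝓝 0) := by
      have hc : Continuous fun ε : ℝ => ENNReal.ofReal (ε ^ 2 * (H + 2) ^ 4 + ε ^ 2) :=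
        ENNReal.continuous_ofReal.comp (by fun_prop)
      have := hc.tendsto 0
      simp only [ne_eq, OfNat.ofNat_ne_zero, not_false_eq_true, zero_pow, zero_mul, add_zero,
        ENNReal.ofReal_zero] at this
      exact this.mono_left nhdsWithin_le_nhds
    refine tendsto_of_tendsto_of_tendsto_of_le_of_le' tendsto_const_nhds hlim
      (Eventually.of_forall fun _ => zero_le) ?_
    have hδ' := eventually_abs_mul_le 1 hδ0
    filter_upwards [hδ', self_mem_nhdsWithin] with ε h1 h2
    refine le_trans (le_of_eq ?_) (hP ε h2 (by simpa using h1)).2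
    set ρ := (P ε : Measure (Obs d)) + (P₀ : Measure (Obs d)) with hR
    have : IsFiniteMeasure ρ := by rw [hR]; infer_instance
    have hac : (P₀ : Measure (Obs d)) ≪ ρ := by
      rw [hR, add_comm]; exact Measure.AbsolutelyContinuous.rfl.add_right _
    refine lintegral_congr_ae ?_
    have hk' := hkL.coeFn_toLp
    -- The representative of `hkL.toLp k` equals `k` only `P₀`-almost everywhere, not `ρ`-almost
    -- everywhere. Where they may differ the density of `P₀` vanishes, and the score is multiplied
    -- by its root.
    have h3 := ae_of_rnDeriv_ne_zero hac hk'
    filter_upwards [h3] with o ho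
    by_cases h0 : (P₀ : Measure (Obs d)).rnDeriv ρ o = 0
    · simp [h0]
    · rw [ho h0]

/-- Every square-integrable mean-zero function belongs to the tangent space. -/
lemma toLp_mem_tangentSpace (hη : 0 < η) (hC : 0 ≤ C) (hP₀ : P₀ ∈ boundedModel 𝒴 𝒜 𝒲 η C)
    {D : Obs d → ℝ} (hD : MemLp D 2 (P₀ : Measure (Obs d)))
    (hD0 : ∫ o, D o ∂(P₀ : Measure (Obs d)) = 0) :
    hD.toLp D ∈ tangentSpace (regularPaths 𝒴 𝒜 𝒲) P₀ := by
  rw [tangentSpace, ← SetLike.mem_coe, Submodule.topologicalClosure_coe, Metric.mem_closure_iff]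
  intro τ hτ
  -- Centering the bounded approximation makes it a score, and moves it little, because `D` has mean
  -- zero and so the mean of `k` is at most `τ/4` in absolute value.
  obtain ⟨k, K, hK, hk, hkK, hDk⟩ := exists_bounded_L2Bound_sub hD (show 0 < τ / 4 by positivity)
  have hki : Integrable k (P₀ : Measure (Obs d)) :=
    (L2Bound.of_bounded hk.aestronglyMeasurable (Eventually.of_forall hkK)).integrable
  set m := ∫ o, k o ∂(P₀ : Measure (Obs d)) with hm
  have hm1 : |m| ≤ τ / 4 := by
    have h1 := hDk.abs_integral_le
    rwa [integral_sub (hD.integrable (by norm_num)) hki, hD0, zero_sub, abs_neg,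
      Real.sqrt_sq (by positivity)] at h1
  have hkm : Measurable fun o => k o - m := hk.sub_const m
  have hkmK : ∀ o, |k o - m| ≤ K + |m| := fun o =>
    (abs_sub _ _).trans (add_le_add (hkK o) le_rfl)
  have hkL : MemLp (fun o => k o - m) 2 (P₀ : Measure (Obs d)) :=
    (L2Bound.of_bounded hkm.aestronglyMeasurable (Eventually.of_forall hkmK)).memLp
  have hk0 : ∫ o, (k o - m) ∂(P₀ : Measure (Obs d)) = 0 := by
    rw [integral_sub hki (integrable_const m)]; simp [hm]
  obtain ⟨P, hP, hdqm⟩ := exists_regularPath_of_bounded hη hC hP₀ hkm hkmK hk0 hkL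
  refine ⟨hkL.toLp _, Submodule.subset_span ⟨P, hP, hdqm⟩, ?_⟩
  rw [dist_eq_norm, ← MemLp.toLp_sub, Lp.norm_toLp]
  have hc : L2Bound (fun _ : Obs d => m) (P₀ : Measure (Obs d)) ((τ / 4) ^ 2) :=
    L2Bound.of_bounded aestronglyMeasurable_const (Eventually.of_forall fun _ => hm1)
  have h2 := (hDk.add hc (by positivity) (by positivity)).mono
    (show 2 * (τ / 4) ^ 2 + 2 * (τ / 4) ^ 2 ≤ (τ / 2) ^ 2 by nlinarith)
  have h3 := (h2.congr (g := D - fun o => k o - m) (Eventually.of_forall fun o => by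
    simp only [Pi.sub_apply]; ring)).eLpNorm_le
  rw [Real.sqrt_sq (by positivity)] at h3
  exact (ENNReal.toReal_le_of_le_ofReal (by positivity) h3).trans_lt (by linarith)

end TangentSpace

theorem proposition2 {d : ℕ} (𝒴 𝒜 : Set ℝ) (𝒲 : Set (Fin d → ℝ))
    (P₀ : ProbabilityMeasure (Obs d)) (hP₀ : P₀ ∈ positivityModel 𝒴 𝒜 𝒲) (a₀ : ℝ) :
    PathwiseDifferentiableAt (regularPaths 𝒴 𝒜 𝒲) (primitiveParam a₀) P₀ ∧
    IsEfficientInfluenceFunction (regularPaths 𝒴 𝒜 𝒲) (primitiveParam a₀) P₀ (eif a₀ P₀) := by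
  obtain ⟨η, hη, C', hP'⟩ := hP₀
  have hC : 0 ≤ max C' 0 := le_max_right _ _
  have hP := boundedModel_mono le_rfl (le_max_left C' 0) hP'
  have hD := memLp_eif hη hC hP a₀
  -- The required functional is the inner product with the influence function, restricted to the
  -- tangent space.
  refine ⟨⟨(innerSL ℝ (hD.toLp (eif a₀ P₀))).comp
    (tangentSpace (regularPaths 𝒴 𝒜 𝒲) P₀).subtypeL, fun P hPr h hdqm => ?_⟩,
    integral_eif hη hC hP a₀, fun P hPr h hdqm => hasDerivAt_primitiveParam hPr hdqm a₀,
    hD, toLp_mem_tangentSpace hη hC hP hD (integral_eif hη hC hP a₀)⟩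
  refine (hasDerivAt_primitiveParam hPr hdqm a₀).congr_deriv ?_
  simp only [ContinuousLinearMap.comp_apply, Submodule.subtypeL_apply, innerSL_apply_apply,
    L2.inner_def]
  refine integral_congr_ae ?_
  filter_upwards [hD.coeFn_toLp] with o ho
  rw [ho]
  simp [mul_comm]
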